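/- **Definitions.** A permutation $\sigma$ of $[n]=\{1,\dots,n\}$ is *square* if each of its points $(i,\sigma(i))$ is a record, i.e. a left-to-right maximum, a left-to-right minimum, a right-to-left maximum or a right-to-left minimum. $Sq(n)$ denotes the set of square permutations of size $n$. A *rooted permutation* is a pair $(A,\preccurlyeq)$, where $A\subseteq\mathbb Z$ is a (finite or infinite) interval of integers containing $0$ and $\preccurlyeq$ is a total order on $A$; $\tilde{\mathcal S}_\bullet$ is the set of all of them. A permutation $\sigma$ of $[n]$ with a root $i\in[n]$ is identified with $A=[-i+1,n-i]$ and $\ell\preccurlyeq j\iff\sigma(\ell+i)\le\sigma(j+i)$. Let $r_h(A,\preccurlyeq)=(A\cap[-h,h],\preccurlyeq)$. The set $\tilde{\mathcal S}_\bullet$ carries the local distance $$d(x,y)=2^{-\sup\{h\in\mathbb N\,:\,r_h(x)=r_h(y)\}},\qquad 2^{-\infty}=0,$$ and the corresponding Borel $\sigma$-algebra. For random permutations $\sigma_n$ of $[n]$, $n\ge1$, let $i_n$ be uniform in $[n]$ and independent of $\sigma_n$. We write $\sigma_n\xrightarrow{aBS}Z$ (annealed Benjamini–Schramm convergence), for a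 random element $Z$ of $\tilde{\mathcal S}_\bullet$, if $(\sigma_n,i_n)\to Z$ in distribution with respect to $d$. We write $\sigma_n\xrightarrow{qBS}\nu$ (quenched Benjamini–Schramm convergence), for a random probability measure $\nu$ on $\tilde{\mathcal S}_\bullet$, if the random measures $\mathcal Law\big((\sigma_n,i_n)\,\big|\,\sigma_n\big)$ converge to $\nu$ in distribution with respect to the weak topology on probability measures on $\tilde{\mathcal S}_\bullet$. For a labeling $\mathcal L\in\{+,-\}^{\mathbb Z}$, let $\preccurlyeq_j^{\mathcal L}$, $j\in\{1,2,3,4\}$, be the total order on $\mathbb Z$ for which every integer labeled $-$ precedes every integer labeled $+$, and in which * for $j=1$, both the $-$ and the $+$ labeled integers are in their usual order; * for $j=2$, the $-$ labeled integers are in reversed order and the $+$ labeled ones in usual order; * for $j=3$, the $-$ labeled integers are in usual order and the $+$ labeled ones in reversed order; * for $j=4$, both are in reversed order. Define $J:[0,1]^2\to\{1,2,3,4\}$ by $$J(u,v)=\begin{cases}1,&u<1/2\text{ and }u\le v\le 1-u,\\ 2,&v<\min\{u,1-u\},\\ 3,&v>\max\{u,1-u\},\\ 4,&u\ge1/2\text{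 and }1-u\le v\le u.\end{cases}$$ Let $\mathcal L$ be a Bernoulli labeling of $\mathbb Z$ (labels independent, each $+$ or $-$ with probability $1/2$), let $U,V$ be uniform on $[0,1]$, with $U,V,\mathcal L$ independent, and set $$\nu_\infty=\mathcal Law\big((\mathbb Z,\preccurlyeq^{\mathcal L}_{J(U,V)})\,\big|\,U\big).$$ Let also $K$ be uniform in $\{1,2,3,4\}$ and independent of $\mathcal L$. **Theorem.** Let $\sigma_n$ be a uniform random element of $Sq(n)$, for each $n\ge1$. Then $$\sigma_n\xrightarrow{qBS}\nu_\infty\qquad\text{and}\qquad\sigma_n\xrightarrow{aBS}(\mathbb Z,\preccurlyeq_K^{\mathcal L}).$$ -/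

import Mathlib

open MeasureTheory ProbabilityTheory Filter Set

/-- A (finite or infinite) rooted permutation: a pair `(A, ≼)` where `A` is an interval of integers
containing `0` and `≼` is a total order on `A`. The order is recorded as a relation on `ℤ` which
only relates elements of `A`, so that equal pairs are equal terms. -/
@[ext]
structure RootedPerm where
  /-- the interval `A` -/
  carrier : Set ℤ
  /-- the total order on `A` -/
  le : ℤ → ℤ → Prop
  ordConnected : carrier.OrdConnected
  zero_mem : (0 : ℤ) ∈ carrier
  le_mem : ∀ x y, le x y → x ∈ carrier ∧ y ∈ carrier
  le_refl : ∀ x ∈ carrier, le x x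
  le_antisymm : ∀ x y, le x y → le y x → x = y
  le_trans : ∀ x y z, le x y → le y z → le x z
  le_total : ∀ x ∈ carrier, ∀ y ∈ carrier, le x y ∨ le y x

namespace RootedPerm

/-- The rooted permutation attached to a permutation `σ` of size `n` and an index `i` (indices and
values are `0, …, n - 1`): the columns are shifted so that the root is in column `0`, and
`x ≼ y` iff `σ (x + i) ≤ σ (y + i)`. -/
def ofPerm {n : ℕ} (σ : Equiv.Perm (Fin n)) (i : Fin n) : RootedPerm where
  carrier := Ico (-(i : ℤ)) ((n : ℤ) - i)
  le x y := ∃ a b : Fin n, (a : ℤ) = x + i ∧ (b : ℤ) = y + i ∧ σ a ≤ σ b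
  ordConnected := ordConnected_Ico
  zero_mem := by
    have := i.isLt
    simp only [mem_Ico]
    omega
  le_mem := by
    rintro x y ⟨a, b, ha, hb, -⟩
    have := a.isLt
    have := b.isLt
    simp only [mem_Ico]
    omega
  le_refl := by
    intro x hx
    simp only [mem_Ico] at hx
    exact ⟨⟨(x + i).toNat, by omega⟩, ⟨(x + i).toNat, by omega⟩,
      by simp; omega, by simp; omega, _root_.le_refl _⟩
  le_antisymm := by
    rintro x y ⟨a, b, ha, hb, hab⟩ ⟨b', a', hb', ha', hba⟩
    have h1 : a' = a := by ext; omega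
    have h2 : b' = b := by ext; omega
    subst h1 h2
    have := σ.injective (_root_.le_antisymm hab hba)
    subst this
    omega
  le_trans := by
    rintro x y z ⟨a, b, ha, hb, hab⟩ ⟨b', c, hb', hc, hbc⟩
    have h2 : b' = b := by ext; omega
    subst h2
    exact ⟨a, c, ha, hc, hab.trans hbc⟩
  le_total := by
    intro x hx y hy
    simp only [mem_Ico] at hx hy
    have hx' : (((⟨(x + i).toNat, by omega⟩ : Fin n) : ℕ) : ℤ) = x + i := by simp; omega
    have hy' : (((⟨(y + i).toNat, by omega⟩ : Fin n) : ℕ) : ℤ) = y + i := by simp; omega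
    rcases _root_.le_total (σ ⟨(x + i).toNat, by omega⟩) (σ ⟨(y + i).toNat, by omega⟩) with h | h
    · exact Or.inl ⟨_, _, hx', hy', h⟩
    · exact Or.inr ⟨_, _, hy', hx', h⟩

/-- The `h`-restriction around the root: `(A, ≼) ↦ (A ∩ [-h, h], ≼)`. -/
def restrict (h : ℕ) (X : RootedPerm) : RootedPerm where
  carrier := X.carrier ∩ Icc (-(h : ℤ)) h
  le x y := X.le x y ∧ x ∈ Icc (-(h : ℤ)) h ∧ y ∈ Icc (-(h : ℤ)) h
  ordConnected := X.ordConnected.inter ordConnected_Icc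
  zero_mem := ⟨X.zero_mem, by simp⟩
  le_mem x y hxy := ⟨⟨(X.le_mem x y hxy.1).1, hxy.2.1⟩, ⟨(X.le_mem x y hxy.1).2, hxy.2.2⟩⟩
  le_refl x hx := ⟨X.le_refl x hx.1, hx.2, hx.2⟩
  le_antisymm x y hxy hyx := X.le_antisymm x y hxy.1 hyx.1
  le_trans x y z hxy hyz := ⟨X.le_trans x y z hxy.1 hyz.1, hxy.2.1, hyz.2.2⟩
  le_total x hx y hy := (X.le_total x hx.1 y hy.1).imp (fun h => ⟨h, hx.2, hy.2⟩)
    (fun h => ⟨h, hy.2, hx.2⟩)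

open Classical in
/-- The local distance `2 ^ (-sup {h : r_h X = r_h Y})`, with `2 ^ (-∞) = 0`. The supremum is
infinite exactly when `X = Y`; otherwise it is over a bounded set of natural numbers. -/
noncomputable def localDist (X Y : RootedPerm) : ℝ :=
  if X = Y then 0 else (1 / 2 : ℝ) ^ sSup {h : ℕ | restrict h X = restrict h Y}

theorem eq_of_le {X Y : RootedPerm} (h : ∀ x y, X.le x y ↔ Y.le x y) : X = Y := by
  have hle : X.le = Y.le := by
    funext x y
    exact propext (h x y)
  have hc : X.carrier = Y.carrier := by
    ext x
    exact ⟨fun hx => (Y.le_mem x x ((h x x).1 (X.le_refl x hx))).1,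
      fun hx => (X.le_mem x x ((h x x).2 (Y.le_refl x hx))).1⟩
  exact RootedPerm.ext hc hle

theorem restrict_eq_iff {h : ℕ} {X Y : RootedPerm} :
    restrict h X = restrict h Y ↔
      ∀ x ∈ Icc (-(h : ℤ)) h, ∀ y ∈ Icc (-(h : ℤ)) h, (X.le x y ↔ Y.le x y) := by
  constructor
  · intro H x hx y hy
    have : (restrict h X).le x y ↔ (restrict h Y).le x y := by rw [H]
    simpa only [restrict, hx, hy, and_true] using this
  · intro H
    apply eq_of_le
    intro x y
    simp only [restrict]
    constructor
    · rintro ⟨h1, h2, h3⟩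
      exact ⟨(H x h2 y h3).1 h1, h2, h3⟩
    · rintro ⟨h1, h2, h3⟩
      exact ⟨(H x h2 y h3).2 h1, h2, h3⟩

theorem restrict_eq_mono {h k : ℕ} (hk : h ≤ k) {X Y : RootedPerm}
    (H : restrict k X = restrict k Y) : restrict h X = restrict h Y := by
  rw [restrict_eq_iff] at H ⊢
  intro x hx y hy
  simp only [mem_Icc] at hx hy
  exact H x (by simp only [mem_Icc]; omega) y (by simp only [mem_Icc]; omega)

theorem eq_of_restrict {X Y : RootedPerm} (H : ∀ h, restrict h X = restrict h Y) : X = Y := by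
  apply eq_of_le
  intro x y
  have := restrict_eq_iff.1 (H (x.natAbs + y.natAbs))
  exact this x (by simp only [mem_Icc]; omega) y (by simp only [mem_Icc]; omega)

theorem restrict_zero (X Y : RootedPerm) : restrict 0 X = restrict 0 Y := by
  rw [restrict_eq_iff]
  intro x hx y hy
  simp only [mem_Icc] at hx hy
  obtain rfl : x = 0 := by omega
  obtain rfl : y = 0 := by omega
  exact ⟨fun _ => Y.le_refl 0 Y.zero_mem, fun _ => X.le_refl 0 X.zero_mem⟩

theorem le_sSup_iff {X Y : RootedPerm} (hXY : X ≠ Y) (h : ℕ) :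
    h ≤ sSup {h : ℕ | restrict h X = restrict h Y} ↔ restrict h X = restrict h Y := by
  have hb : BddAbove {h : ℕ | restrict h X = restrict h Y} := by
    by_contra hb
    apply hXY
    apply eq_of_restrict
    intro h
    rw [bddAbove_def] at hb
    push Not at hb
    obtain ⟨k, hk, hk'⟩ := hb h
    exact restrict_eq_mono hk'.le hk
  constructor
  · intro H
    exact restrict_eq_mono H (Nat.sSup_mem ⟨0, restrict_zero X Y⟩ hb)
  · intro H
    exact le_csSup hb H

theorem localDist_le_iff {X Y : RootedPerm} (h : ℕ) :
    localDist X Y ≤ (1 / 2 : ℝ) ^ h ↔ restrict h X = restrict h Y := by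
  unfold localDist
  split_ifs with H
  · subst H
    simp
  · rw [← le_sSup_iff H]
    exact pow_le_pow_iff_right_of_lt_one₀ (by norm_num) (by norm_num)

theorem localDist_le_max (X Y Z : RootedPerm) :
    localDist X Z ≤ max (localDist X Y) (localDist Y Z) := by
  by_cases h1 : X = Y
  · subst h1
    exact le_max_right _ _
  by_cases h2 : Y = Z
  · subst h2
    exact le_max_left _ _
  have key : ∀ m : ℕ, localDist X Y ≤ (1 / 2 : ℝ) ^ m → localDist Y Z ≤ (1 / 2 : ℝ) ^ m →
      localDist X Z ≤ (1 / 2 : ℝ) ^ m := by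
    intro m hm hm'
    rw [localDist_le_iff] at *
    exact hm.trans hm'
  rcases _root_.le_total (localDist X Y) (localDist Y Z) with h | h
  · rw [max_eq_right h]
    have e : localDist Y Z = (1 / 2 : ℝ) ^ sSup {h : ℕ | restrict h Y = restrict h Z} := if_neg h2
    rw [e] at h ⊢
    exact key _ h e.le
  · rw [max_eq_left h]
    have e : localDist X Y = (1 / 2 : ℝ) ^ sSup {h : ℕ | restrict h X = restrict h Y} := if_neg h1
    rw [e] at h ⊢
    exact key _ e.le h

theorem localDist_nonneg (X Y : RootedPerm) : 0 ≤ localDist X Y := by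
  unfold localDist
  split_ifs <;> positivity

/-- The metric space of all rooted permutations with the local distance. -/
noncomputable instance : MetricSpace RootedPerm where
  dist := localDist
  dist_self X := by simp [localDist]
  dist_comm X Y := by
    have e : {h : ℕ | restrict h X = restrict h Y} = {h : ℕ | restrict h Y = restrict h X} := by
      ext h
      exact eq_comm
    by_cases hXY : X = Y
    · rw [hXY]
    · rw [localDist, localDist, if_neg hXY, if_neg (Ne.symm hXY), e]
  dist_triangle X Y Z := (localDist_le_max X Y Z).trans
    (max_le_add_of_nonneg (localDist_nonneg X Y) (localDist_nonneg Y Z))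
  eq_of_dist_eq_zero {X Y} h := by
    by_contra hXY
    have e : localDist X Y = (1 / 2 : ℝ) ^ sSup {h : ℕ | restrict h X = restrict h Y} := if_neg hXY
    have h' : localDist X Y = 0 := h
    rw [e] at h'
    exact absurd h' (by positivity)

/-- Rooted permutations carry the Borel `σ`-algebra of the local distance. -/
noncomputable instance : MeasurableSpace RootedPerm := borel RootedPerm

instance : BorelSpace RootedPerm := ⟨rfl⟩

instance : Nonempty RootedPerm := ⟨ofPerm (n := 1) 1 0⟩

/-- Boolean relations on `ℤ` which are total orders on an interval containing `0`. -/
def codes : Set (ℤ → ℤ → Bool) :=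
  {f | f 0 0 = true ∧ (∀ x y, f x y = true → f x x = true ∧ f y y = true) ∧
    (∀ x y z, x ≤ y → y ≤ z → f x x = true → f z z = true → f y y = true) ∧
    (∀ x y, f x y = true → f y x = true → x = y) ∧
    (∀ x y z, f x y = true → f y z = true → f x z = true) ∧
    (∀ x y, f x x = true → f y y = true → f x y = true ∨ f y x = true)}

theorem isClosed_codes : IsClosed codes := by
  have ev : ∀ x y : ℤ, Continuous fun f : ℤ → ℤ → Bool => f x y := by
    intro x y
    fun_prop
  have clo : ∀ x y : ℤ, IsClopen {f : ℤ → ℤ → Bool | f x y = true} := by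
    intro x y
    exact (isClopen_discrete ({true} : Set Bool)).preimage (ev x y)
  have imp : ∀ {p q : (ℤ → ℤ → Bool) → Prop}, IsOpen {f | p f} → IsClosed {f | q f} →
      IsClosed {f | p f → q f} := fun hp hq => isClosed_imp hp hq
  have all : ∀ {ι : Type} {p : ι → (ℤ → ℤ → Bool) → Prop}, (∀ i, IsClosed {f | p i f}) →
      IsClosed {f | ∀ i, p i f} := by
    intro ι p hp
    have : {f | ∀ i, p i f} = ⋂ i, {f | p i f} := by
      ext
      simp
    rw [this]
    exact isClosed_iInter hp
  refine (clo 0 0).1.inter (IsClosed.inter ?_ (IsClosed.inter ?_ (IsClosed.inter ?_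
    (IsClosed.inter ?_ ?_))))
  · exact all fun x => all fun y => imp (clo x y).2 ((clo x x).1.inter (clo y y).1)
  · exact all fun x => all fun y => all fun z => imp isOpen_const (imp isOpen_const
      (imp (clo x x).2 (imp (clo z z).2 (clo y y).1)))
  · exact all fun x => all fun y => imp (clo x y).2 (imp (clo y x).2 isClosed_const)
  · exact all fun x => all fun y => all fun z =>
      imp (clo x y).2 (imp (clo y z).2 (clo x z).1)
  · exact all fun x => all fun y =>
      imp (clo x x).2 (imp (clo y y).2 ((clo x y).1.union (clo y x).1))

/-- The rooted permutation described by a Boolean relation. -/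
def ofCode (f : codes) : RootedPerm where
  carrier := {x | f.1 x x = true}
  le x y := f.1 x y = true
  ordConnected := ⟨fun x hx z hz y hy => f.2.2.2.1 x y z hy.1 hy.2 hx hz⟩
  zero_mem := f.2.1
  le_mem := f.2.2.1
  le_refl _ hx := hx
  le_antisymm := f.2.2.2.2.1
  le_trans := f.2.2.2.2.2.1
  le_total x hx y hy := f.2.2.2.2.2.2 x y hx hy

theorem surjective_ofCode : Function.Surjective ofCode := by
  classical
  intro X
  refine ⟨⟨fun x y => decide (X.le x y), ?_⟩, ?_⟩
  · simp only [codes, mem_ofPred_eq, decide_eq_true_eq]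
    refine ⟨X.le_refl 0 X.zero_mem, ?_, ?_, X.le_antisymm, X.le_trans, ?_⟩
    · intro x y h
      exact ⟨X.le_refl _ (X.le_mem x y h).1, X.le_refl _ (X.le_mem x y h).2⟩
    · intro x y z hxy hyz hx hz
      exact X.le_refl y (X.ordConnected.out (X.le_mem x x hx).1 (X.le_mem z z hz).1 ⟨hxy, hyz⟩)
    · intro x y hx hy
      exact X.le_total x (X.le_mem x x hx).1 y (X.le_mem y y hy).1
  · apply eq_of_le
    intro x y
    simp [ofCode]

theorem continuous_ofCode : Continuous ofCode := by
  rw [Metric.continuous_iff']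
  intro f ε hε
  obtain ⟨h, hh⟩ := exists_pow_lt_of_lt_one hε (by norm_num : (1 / 2 : ℝ) < 1)
  have H : ∀ᶠ g : codes in nhds f, ∀ x ∈ Icc (-(h : ℤ)) h, ∀ y ∈ Icc (-(h : ℤ)) h,
      g.1 x y = f.1 x y := by
    rw [eventually_all_finite (finite_Icc _ _)]
    intro x _
    rw [eventually_all_finite (finite_Icc _ _)]
    intro y _
    have hc : Continuous fun g : ℤ → ℤ → Bool => g x y := by fun_prop
    have hc' : Continuous fun g : codes => g.1 x y := hc.comp continuous_subtype_val
    exact hc'.continuousAt.eventually_mem ((isOpen_discrete {f.1 x y}).mem_nhds rfl)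
  filter_upwards [H] with g hg
  refine lt_of_le_of_lt ?_ hh
  refine (localDist_le_iff h).2 (restrict_eq_iff.2 ?_)
  intro x hx y hy
  simp [ofCode, hg x hx y hy]

instance : CompactSpace RootedPerm := by
  have : CompactSpace codes := isCompact_iff_compactSpace.1 isClosed_codes.isCompact
  refine ⟨?_⟩
  rw [← surjective_ofCode.range_eq]
  exact isCompact_range continuous_ofCode

end RootedPerm

/-- On a compact metrizable space, the usual `σ`-algebra on probability measures contains the open
sets of the weak topology, so that weak convergence of random probability measures makes sense. -/
theorem opensMeasurableSpace_probabilityMeasure (E : Type*) [TopologicalSpace E] [CompactSpace E]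
    [TopologicalSpace.MetrizableSpace E] [MeasurableSpace E] [BorelSpace E] :
    OpensMeasurableSpace (ProbabilityMeasure E) := by
  let _ := TopologicalSpace.metrizableSpaceMetric (ProbabilityMeasure E)
  let ev : BoundedContinuousFunction E NNReal → ProbabilityMeasure E → NNReal :=
    fun f μ => (∫⁻ x, f x ∂(μ : Measure E)).toNNReal
  have hev : ∀ f, Measurable (ev f) := by
    intro f
    have h1 : Measurable fun μ : Measure E => ∫⁻ x, (f x : ENNReal) ∂μ :=
      Measure.measurable_lintegral (by
        exact measurable_coe_nnreal_ennreal.comp f.continuous.measurable)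
    exact (h1.comp measurable_subtype_coe).ennreal_toNNReal
  have htop : ProbabilityMeasure.instTopologicalSpace =
      TopologicalSpace.generateFrom {s | ∃ f, ∃ u : Set NNReal, IsOpen u ∧ s = ev f ⁻¹' u} := by
    apply le_antisymm
    · apply le_generateFrom
      rintro s ⟨f, u, hu, rfl⟩
      exact hu.preimage (ProbabilityMeasure.continuous_testAgainstNN_eval f)
    · apply le_of_nhds_le_nhds
      intro μ
      change Tendsto id _ _
      refine ProbabilityMeasure.tendsto_nhds_iff_toFiniteMeasure_tendsto_nhds _ |>.2 ?_
      refine FiniteMeasure.tendsto_iff_forall_toWeakDualBCNN_tendsto.2 ?_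
      intro f
      rw [tendsto_nhds]
      intro u hu hμ
      have ho := TopologicalSpace.isOpen_generateFrom_of_mem (s := ev f ⁻¹' u)
        (g := {s | ∃ f, ∃ u : Set NNReal, IsOpen u ∧ s = ev f ⁻¹' u}) ⟨f, u, hu, rfl⟩
      exact @IsOpen.mem_nhds _ (TopologicalSpace.generateFrom _) _ _ ho hμ
  refine ⟨?_⟩
  rw [borel_eq_generateFrom_of_subbasis htop]
  refine MeasurableSpace.generateFrom_le ?_
  rintro s ⟨f, u, hu, rfl⟩
  exact hev f hu.measurableSet

instance : OpensMeasurableSpace (ProbabilityMeasure RootedPerm) :=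
  opensMeasurableSpace_probabilityMeasure RootedPerm

instance (n : ℕ) : MeasurableSpace (Equiv.Perm (Fin n)) := ⊤

/-- `Sq(n)`, the square permutations of size `n`: every point is a record, that is, a left-to-right
maximum, a left-to-right minimum, a right-to-left maximum or a right-to-left minimum. -/
def squarePerms (n : ℕ) : Set (Equiv.Perm (Fin n)) :=
  {σ | ∀ i, (∀ j, j < i → σ j < σ i) ∨ (∀ j, j < i → σ i < σ j) ∨
    (∀ j, i < j → σ j < σ i) ∨ (∀ j, i < j → σ i < σ j)}

/-- The regular conditional law of `Y` given `X`, as a random probability measure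
(a function of `X`; determined up to almost sure equality). -/
noncomputable def condLaw {Ω S T : Type*} [MeasurableSpace Ω] [MeasurableSpace S]
    [StandardBorelSpace S] [Nonempty S] [MeasurableSpace T] (Y : Ω → S) (X : Ω → T)
    (P : Measure Ω) [IsProbabilityMeasure P] : Ω → ProbabilityMeasure S :=
  fun ω => ⟨condDistrib Y X P (X ω), inferInstance⟩

/-- Annealed Benjamini–Schramm convergence of random permutations `σ n` of size `n`, where `i n` is
a uniform root independent of `σ n`, to the random rooted permutation `Z`: convergence in
distribution of `(σ n, i n)` to `Z` for the local distance. -/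
def TendstoAnnealedBS {Ω : ℕ+ → Type*} [∀ n, MeasurableSpace (Ω n)] (P : ∀ n, Measure (Ω n))
    [∀ n, IsProbabilityMeasure (P n)] (σ : ∀ n : ℕ+, Ω n → Equiv.Perm (Fin n))
    (i : ∀ n : ℕ+, Ω n → Fin n) {Ω' : Type*} [MeasurableSpace Ω'] (P' : Measure Ω')
    [IsProbabilityMeasure P'] (Z : Ω' → RootedPerm) : Prop :=
  TendstoInDistribution (fun n ω => RootedPerm.ofPerm (σ n ω) (i n ω)) atTop Z P P'

/-- Quenched Benjamini–Schramm convergence of random permutations `σ n` of size `n`, where `i n` is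
a uniform root independent of `σ n`, to the random probability measure `ν`: convergence in
distribution of the conditional laws of `(σ n, i n)` given `σ n` to `ν`, for the weak topology. -/
def TendstoQuenchedBS {Ω : ℕ+ → Type*} [∀ n, MeasurableSpace (Ω n)] (P : ∀ n, Measure (Ω n))
    [∀ n, IsProbabilityMeasure (P n)] (σ : ∀ n : ℕ+, Ω n → Equiv.Perm (Fin n))
    (i : ∀ n : ℕ+, Ω n → Fin n) {Ω' : Type*} [MeasurableSpace Ω'] (P' : Measure Ω')
    [IsProbabilityMeasure P'] (ν : Ω' → ProbabilityMeasure RootedPerm) : Prop :=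
  TendstoInDistribution
    (fun n => condLaw (fun ω => RootedPerm.ofPerm (σ n ω) (i n ω)) (σ n) (P n)) atTop ν P P'

/-- The four total orders on `ℤ` attached to a labeling `L` of `ℤ` by `+` (`true`) and `-`
(`false`). All `-` labeled integers precede all `+` labeled ones; the order among integers of equal
label is kept or reversed. The indices `0, 1, 2, 3 : Fin 4` stand for the cases `1, 2, 3, 4`. -/
def labelLE : Fin 4 → (ℤ → Bool) → ℤ → ℤ → Prop
  | 0, L, x, y => x = y ∨ (x < y ∧ L x = false ∧ L y = false) ∨
      (x < y ∧ L x = true ∧ L y = true) ∨ (L x = false ∧ L y = true)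
  | 1, L, x, y => x = y ∨ (x > y ∧ L x = false ∧ L y = false) ∨
      (x < y ∧ L x = true ∧ L y = true) ∨ (L x = false ∧ L y = true)
  | 2, L, x, y => x = y ∨ (x < y ∧ L x = false ∧ L y = false) ∨
      (x > y ∧ L x = true ∧ L y = true) ∨ (L x = false ∧ L y = true)
  | 3, L, x, y => x = y ∨ (x > y ∧ L x = false ∧ L y = false) ∨
      (x > y ∧ L x = true ∧ L y = true) ∨ (L x = false ∧ L y = true)

/-- The infinite rooted permutation `(ℤ, ≼_j^L)`. -/
def labelPerm (j : Fin 4) (L : ℤ → Bool) : RootedPerm where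
  carrier := univ
  le := labelLE j L
  ordConnected := ordConnected_univ
  zero_mem := mem_univ _
  le_mem _ _ _ := ⟨mem_univ _, mem_univ _⟩
  le_refl x _ := by fin_cases j <;> exact Or.inl rfl
  le_antisymm x y := by
    fin_cases j <;> cases hx : L x <;> cases hy : L y <;> simp [labelLE, hx, hy] <;> omega
  le_trans x y z := by
    fin_cases j <;> cases hx : L x <;> cases hy : L y <;> cases hz : L z <;>
      simp [labelLE, hx, hy, hz] <;> grind
  le_total x _ y _ := by
    fin_cases j <;> cases hx : L x <;> cases hy : L y <;> simp [labelLE, hx, hy] <;> omega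

open Classical in
/-- The map `J : [0,1]² → {1,2,3,4}`, again with `0, 1, 2, 3 : Fin 4` standing for `1, 2, 3, 4`.
On `[0,1]²` the last case is exactly `u ≥ 1/2` and `1 - u ≤ v ≤ u`. -/
noncomputable def caseJ (u v : ℝ) : Fin 4 :=
  if u < 1 / 2 ∧ u ≤ v ∧ v ≤ 1 - u then 0
  else if v < min u (1 - u) then 1
  else if v > max u (1 - u) then 2
  else 3

/-! A large square permutation follows the boundary of a tilted rectangle. If its lowest point is in
column `z`, the left-to-right minima descend from about `(0, z)` to `(z, 0)` and the right-to-left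
minima climb on to about `(n, n - z)`; the left-to-right maxima climb from about `(0, z)` to `(n -
z, n)` and the right-to-left maxima descend from there to `(n, n - z)`. The permutation can be
recovered from `z` and two words: `X` tells for each column whether its point is on the lower or the
upper boundary, `Y` tells for each row whether its point is on the left or the right boundary. Each
of the four sides is monotone, so nothing else is free and rows are found by matching prefix counts
(`isRow_of_mem_squarePerms`, `injOn_encode`).

Conversely, most triples `(X, Y, z)` arise once five letters have their forced values. If all
prefixes of both words are balanced up to `t` and `z` is far from the ends on the scale `t`, the
matching rule defines a permutation within `O(t)` of the rectangle, it is square, and it encodes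
back to the same triple (`exists_perm_isRow`, `IsRow.encode_eq`). An exponential moment bound with
`t` of order `n ^ (3/4)` shows that irregular triples number `o(n * 4 ^ n)`. Hence about `4 ^ n /
32` square permutations have their lowest point in a given column, in the summed sense of
`sum_abs_squareCount_sub_le`: `z / n` is asymptotically uniform, and any event that is rare among
all words remains rare for square permutations.

Near a root `i` away from the four corners, one sees a stretch of one lower side and of one upper
side, the former entirely below the latter. The local order is therefore one of the four label
orders, applied to the letters of `X` around `i`; which one depends only on the position of `i`
relative to `z` and to `n - z` (`restrict_ofPerm_of_isRow`). A second moment bound shows that letter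
patterns are equidistributed among the roots of each type, and the proportion of roots of each type
is the law of `J(z / n, V)`. So, outside a negligible set of `σ`, the law of `σ` at a uniform root
is close on local sets to `limitLaw (z / n)` (`abs_rootedLaw_sub_limitLaw_le`).

Compactness upgrades closeness on local sets to closeness under any continuous functional `F`
(`exists_local_control`). The average of `F (limitLaw (z / n))` over nearly uniform `z` is a Riemann
sum for `∫ F (limitLaw u) du`, which is the quenched limit. The annealed limit is the case where `F`
integrates a fixed test function: averaged over `u`, each of the four types has probability `1/4`.
-/

/-! ### Prefix counts of two-letter words -/

/-- The number of positions before `m` at which the word `X` has the letter `b`. -/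
def prefixCount {n : ℕ} (X : Fin n → Bool) (b : Bool) (m : ℕ) : ℕ :=
  (Finset.univ.filter fun a : Fin n => X a = b ∧ (a : ℕ) < m).card

section prefixCount

variable {n : ℕ} (X : Fin n → Bool) (b : Bool)

theorem prefixCount_mono {m m' : ℕ} (h : m ≤ m') : prefixCount X b m ≤ prefixCount X b m' := by
  apply Finset.card_le_card
  intro a
  simp only [Finset.mem_filter, Finset.mem_univ, true_and]
  exact fun ha => ⟨ha.1, by omega⟩

theorem prefixCount_add_card {m m' : ℕ} (h : m ≤ m') :
    prefixCount X b m' = prefixCount X b m +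
      (Finset.univ.filter fun a : Fin n => X a = b ∧ m ≤ (a : ℕ) ∧ (a : ℕ) < m').card := by
  unfold prefixCount
  rw [← Finset.card_union_of_disjoint]
  · congr 1
    ext a
    simp only [Finset.mem_filter, Finset.mem_univ, true_and, Finset.mem_union]
    constructor
    · rintro ⟨h1, h2⟩
      rcases lt_or_ge (a : ℕ) m with h3 | h3
      · exact Or.inl ⟨h1, h3⟩
      · exact Or.inr ⟨h1, h3, h2⟩
    · rintro (⟨h1, h2⟩ | ⟨h1, h2, h3⟩)
      · exact ⟨h1, by omega⟩
      · exact ⟨h1, h3⟩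
  · rw [Finset.disjoint_left]
    intro a
    simp only [Finset.mem_filter, Finset.mem_univ, true_and]
    rintro ⟨-, h1⟩ ⟨-, h2, -⟩
    omega

theorem prefixCount_succ (a : Fin n) :
    prefixCount X b (a + 1) = prefixCount X b a + if X a = b then 1 else 0 := by
  rw [prefixCount_add_card X b (Nat.le_succ a)]
  congr 1
  split_ifs with h
  · rw [Finset.card_eq_one]
    refine ⟨a, ?_⟩
    ext c
    simp only [Finset.mem_filter, Finset.mem_univ, true_and, Finset.mem_singleton]
    constructor
    · rintro ⟨-, h1, h2⟩
      ext
      omega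
    · rintro rfl
      exact ⟨h, le_rfl, Nat.lt_succ_self _⟩
  · rw [Finset.card_eq_zero, Finset.filter_eq_empty_iff]
    rintro c - ⟨h1, h2, h3⟩
    obtain rfl : c = a := by
      ext
      omega
    exact h h1

theorem prefixCount_succ_of_eq {a : Fin n} (h : X a = b) :
    prefixCount X b (a + 1) = prefixCount X b a + 1 := by
  rw [prefixCount_succ, if_pos h]

theorem prefixCount_zero : prefixCount X b 0 = 0 := by
  simp [prefixCount]

theorem prefixCount_lt {a c : Fin n} (hac : a < c) (h : X a = b) :
    prefixCount X b a < prefixCount X b c := by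
  have h1 := prefixCount_succ_of_eq X b h
  have h2 : prefixCount X b (a + 1) ≤ prefixCount X b c := prefixCount_mono X b hac
  omega

theorem prefixCount_lt_length {a : Fin n} (h : X a = b) :
    prefixCount X b a < prefixCount X b n := by
  have h1 := prefixCount_succ_of_eq X b h
  have h2 : prefixCount X b (a + 1) ≤ prefixCount X b n := prefixCount_mono X b a.isLt
  omega

theorem eq_of_prefixCount_eq {a c : Fin n} (ha : X a = b) (hc : X c = b)
    (h : prefixCount X b a = prefixCount X b c) : a = c := by
  rcases lt_trichotomy a c with h1 | h1 | h1
  · have := prefixCount_lt X b h1 ha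
    omega
  · exact h1
  · have := prefixCount_lt X b h1 hc
    omega

theorem lt_of_prefixCount_lt {a c : Fin n}
    (h : prefixCount X b a < prefixCount X b c) : a < c := by
  by_contra h1
  have := prefixCount_mono X b (not_lt.1 h1 : (c : ℕ) ≤ a)
  omega

theorem prefixCount_true_add_false {m : ℕ} (hm : m ≤ n) :
    prefixCount X true m + prefixCount X false m = m := by
  induction m with
  | zero => simp [prefixCount_zero]
  | succ m ih =>
    have h1 := prefixCount_succ X true ⟨m, hm⟩
    have h2 := prefixCount_succ X false ⟨m, hm⟩
    have h3 := ih (Nat.le_of_succ_le hm)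
    cases h : X ⟨m, hm⟩ <;> simp only [h] at h1 h2 <;> simp at h1 h2 <;> omega

/-- A discrete intermediate value property: the count grows by steps of one, so every rank below its
final value is attained at a position carrying the letter `b`. This is how points are placed in
prescribed rows. -/
theorem exists_prefixCount_eq {c : ℕ} {m : ℕ} (hm : m ≤ n) (h : c < prefixCount X b m) :
    ∃ a : Fin n, X a = b ∧ prefixCount X b a = c := by
  induction m with
  | zero => simp [prefixCount_zero] at h
  | succ m ih =>
    by_cases h1 : c < prefixCount X b m
    · exact ih (Nat.le_of_succ_le hm) h1
    · have h2 := prefixCount_succ X b ⟨m, hm⟩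
      by_cases h3 : X ⟨m, hm⟩ = b
      · rw [if_pos h3] at h2
        exact ⟨⟨m, hm⟩, h3, by simp at h2 ⊢; omega⟩
      · rw [if_neg h3] at h2
        simp at h2
        omega

end prefixCount

/-! ### The encoding of square permutations by two words and a position -/

/-- `v` is the row of the point in column `i` prescribed by the column labels `X`, the row labels
`Y` and the column `z` of the lowest point. -/
def IsRow {n : ℕ} (X Y : Fin n → Bool) (z i v : Fin n) : Prop :=
  (X i = false ∧ i ≤ z ∧ Y v = false ∧
    prefixCount Y false v + prefixCount X false (i + 1) = prefixCount X false (z + 1)) ∨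
  (X i = false ∧ z < i ∧ Y v = true ∧
    prefixCount Y true v + prefixCount X false (z + 1) = prefixCount X false i) ∨
  (X i = true ∧ Y v = false ∧
    prefixCount Y false v = prefixCount X false (z + 1) + prefixCount X true i) ∨
  (X i = true ∧ Y v = true ∧
    prefixCount Y true v + prefixCount X false (z + 1) + prefixCount X true (i + 1) = n)

/-- A letter of `Y` together with its rank pins down a row. The only competition is, for an upper
column, between a left and a right row; both cannot be available, since the two ranks add up to `n -
1` while each lies below the number of rows of its kind. -/
theorem IsRow.eq {n : ℕ} {X Y : Fin n → Bool} {z i v w : Fin n} (hv : IsRow X Y z i v)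
    (hw : IsRow X Y z i w) : v = w := by
  have key : ∀ v w : Fin n, X i = true → Y v = false → Y w = true →
      prefixCount Y false v = prefixCount X false (z + 1) + prefixCount X true i →
      prefixCount Y true w + prefixCount X false (z + 1) + prefixCount X true (i + 1) = n →
      False := by
    intro v w hX h1 h2 h3 h4
    have h5 := prefixCount_lt_length Y _ h1
    have h6 := prefixCount_lt_length Y _ h2
    have h7 := prefixCount_true_add_false Y le_rfl
    have h8 := prefixCount_succ_of_eq X _ hX
    omega
  rcases hv with ⟨a1, a2, a3, a4⟩ | ⟨a1, a2, a3, a4⟩ | ⟨a1, a3, a4⟩ | ⟨a1, a3, a4⟩ <;>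
  rcases hw with ⟨b1, b2, b3, b4⟩ | ⟨b1, b2, b3, b4⟩ | ⟨b1, b3, b4⟩ | ⟨b1, b3, b4⟩
  · exact eq_of_prefixCount_eq Y _ a3 b3 (by omega)
  · exact absurd b2 (not_lt.2 a2)
  · simp [a1] at b1
  · simp [a1] at b1
  · exact absurd a2 (not_lt.2 b2)
  · exact eq_of_prefixCount_eq Y _ a3 b3 (by omega)
  · simp [a1] at b1
  · simp [a1] at b1
  · simp [a1] at b1
  · simp [a1] at b1
  · exact eq_of_prefixCount_eq Y _ a3 b3 (by omega)
  · exact (key _ _ a1 a3 b3 a4 b4).elim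
  · simp [a1] at b1
  · simp [a1] at b1
  · exact (key _ _ a1 b3 a3 b4 a4).elim
  · exact eq_of_prefixCount_eq Y _ a3 b3 (by omega)

/-! ### The four kinds of records and the labels they induce. -/

section Records

variable {n : ℕ} (σ : Equiv.Perm (Fin n)) (i : Fin n)

/-- The point of `σ` in column `i` is a left-to-right minimum. -/
def IsLRMin : Prop := ∀ j, j < i → σ i < σ j

/-- The point of `σ` in column `i` is a left-to-right maximum. -/
def IsLRMax : Prop := ∀ j, j < i → σ j < σ i

/-- The point of `σ` in column `i` is a right-to-left minimum. -/
def IsRLMin : Prop := ∀ j, i < j → σ i < σ j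

/-- The point of `σ` in column `i` is a right-to-left maximum. -/
def IsRLMax : Prop := ∀ j, i < j → σ j < σ i

end Records

open Classical in
/-- Column labels: `false` at the left-to-right and right-to-left minima. -/
noncomputable def columnLabel {n : ℕ} (σ : Equiv.Perm (Fin n)) (i : Fin n) : Bool :=
  !decide (IsLRMin σ i ∨ IsRLMin σ i)

open Classical in
/-- Row labels: `false` at the left-to-right minima, and at the left-to-right maxima which are not
right-to-left minima. -/
noncomputable def rowLabel {n : ℕ} (σ : Equiv.Perm (Fin n)) (v : Fin n) : Bool :=
  !decide (IsLRMin σ (σ.symm v) ∨ (IsLRMax σ (σ.symm v) ∧ ¬ IsRLMin σ (σ.symm v)))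

section Encoding

variable {n : ℕ} {σ : Equiv.Perm (Fin n)}

theorem columnLabel_eq_false {i : Fin n} :
    columnLabel σ i = false ↔ IsLRMin σ i ∨ IsRLMin σ i := by
  simp [columnLabel]

theorem columnLabel_eq_true {i : Fin n} :
    columnLabel σ i = true ↔ ¬ IsLRMin σ i ∧ ¬ IsRLMin σ i := by
  simp [columnLabel]

theorem rowLabel_eq_false {i : Fin n} :
    rowLabel σ (σ i) = false ↔ IsLRMin σ i ∨ (IsLRMax σ i ∧ ¬ IsRLMin σ i) := by
  simp [rowLabel]

theorem rowLabel_eq_true {i : Fin n} :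
    rowLabel σ (σ i) = true ↔ ¬ IsLRMin σ i ∧ (IsLRMax σ i → IsRLMin σ i) := by
  simp [rowLabel]

theorem prefixCount_row (Y : Fin n → Bool) (b : Bool) (v : Fin n) (σ : Equiv.Perm (Fin n)) :
    prefixCount Y b v = (Finset.univ.filter fun a => Y (σ a) = b ∧ σ a < v).card := by
  unfold prefixCount
  symm
  apply Finset.card_bij (fun a _ => σ a)
  · intro a
    simp
  · intro a _ c _ h
    exact σ.injective h
  · intro w hw
    exact ⟨σ.symm w, by simpa using hw, by simp⟩

theorem lt_of_lrMin_lrMax {a i : Fin n} (ha : IsLRMin σ a) (hi : IsLRMax σ i) (h : a ≠ i) :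
    σ a < σ i := by
  rcases lt_or_gt_of_ne h with h | h
  · exact hi a h
  · exact ha i h

theorem lt_of_rlMin_rlMax {a i : Fin n} (ha : IsRLMin σ a) (hi : IsRLMax σ i) (h : a ≠ i) :
    σ a < σ i := by
  rcases lt_or_gt_of_ne h with h | h
  · exact ha i h
  · exact hi a h

theorem record_cases (hσ : σ ∈ squarePerms n) (i : Fin n) :
    IsLRMax σ i ∨ IsLRMin σ i ∨ IsRLMax σ i ∨ IsRLMin σ i := hσ i

variable [NeZero n]

theorem apply_lowest_le (a : Fin n) : σ (σ.symm 0) ≤ σ a := by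
  simp

theorem IsLRMin.le_lowest {a : Fin n} (ha : IsLRMin σ a) : a ≤ σ.symm 0 := by
  by_contra h
  exact absurd (ha _ (not_le.1 h)) (not_lt.2 (apply_lowest_le a))

theorem IsRLMin.lowest_le {a : Fin n} (ha : IsRLMin σ a) : σ.symm 0 ≤ a := by
  by_contra h
  exact absurd (ha _ (not_le.1 h)) (not_lt.2 (apply_lowest_le a))

theorem isLRMin_lowest : IsLRMin σ (σ.symm 0) := by
  intro j hj
  exact lt_of_le_of_ne (apply_lowest_le j) fun h => hj.ne' (σ.injective h)

/-- All left-to-right minima are weakly left of the lowest point and all right-to-left minima weakly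
right of it, so `z` separates the two kinds that the column letter merges. -/
theorem columnLabel_eq_false_iff_of_le {a : Fin n} (ha : a ≤ σ.symm 0) :
    columnLabel σ a = false ↔ IsLRMin σ a := by
  rw [columnLabel_eq_false]
  refine ⟨fun h => h.elim id fun h => ?_, Or.inl⟩
  rw [_root_.le_antisymm ha h.lowest_le]
  exact isLRMin_lowest

theorem columnLabel_eq_false_iff_of_lt {a : Fin n} (ha : σ.symm 0 < a) :
    columnLabel σ a = false ↔ IsRLMin σ a := by
  rw [columnLabel_eq_false]
  exact ⟨fun h => h.elim (fun h => absurd h.le_lowest (not_le.2 ha)) id, Or.inr⟩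

/-- The rows of a square permutation are prescribed by its labels and its lowest point. -/
theorem isRow_of_mem_squarePerms (hσ : σ ∈ squarePerms n) (i : Fin n) :
    IsRow (columnLabel σ) (rowLabel σ) (σ.symm 0) i (σ i) := by
  set z := σ.symm 0 with hz
  cases hX : columnLabel σ i with
  | false =>
    rcases le_or_gt i z with hiz | hiz
    · left
      have hi := (columnLabel_eq_false_iff_of_le hiz).1 hX
      refine ⟨hX, hiz, rowLabel_eq_false.2 (Or.inl hi), ?_⟩
      -- Left rows below `σ i` belong exactly to the left-to-right minima in the columns from `i +
      -- 1` to `z`: a left-to-right maximum lower than `σ i` cannot be to the right of `i`, and no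
      -- point to the left of `i` is lower.
      rw [prefixCount_row _ _ _ σ, add_comm, prefixCount_add_card _ _
        (show (i : ℕ) + 1 ≤ z + 1 by simpa using hiz)]
      congr 2
      ext a
      simp only [Finset.mem_filter, Finset.mem_univ, true_and, rowLabel_eq_false]
      constructor
      · rintro ⟨h1, h2⟩
        have hia : i < a := by
          by_contra h
          rcases lt_or_eq_of_le (not_lt.1 h) with h | h
          · exact absurd (hi a h) (not_lt.2 h2.le)
          · exact absurd h2 (by simp [h])
        have ha : IsLRMin σ a := by
          rcases h1 with h1 | h1
          · exact h1
          · exact absurd (h1.1 i hia) (not_lt.2 h2.le)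
        exact ⟨columnLabel_eq_false.2 (Or.inl ha), hia, Nat.lt_succ_of_le ha.le_lowest⟩
      · rintro ⟨h1, h2, h3⟩
        have ha := (columnLabel_eq_false_iff_of_le (Nat.le_of_lt_succ h3 : a ≤ z)).1 h1
        exact ⟨Or.inl ha, ha i h2⟩
    · right; left
      have hi := (columnLabel_eq_false_iff_of_lt hiz).1 hX
      have hi' : ¬ IsLRMin σ i := fun h => absurd h.le_lowest (not_le.2 hiz)
      refine ⟨hX, hiz, rowLabel_eq_true.2 ⟨hi', fun _ => hi⟩, ?_⟩
      -- Right rows below `σ i` belong exactly to the right-to-left minima strictly between `z` and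
      -- `i`. Squareness enters here: such a point can be no other kind of record.
      rw [prefixCount_row _ _ _ σ, add_comm, prefixCount_add_card (columnLabel σ) false
        (show (z : ℕ) + 1 ≤ i from hiz)]
      congr 2
      ext a
      simp only [Finset.mem_filter, Finset.mem_univ, true_and, rowLabel_eq_true]
      constructor
      · rintro ⟨⟨h1, h1'⟩, h2⟩
        have hai : a < i := by
          by_contra h
          rcases lt_or_eq_of_le (not_lt.1 h) with h | h
          · exact absurd (hi a h) (not_lt.2 h2.le)
          · exact absurd h2 (by simp [h])
        have ha : IsRLMin σ a := by
          rcases record_cases hσ a with h | h | h | h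
          · exact h1' h
          · exact absurd h h1
          · exact absurd (h i hai) (not_lt.2 h2.le)
          · exact h
        refine ⟨columnLabel_eq_false.2 (Or.inr ha), ?_, hai⟩
        -- The lowest point is both kinds of minimum; its row is labelled as a left-to-right
        -- minimum, so it does not count among the right rows.
        refine Nat.succ_le_of_lt (lt_of_le_of_ne ha.lowest_le fun h => h1 ?_)
        rw [← Fin.ext h]
        exact isLRMin_lowest
      · rintro ⟨h1, h2, h3⟩
        have ha := (columnLabel_eq_false_iff_of_lt (Nat.lt_of_succ_le h2 : z < a)).1 h1
        exact ⟨⟨fun h => absurd h.le_lowest (not_le.2 h2), fun _ => ha⟩, ha i h3⟩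
  | true =>
    have hi := columnLabel_eq_true.1 hX
    right; right
    cases hY : rowLabel σ (σ i) with
    | false =>
      left
      have hmax : IsLRMax σ i := ((rowLabel_eq_false.1 hY).resolve_left hi.1).1
      refine ⟨hX, rfl, ?_⟩
      -- The left rows below a left-to-right maximum are those of all left-to-right minima and those
      -- of the upper columns before it.
      rw [prefixCount_row _ _ _ σ]
      unfold prefixCount
      rw [← Finset.card_union_of_disjoint]
      · congr 1
        ext a
        simp only [Finset.mem_filter, Finset.mem_univ, true_and, rowLabel_eq_false,
          Finset.mem_union]
        constructor
        · rintro ⟨h1, h2⟩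
          by_cases ha : IsLRMin σ a
          · exact Or.inl ⟨columnLabel_eq_false.2 (Or.inl ha), Nat.lt_succ_of_le ha.le_lowest⟩
          · have h1 := h1.resolve_left ha
            refine Or.inr ⟨columnLabel_eq_true.2 ⟨ha, h1.2⟩, ?_⟩
            by_contra h
            rcases lt_or_eq_of_le (not_lt.1 h) with h | h
            · exact absurd (h1.1 i h) (not_lt.2 h2.le)
            · rw [Fin.ext h] at h2
              exact absurd h2 (lt_irrefl _)
        · rintro (⟨h1, h2⟩ | ⟨h1, h2⟩)
          · have ha := (columnLabel_eq_false_iff_of_le (Nat.le_of_lt_succ h2 : a ≤ z)).1 h1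
            refine ⟨Or.inl ha, lt_of_lrMin_lrMax ha hmax ?_⟩
            rintro rfl
            exact hi.1 ha
          · have ha := columnLabel_eq_true.1 h1
            refine ⟨Or.inr ⟨?_, ha.2⟩, hmax a h2⟩
            rcases record_cases hσ a with h | h | h | h
            · exact h
            · exact absurd h ha.1
            · exact absurd (h i h2) (not_lt.2 (hmax a h2).le)
            · exact absurd h ha.2
      · rw [Finset.disjoint_left]
        intro a
        simp only [Finset.mem_filter, Finset.mem_univ, true_and]
        rintro ⟨h1, -⟩ ⟨h2, -⟩
        simp [h1] at h2
    | true =>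
      right
      have hmax : IsRLMax σ i := by
        have h1 := rowLabel_eq_true.1 hY
        rcases record_cases hσ i with h | h | h | h
        · exact absurd (h1.2 h) hi.2
        · exact absurd h hi.1
        · exact h
        · exact absurd h hi.2
      refine ⟨hX, rfl, ?_⟩
      have e1 := prefixCount_true_add_false (columnLabel σ) le_rfl
      have e2 := prefixCount_add_card (columnLabel σ) false (show (z : ℕ) + 1 ≤ n from z.isLt)
      have e3 := prefixCount_add_card (columnLabel σ) true (show (i : ℕ) + 1 ≤ n from i.isLt)
      -- The right rows below a right-to-left maximum are those of the lower columns after `z` and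
      -- those of the upper columns after `i`. Taking complements in `n` turns these suffix counts
      -- into the prefix counts of `IsRow`.
      suffices H : prefixCount (rowLabel σ) true (σ i) =
          (Finset.univ.filter fun a : Fin n => columnLabel σ a = false ∧
            (z : ℕ) + 1 ≤ a ∧ (a : ℕ) < n).card +
          (Finset.univ.filter fun a : Fin n => columnLabel σ a = true ∧
            (i : ℕ) + 1 ≤ a ∧ (a : ℕ) < n).card by omega
      rw [prefixCount_row _ _ _ σ, ← Finset.card_union_of_disjoint]
      · congr 1
        ext a
        simp only [Finset.mem_filter, Finset.mem_univ, true_and, rowLabel_eq_true,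
          Finset.mem_union, a.isLt, and_true]
        constructor
        · rintro ⟨⟨h1, h1'⟩, h2⟩
          by_cases ha : IsRLMin σ a
          · refine Or.inl ⟨columnLabel_eq_false.2 (Or.inr ha), ?_⟩
            refine Nat.succ_le_of_lt (lt_of_le_of_ne ha.lowest_le fun h => h1 ?_)
            rw [← Fin.ext h]
            exact isLRMin_lowest
          · refine Or.inr ⟨columnLabel_eq_true.2 ⟨h1, ha⟩, ?_⟩
            have ha' : IsRLMax σ a := by
              rcases record_cases hσ a with h | h | h | h
              · exact absurd (h1' h) ha
              · exact absurd h h1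
              · exact h
              · exact absurd h ha
            by_contra h
            rcases lt_or_eq_of_le (Nat.le_of_not_lt h) with h | h
            · exact absurd (ha' i h) (not_lt.2 h2.le)
            · rw [Fin.ext h] at h2
              exact absurd h2 (lt_irrefl _)
        · rintro (⟨h1, h2⟩ | ⟨h1, h2⟩)
          · have ha := (columnLabel_eq_false_iff_of_lt (Nat.lt_of_succ_le h2 : z < a)).1 h1
            refine ⟨⟨fun h => absurd h.le_lowest (not_le.2 h2), fun _ => ha⟩,
              lt_of_rlMin_rlMax ha hmax ?_⟩
            rintro rfl
            exact hi.2 ha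
          · have ha := columnLabel_eq_true.1 h1
            exact ⟨⟨ha.1, fun h => absurd (h i h2) (not_lt.2 (hmax a h2).le)⟩, hmax a h2⟩
      · rw [Finset.disjoint_left]
        intro a
        simp only [Finset.mem_filter, Finset.mem_univ, true_and]
        rintro ⟨h1, -⟩ ⟨h2, -⟩
        simp [h1] at h2

/-- The labels of a permutation together with the column of its lowest point. -/
noncomputable def encode (σ : Equiv.Perm (Fin n)) : (Fin n → Bool) × (Fin n → Bool) × Fin n :=
  (columnLabel σ, rowLabel σ, σ.symm 0)

/-- The triple prescribes the row of every column, and prescribed rows are unique. -/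
theorem injOn_encode : Set.InjOn (encode (n := n)) (squarePerms n) := by
  intro σ hσ τ hτ h
  simp only [encode, Prod.mk.injEq] at h
  ext i : 1
  have h1 := isRow_of_mem_squarePerms hσ i
  have h2 := isRow_of_mem_squarePerms hτ i
  rw [← h.1, ← h.2.1, ← h.2.2] at h2
  exact h1.eq h2

end Encoding

/-! ### Regular labels and the decoding map -/

/-- The labels are balanced up to `t` on all prefixes, and the lowest point is far from both
ends. -/
structure RegularLabels {n : ℕ} (t : ℕ) (X Y : Fin n → Bool) (z : Fin n) : Prop where
  col_le : ∀ m ≤ n, 2 * prefixCount X false m ≤ m + t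
  le_col : ∀ m ≤ n, m ≤ 2 * prefixCount X false m + t
  row_le : ∀ m ≤ n, 2 * prefixCount Y false m ≤ m + t
  le_row : ∀ m ≤ n, m ≤ 2 * prefixCount Y false m + t
  le_lowest : 100 * t + 100 ≤ z
  lowest_le : z + 100 * t + 100 ≤ n

/-- The constraints on the labels of a square permutation at the extreme columns and rows. -/
structure AdmissibleLabels {n : ℕ} [NeZero n] (X Y : Fin n → Bool) (z : Fin n) : Prop where
  col_first : X 0 = false
  col_last : X (Fin.rev 0) = false
  col_lowest : X z = false
  row_first : Y 0 = false
  row_last : Y (Fin.rev 0) = false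

section Regular

variable {n t : ℕ} {X Y : Fin n → Bool} {z : Fin n}

/-- In regular labels, a point in a `false` column `i` lies close to the row `|i - z|`. -/
theorem IsRow.near_of_false (hR : RegularLabels t X Y z) {i v : Fin n} (h : IsRow X Y z i v)
    (hX : X i = false) :
    (i ≤ z ∧ (v : ℕ) + i ≤ z + 3 * t + 3 ∧ (z : ℕ) ≤ v + i + 3 * t + 3) ∨
    (z < i ∧ (v : ℕ) + z ≤ i + 3 * t + 3 ∧ (i : ℕ) ≤ v + z + 3 * t + 3) := by
  -- After doubling, each of the three prefix counts in the row equation equals its length up to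
  -- `t`, whence `3 * t`; the extra `3` absorbs the shifts by one between strict and weak prefixes.
  have d1 := hR.col_le (i + 1) i.isLt
  have d2 := hR.le_col (i + 1) i.isLt
  have d3 := hR.col_le i i.isLt.le
  have d4 := hR.le_col i i.isLt.le
  have d5 := hR.col_le (z + 1) z.isLt
  have d6 := hR.le_col (z + 1) z.isLt
  have d7 := hR.row_le v v.isLt.le
  have d8 := hR.le_row v v.isLt.le
  have d9 := prefixCount_true_add_false Y v.isLt.le
  rcases h with ⟨a1, a2, a3, a4⟩ | ⟨a1, a2, a3, a4⟩ | ⟨a1, a3, a4⟩ | ⟨a1, a3, a4⟩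
  · exact Or.inl ⟨a2, by omega, by omega⟩
  · exact Or.inr ⟨a2, by omega, by omega⟩
  · simp [hX] at a1
  · simp [hX] at a1

/-- In regular labels, a point in a `true` column `i` lies close to the row `z + i` or close to the
row `2 n - z - i`. -/
theorem IsRow.near_of_true (hR : RegularLabels t X Y z) {i v : Fin n} (h : IsRow X Y z i v)
    (hX : X i = true) :
    (Y v = false ∧ (v : ℕ) ≤ z + i + 3 * t + 3 ∧ (z : ℕ) + i ≤ v + 3 * t + 3 ∧
      (i : ℕ) + z ≤ n + 3 * t + 3) ∨
    (Y v = true ∧ (v : ℕ) + z + i ≤ 2 * n + 3 * t + 3 ∧ 2 * n ≤ (v : ℕ) + z + i + 3 * t + 3 ∧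
      n ≤ (i : ℕ) + z + 3 * t + 3) := by
  have d1 := hR.col_le (i + 1) i.isLt
  have d2 := hR.le_col (i + 1) i.isLt
  have d3 := hR.col_le i i.isLt.le
  have d4 := hR.le_col i i.isLt.le
  have d5 := hR.col_le (z + 1) z.isLt
  have d6 := hR.le_col (z + 1) z.isLt
  have d7 := hR.row_le v v.isLt.le
  have d8 := hR.le_row v v.isLt.le
  have d9 := prefixCount_true_add_false Y v.isLt.le
  have d10 := prefixCount_true_add_false X i.isLt.le
  have d11 := prefixCount_true_add_false X (show (i : ℕ) + 1 ≤ n from i.isLt)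
  have d12 := v.isLt
  rcases h with ⟨a1, a2, a3, a4⟩ | ⟨a1, a2, a3, a4⟩ | ⟨a1, a3, a4⟩ | ⟨a1, a3, a4⟩
  · simp [hX] at a1
  · simp [hX] at a1
  · exact Or.inl ⟨a3, by omega, by omega, by omega⟩
  · exact Or.inr ⟨a3, by omega, by omega, by omega⟩

/-- Balance gives about `n / 2` rows of each kind, and the distance of `z` from both ends is what
keeps the ranks required by the lower columns below that supply. -/
theorem exists_isRow (hR : RegularLabels t X Y z) (i : Fin n) : ∃ v, IsRow X Y z i v := by
  have d1 := hR.col_le (z + 1) z.isLt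
  have d3 := hR.col_le n le_rfl
  have d4 := hR.le_col n le_rfl
  have d5 := hR.row_le n le_rfl
  have d6 := hR.le_row n le_rfl
  have d2 := hR.le_col (z + 1) z.isLt
  have d7 := hR.le_lowest
  have d8 := hR.lowest_le
  have e1 := prefixCount_true_add_false X (le_refl n)
  have e2 := prefixCount_true_add_false Y (le_refl n)
  cases hX : X i with
  | false =>
    have e3 := prefixCount_succ_of_eq X _ hX
    rcases le_or_gt i z with hi | hi
    · have m1 := prefixCount_mono X false (show (i : ℕ) + 1 ≤ z + 1 by simpa using hi)
      obtain ⟨v, hv, hv'⟩ := exists_prefixCount_eq Y false le_rfl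
        (c := prefixCount X false (z + 1) - prefixCount X false (i + 1)) (by omega)
      exact ⟨v, Or.inl ⟨hX, hi, hv, by omega⟩⟩
    · have m1 := prefixCount_mono X false (show (z : ℕ) + 1 ≤ i from hi)
      have m2 := prefixCount_lt_length X _ hX
      obtain ⟨v, hv, hv'⟩ := exists_prefixCount_eq Y true le_rfl
        (c := prefixCount X false i - prefixCount X false (z + 1)) (by omega)
      exact ⟨v, Or.inr (Or.inl ⟨hX, hi, hv, by omega⟩)⟩
  | true =>
    have e3 := prefixCount_succ_of_eq X _ hX
    have m2 := prefixCount_lt_length X _ hX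
    -- Upper columns, read from the left, use up the left rows first. Once these are exhausted, the
    -- complementary rank is available among the right rows.
    by_cases h : prefixCount X false (z + 1) + prefixCount X true i < prefixCount Y false n
    · obtain ⟨v, hv, hv'⟩ := exists_prefixCount_eq Y false le_rfl h
      exact ⟨v, Or.inr (Or.inr (Or.inl ⟨hX, hv, hv'⟩))⟩
    · have m3 := prefixCount_mono X false (show (z : ℕ) + 1 ≤ n from z.isLt)
      obtain ⟨v, hv, hv'⟩ := exists_prefixCount_eq Y true le_rfl
        (c := n - (prefixCount X false (z + 1) + prefixCount X true (i + 1))) (by omega)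
      exact ⟨v, Or.inr (Or.inr (Or.inr ⟨hX, hv, by omega⟩))⟩

/-- Rank within the left rows separates left-to-right minima (below the number of lower columns up
to `z`) from left-to-right maxima (at or above it); a similar threshold splits the right rows.
Within one side the rank determines the column. No regularity is needed. -/
theorem IsRow.injective {i j v : Fin n} (hi : IsRow X Y z i v) (hj : IsRow X Y z j v) :
    i = j := by
  have si := prefixCount_succ X false i
  have sj := prefixCount_succ X false j
  have si' := prefixCount_succ X true i
  have sj' := prefixCount_succ X true j
  have key : ∀ i j : Fin n, X i = false → z < i → X j = true →
      prefixCount Y true v + prefixCount X false (z + 1) = prefixCount X false i →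
      prefixCount Y true v + prefixCount X false (z + 1) + prefixCount X true (j + 1) = n →
      False := by
    intro i j h1 h2 h3 h4 h5
    have e1 := prefixCount_true_add_false X (le_refl n)
    have e2 := prefixCount_lt_length X _ h1
    have e3 := prefixCount_mono X true (show (j : ℕ) + 1 ≤ n from j.isLt)
    omega
  rcases hi with ⟨a1, a2, a3, a4⟩ | ⟨a1, a2, a3, a4⟩ | ⟨a1, a3, a4⟩ | ⟨a1, a3, a4⟩ <;>
  rcases hj with ⟨b1, b2, b3, b4⟩ | ⟨b1, b2, b3, b4⟩ | ⟨b1, b3, b4⟩ | ⟨b1, b3, b4⟩ <;>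
  simp only [a1, b1, a3, if_true, reduceCtorEq, if_false] at si sj si' sj' b3
  · exact eq_of_prefixCount_eq X _ a1 b1 (by omega)
  · omega
  · exact eq_of_prefixCount_eq X _ a1 b1 (by omega)
  · exact (key _ _ a1 a2 b1 a4 b4).elim
  · omega
  · exact eq_of_prefixCount_eq X _ a1 b1 (by omega)
  · exact (key _ _ b1 b2 a1 b4 a4).elim
  · exact eq_of_prefixCount_eq X _ a1 b1 (by omega)

theorem exists_perm_isRow (hR : RegularLabels t X Y z) :
    ∃ σ : Equiv.Perm (Fin n), ∀ i, IsRow X Y z i (σ i) := by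
  choose f hf using exists_isRow hR
  have hinj : Function.Injective f := fun i j h => (hf i).injective (h ▸ hf j)
  exact ⟨Equiv.ofBijective f (Finite.injective_iff_bijective.1 hinj), hf⟩

variable {σ : Equiv.Perm (Fin n)}

/-- Points in left rows are compared through their ranks. Only the comparison between a left and a
right row uses that the points stay close to the rectangle; the same scheme serves the three other
kinds of records. -/
theorem IsRow.isLRMin (hR : RegularLabels t X Y z) (h : ∀ i, IsRow X Y z i (σ i)) {i : Fin n}
    (hX : X i = false) (hi : i ≤ z) : IsLRMin σ i := by
  intro j hj
  have d8 := hR.lowest_le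
  rcases h i with ⟨a1, a2, a3, a4⟩ | ⟨a1, a2, a3, a4⟩ | ⟨a1, a3, a4⟩ | ⟨a1, a3, a4⟩
  · have e := prefixCount_mono X false (show (j : ℕ) + 1 ≤ i from hj)
    have e' := prefixCount_succ_of_eq X _ a1
    rcases h j with ⟨b1, b2, b3, b4⟩ | ⟨b1, b2, b3, b4⟩ | ⟨b1, b3, b4⟩ | ⟨b1, b3, b4⟩
    · exact lt_of_prefixCount_lt Y false (by omega)
    · omega
    · exact lt_of_prefixCount_lt Y false (by omega)
    -- Ranks of left and right rows are not comparable, so positions are used: the point in column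
    -- `j` is near height `2 * n - z - j`, the one in column `i` near `z - i`, and `z` is far from
    -- `n`.
    · rcases (h j).near_of_true hR b1 with ⟨c1, -⟩ | c1
      · simp [b3] at c1
      · rcases (h i).near_of_false hR hX with c2 | c2 <;> omega
  · exact absurd a2 (not_lt.2 hi)
  · simp [hX] at a1
  · simp [hX] at a1

theorem IsRow.isRLMin (hR : RegularLabels t X Y z) (h : ∀ i, IsRow X Y z i (σ i)) {i : Fin n}
    (hX : X i = false) (hi : z < i) : IsRLMin σ i := by
  intro j hj
  have d8 := hR.le_lowest
  rcases h i with ⟨a1, a2, a3, a4⟩ | ⟨a1, a2, a3, a4⟩ | ⟨a1, a3, a4⟩ | ⟨a1, a3, a4⟩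
  · exact absurd hi (not_lt.2 a2)
  · have e := prefixCount_mono X false (show (i : ℕ) + 1 ≤ j from hj)
    have e' := prefixCount_succ_of_eq X _ a1
    rcases h j with ⟨b1, b2, b3, b4⟩ | ⟨b1, b2, b3, b4⟩ | ⟨b1, b3, b4⟩ | ⟨b1, b3, b4⟩
    · omega
    · exact lt_of_prefixCount_lt Y true (by omega)
    · rcases (h j).near_of_true hR b1 with c1 | ⟨c1, -⟩
      · rcases (h i).near_of_false hR hX with c2 | c2 <;> omega
      · simp [b3] at c1
    · have e1 := prefixCount_true_add_false X (le_refl n)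
      have e2 := prefixCount_lt_length X _ a1
      have e3 := prefixCount_mono X true (show (j : ℕ) + 1 ≤ n from j.isLt)
      exact lt_of_prefixCount_lt Y true (by omega)
  · simp [hX] at a1
  · simp [hX] at a1

/-- There is a switching threshold: an upper column uses a left row only if fewer than (left rows)
minus (lower columns up to `z`) upper columns precede it, and a right row only if at least that many
do. -/
theorem IsRow.lt_of_true_of_rows (h : ∀ i, IsRow X Y z i (σ i)) {i j : Fin n}
    (hi : X i = true) (hj : X j = true) (hYi : Y (σ i) = false) (hYj : Y (σ j) = true) :
    i < j := by
  rcases h i with ⟨a1, a2, a3, a4⟩ | ⟨a1, a2, a3, a4⟩ | ⟨a1, a3, a4⟩ | ⟨a1, a3, a4⟩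
  · simp [hi] at a1
  · simp [hi] at a1
  · rcases h j with ⟨b1, b2, b3, b4⟩ | ⟨b1, b2, b3, b4⟩ | ⟨b1, b3, b4⟩ | ⟨b1, b3, b4⟩
    · simp [hj] at b1
    · simp [hj] at b1
    · simp [hYj] at b3
    · have e1 := prefixCount_lt_length Y _ hYi
      have e2 := prefixCount_lt_length Y _ hYj
      have e3 := prefixCount_true_add_false Y (le_refl n)
      have e4 := prefixCount_succ_of_eq X _ hj
      have e5 := prefixCount_succ_of_eq X _ hi
      by_contra hij
      rcases lt_or_eq_of_le (not_lt.1 hij) with hij | hij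
      · have := prefixCount_mono X true (show (j : ℕ) + 1 ≤ i from hij)
        omega
      · simp [hij, hYi] at hYj
  · simp [hYi] at a3

theorem IsRow.isLRMax (hR : RegularLabels t X Y z) (h : ∀ i, IsRow X Y z i (σ i)) {i : Fin n}
    (hX : X i = true) (hY : Y (σ i) = false) : IsLRMax σ i := by
  intro j hj
  have d8 := hR.le_lowest
  rcases h i with ⟨a1, a2, a3, a4⟩ | ⟨a1, a2, a3, a4⟩ | ⟨a1, a3, a4⟩ | ⟨a1, a3, a4⟩
  · simp [hX] at a1
  · simp [hX] at a1
  · rcases h j with ⟨b1, b2, b3, b4⟩ | ⟨b1, b2, b3, b4⟩ | ⟨b1, b3, b4⟩ | ⟨b1, b3, b4⟩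
    · have e4 := prefixCount_succ_of_eq X _ b1
      exact lt_of_prefixCount_lt Y false (by omega)
    · rcases (h i).near_of_true hR hX with c1 | ⟨c1, -⟩
      · rcases (h j).near_of_false hR b1 with c2 | c2 <;> omega
      · simp [hY] at c1
    · have := prefixCount_lt X _ hj b1
      exact lt_of_prefixCount_lt Y false (by omega)
    · have := IsRow.lt_of_true_of_rows h hX b1 hY b3
      exact absurd this (not_lt.2 hj.le)
  · simp [hY] at a3

theorem IsRow.isRLMax (hR : RegularLabels t X Y z) (h : ∀ i, IsRow X Y z i (σ i)) {i : Fin n}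
    (hX : X i = true) (hY : Y (σ i) = true) : IsRLMax σ i := by
  intro j hj
  have d8 := hR.lowest_le
  rcases h i with ⟨a1, a2, a3, a4⟩ | ⟨a1, a2, a3, a4⟩ | ⟨a1, a3, a4⟩ | ⟨a1, a3, a4⟩
  · simp [hX] at a1
  · simp [hX] at a1
  · simp [hY] at a3
  · rcases h j with ⟨b1, b2, b3, b4⟩ | ⟨b1, b2, b3, b4⟩ | ⟨b1, b3, b4⟩ | ⟨b1, b3, b4⟩
    · rcases (h i).near_of_true hR hX with ⟨c1, -⟩ | c1
      · simp [hY] at c1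
      · rcases (h j).near_of_false hR b1 with c2 | c2 <;> omega
    · have e1 := prefixCount_true_add_false X (le_refl n)
      have e2 := prefixCount_lt_length X _ b1
      have e3 := prefixCount_mono X true (show (i : ℕ) + 1 ≤ n from i.isLt)
      exact lt_of_prefixCount_lt Y true (by omega)
    · have := IsRow.lt_of_true_of_rows h b1 hX b3 hY
      exact absurd this (not_lt.2 hj.le)
    · have e1 := prefixCount_succ_of_eq X _ b1
      have := prefixCount_mono X true (show (i : ℕ) + 1 ≤ j from hj)
      exact lt_of_prefixCount_lt Y true (by omega)

theorem IsRow.mem_squarePerms (hR : RegularLabels t X Y z) (h : ∀ i, IsRow X Y z i (σ i)) :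
    σ ∈ squarePerms n := by
  intro i
  cases hX : X i with
  | false =>
    rcases le_or_gt i z with hi | hi
    · exact Or.inr (Or.inl (IsRow.isLRMin hR h hX hi))
    · exact Or.inr (Or.inr (Or.inr (IsRow.isRLMin hR h hX hi)))
  | true =>
    cases hY : Y (σ i) with
    | false => exact Or.inl (IsRow.isLRMax hR h hX hY)
    | true => exact Or.inr (Or.inr (Or.inl (IsRow.isRLMax hR h hX hY)))

variable [NeZero n]

/-- Row `0` satisfies the rule for column `z`, as its letter is that of a left row with nothing
below it. -/
theorem IsRow.lowest (hA : AdmissibleLabels X Y z) (h : ∀ i, IsRow X Y z i (σ i)) :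
    σ.symm 0 = z := by
  have hz : IsRow X Y z z 0 :=
    Or.inl ⟨hA.col_lowest, le_rfl, hA.row_first, by simp [prefixCount_zero]⟩
  rw [Equiv.symm_apply_eq]
  exact hz.eq (h z)

/-- Nearest lower column to the left, with only upper columns in between. Equality of counts,
together with balance, bounds its distance from `i`. -/
theorem exists_prev (hX : X 0 = false) (i : Fin n) (hi : X i = true) :
    ∃ a < i, X a = false ∧ prefixCount X false (a + 1) = prefixCount X false i := by
  have h0 := prefixCount_succ_of_eq X _ hX
  have hpos : 0 < i := Fin.pos_iff_ne_zero.2 fun h => by simp [h, hX] at hi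
  have h1 := prefixCount_mono X false (show ((0 : Fin n) : ℕ) + 1 ≤ i from hpos)
  obtain ⟨a, ha, ha'⟩ := exists_prefixCount_eq X false i.isLt.le
    (c := prefixCount X false i - 1) (by omega)
  exact ⟨a, lt_of_prefixCount_lt X false (by omega), ha, by
    rw [prefixCount_succ_of_eq X _ ha]
    omega⟩

theorem exists_next (hX : X (Fin.rev 0) = false) (i : Fin n) (hi : X i = true) :
    ∃ a > i, X a = false ∧ prefixCount X false a = prefixCount X false i := by
  have h0 := prefixCount_succ_of_eq X _ hX
  have hlt : i < Fin.rev 0 := by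
    refine lt_of_le_of_ne ?_ fun h => by simp [h, hX] at hi
    rw [Fin.le_def, Fin.val_rev]
    simp
    omega
  have h1 := prefixCount_mono X false (show (i : ℕ) ≤ (Fin.rev (0 : Fin n) : Fin n) from hlt.le)
  have h2 := prefixCount_mono X false (show ((Fin.rev (0 : Fin n) : Fin n) : ℕ) + 1 ≤ n from
    (Fin.rev (0 : Fin n)).isLt)
  obtain ⟨a, ha, ha'⟩ := exists_prefixCount_eq X false le_rfl
    (c := prefixCount X false i) (by omega)
  refine ⟨a, ?_, ha, ha'⟩
  by_contra hle
  rcases lt_or_eq_of_le (not_lt.1 hle) with hlt | heq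
  · have := prefixCount_lt X false hlt ha
    omega
  · simp [heq, hi] at ha

/-- The records of the constructed permutation contain the expected kinds by `IsRow.isLRMin` and its
analogues. What remains is to exclude accidental extra records, which could only occur near corners;
the forced letters at the extremities rule them out. -/
theorem IsRow.encode_eq (hR : RegularLabels t X Y z) (hA : AdmissibleLabels X Y z)
    (h : ∀ i, IsRow X Y z i (σ i)) : encode σ = (X, Y, z) := by
  have hz := IsRow.lowest hA h
  have d7 := hR.le_lowest
  have d8 := hR.lowest_le
  have htrue : ∀ i, X i = true → ¬ IsLRMin σ i ∧ ¬ IsRLMin σ i := by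
    intro i hX
    constructor
    · intro hmin
      have hiz : i ≤ z := hz ▸ hmin.le_lowest
      obtain ⟨a, hai, ha, hcount⟩ := exists_prev hA.col_first i hX
      have h1 := hmin a hai
      -- Equal counts and balance put `a` within about `2 * t` of `i`, too close for a point of the
      -- upper boundary at `i` to lie below the lower boundary point at `a`.
      have c1 := hR.col_le i i.isLt.le
      have c2 := hR.le_col i i.isLt.le
      have c3 := hR.col_le (a + 1) a.isLt
      have c4 := hR.le_col (a + 1) a.isLt
      rcases (h a).near_of_false hR ha with b | b
      · rcases (h i).near_of_true hR hX with c | c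
        · exact absurd h1 (not_lt.2 (IsRow.isLRMax hR h hX c.1 a hai).le)
        · omega
      · omega
    · intro hmin
      have hiz : z ≤ i := hz ▸ hmin.lowest_le
      obtain ⟨a, hai, ha, hcount⟩ := exists_next hA.col_last i hX
      have h1 := hmin a hai
      have c1 := hR.col_le i i.isLt.le
      have c2 := hR.le_col i i.isLt.le
      have c3 := hR.col_le a a.isLt.le
      have c4 := hR.le_col a a.isLt.le
      rcases (h a).near_of_false hR ha with b | b
      · omega
      · rcases (h i).near_of_true hR hX with c | c
        · omega
        · exact absurd h1 (not_lt.2 (IsRow.isRLMax hR h hX c.1 a hai).le)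
  have hcol : columnLabel σ = X := by
    funext i
    cases hX : X i with
    | false =>
      rw [columnLabel_eq_false]
      rcases le_or_gt i z with hi | hi
      · exact Or.inl (IsRow.isLRMin hR h hX hi)
      · exact Or.inr (IsRow.isRLMin hR h hX hi)
    | true => exact columnLabel_eq_true.2 (htrue i hX)
  have hrow : rowLabel σ = Y := by
    funext v
    obtain ⟨i, rfl⟩ := σ.surjective v
    rcases h i with ⟨a1, a2, a3, a4⟩ | ⟨a1, a2, a3, a4⟩ | ⟨a1, a3, a4⟩ | ⟨a1, a3, a4⟩
    · rw [a3, rowLabel_eq_false]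
      exact Or.inl (IsRow.isLRMin hR h a1 a2)
    · rw [a3, rowLabel_eq_true]
      refine ⟨fun hmin => ?_, fun _ => IsRow.isRLMin hR h a1 a2⟩
      exact absurd (hz ▸ hmin.le_lowest) (not_le.2 a2)
    · rw [a3, rowLabel_eq_false]
      exact Or.inr ⟨IsRow.isLRMax hR h a1 a3, (htrue i a1).2⟩
    · rw [a3, rowLabel_eq_true]
      refine ⟨(htrue i a1).1, fun hmax => ?_⟩
      exfalso
      -- The highest point witnesses that `i` is not a left-to-right maximum: the forced letter of
      -- the top row makes it a left row, so its column precedes every upper column with a right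
      -- row.
      obtain ⟨p, hp⟩ := σ.surjective (Fin.rev 0)
      have hpv : (σ p : ℕ) + 1 = n := by
        have := i.isLt
        rw [hp, Fin.val_rev]
        simp
        omega
      have hYp : Y (σ p) = false := by
        rw [hp]
        exact hA.row_last
      have hXp : X p = true := by
        by_contra hXp
        rcases (h p).near_of_false hR (Bool.eq_false_of_not_eq_true hXp) with b | b <;> omega
      have hpi := IsRow.lt_of_true_of_rows h hXp a1 hYp a3
      have := hmax p hpi
      have := (σ i).isLt
      omega
  simp [encode, hcol, hrow, hz]

/-- The extreme columns and rows carry records of known kinds. Regularity matters only for the top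
row, whose point is a left-to-right maximum but must also fail to be a right-to-left minimum. -/
theorem admissibleLabels_of_mem_squarePerms (hσ : σ ∈ squarePerms n)
    (hR : RegularLabels t (columnLabel σ) (rowLabel σ) (σ.symm 0)) :
    AdmissibleLabels (columnLabel σ) (rowLabel σ) (σ.symm 0) where
  col_first := columnLabel_eq_false.2 (Or.inl fun j hj => by simp at hj)
  col_last := columnLabel_eq_false.2 (Or.inr fun j hj => by
    have := j.isLt
    rw [Fin.lt_def, Fin.val_rev] at hj
    simp at hj
    omega)
  col_lowest := columnLabel_eq_false.2 (Or.inl isLRMin_lowest)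
  row_first := by
    have := rowLabel_eq_false.2 (Or.inl (isLRMin_lowest (σ := σ)))
    simpa using this
  row_last := by
    obtain ⟨p, hp⟩ := σ.surjective (Fin.rev 0)
    have hpv : (σ p : ℕ) + 1 = n := by
      have := p.isLt
      rw [hp, Fin.val_rev]
      simp
      omega
    have hmax : IsLRMax σ p := by
      intro j hj
      have h1 := (σ j).isLt
      refine lt_of_le_of_ne (Nat.le_of_lt_succ (by omega)) fun h => hj.ne (σ.injective h)
    rw [← hp, rowLabel_eq_false]
    by_contra hcon
    push Not at hcon
    -- Then the highest point would be in a lower column, but the lower sides only reach heights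
    -- about `z` and `n - z`, both far below `n`.
    have hmin := hcon.2 hmax
    have d7 := hR.le_lowest
    have d8 := hR.lowest_le
    rcases (isRow_of_mem_squarePerms hσ p).near_of_false hR
      (columnLabel_eq_false.2 (Or.inr hmin)) with b | b <;> omega

end Regular

/-! ### Local structure of square permutations with regular labels -/

/-- The labels of the integers seen from position `i` of the word `X`. -/
def shiftLabels {n : ℕ} (X : Fin n → Bool) (i : ℕ) (x : ℤ) : Bool :=
  if h : 0 ≤ x + i ∧ x + i < n then X ⟨(x + i).toNat, by omega⟩ else false

theorem shiftLabels_sub {n : ℕ} (X : Fin n → Bool) (i : ℕ) (a : Fin n) :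
    shiftLabels X i ((a : ℤ) - i) = X a := by
  have := a.isLt
  rw [shiftLabels, dif_pos (by omega)]
  congr 1
  ext
  simp

/-- The discrete version of `caseJ`, for the lowest point in column `z` and the root `i`. -/
def discreteCase (n z i : ℕ) : Fin 4 :=
  if 2 * z < n ∧ z ≤ i ∧ i + z ≤ n then 0
  else if i < z ∧ i + z < n then 1
  else if z < i ∧ n < i + z then 2
  else 3

/-- The column `i` is at distance more than `m` from the ends and from the columns of the lowest
and of the (approximate) highest point. -/
structure FarFromCorners (n m z i : ℕ) : Prop where
  le_index : m < i
  index_le : i + m < n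
  far_lowest : z + m < i ∨ i + m < z
  far_highest : i + z + m < n ∨ n + m < i + z

theorem RootedPerm.restrict_ofPerm_eq {n : ℕ} {σ : Equiv.Perm (Fin n)} {i : Fin n} {h : ℕ}
    (h1 : h ≤ i) (h2 : i + h < n) {j : Fin 4} {L : ℤ → Bool}
    (H : ∀ a b : Fin n, (i : ℕ) ≤ a + h → (a : ℕ) ≤ i + h → (i : ℕ) ≤ b + h → (b : ℕ) ≤ i + h →
      (σ a ≤ σ b ↔ labelLE j L ((a : ℤ) - (i : ℕ)) ((b : ℤ) - (i : ℕ)))) :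
    restrict h (ofPerm σ i) = restrict h (labelPerm j L) := by
  rw [restrict_eq_iff]
  intro x hx y hy
  simp only [mem_Icc] at hx hy
  set a : Fin n := ⟨(x + (i : ℕ)).toNat, by omega⟩ with ha
  set b : Fin n := ⟨(y + (i : ℕ)).toNat, by omega⟩ with hb
  have ha' : ((a : ℕ) : ℤ) = x + (i : ℕ) := by simp [ha]; omega
  have hb' : ((b : ℕ) : ℤ) = y + (i : ℕ) := by simp [hb]; omega
  have key := H a b (by omega) (by omega) (by omega) (by omega)
  rw [show ((a : ℕ) : ℤ) - (i : ℕ) = x by omega, show ((b : ℕ) : ℤ) - (i : ℕ) = y by omega] at key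
  change (∃ c d : Fin n, ((c : ℕ) : ℤ) = x + (i : ℕ) ∧ ((d : ℕ) : ℤ) = y + (i : ℕ) ∧ σ c ≤ σ d) ↔
    labelLE j L x y
  rw [← key]
  constructor
  · rintro ⟨c, d, hc, hd, hcd⟩
    rwa [show c = a by ext; omega, show d = b by ext; omega] at hcd
  · intro hab
    exact ⟨a, b, ha', hb', hab⟩

section Local

variable {n t : ℕ} {X Y : Fin n → Bool} {z : Fin n} {σ : Equiv.Perm (Fin n)}

/-- Away from the corners by much more than the `O(t)` fluctuations, the window meets exactly one
lower and one upper side. Each is monotone, and their vertical gap exceeds the fluctuations, so only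
the letters of `X` and the two slopes matter. -/
theorem restrict_ofPerm_of_isRow (hR : RegularLabels t X Y z) (hσ : ∀ i, IsRow X Y z i (σ i))
    {h : ℕ} (ht : h ≤ t) {i : Fin n} (hi : FarFromCorners n (20 * t + 20) z i) :
    RootedPerm.restrict h (RootedPerm.ofPerm σ i) =
      RootedPerm.restrict h (labelPerm (discreteCase n z i) (shiftLabels X i)) := by
  have f1 := hi.le_index
  have f2 := hi.index_le
  have f3 := hi.far_lowest
  have f4 := hi.far_highest
  have d7 := hR.le_lowest
  have d8 := hR.lowest_le
  apply RootedPerm.restrict_ofPerm_eq (by omega) (by omega)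
  intro a b ha1 ha2 hb1 hb2
  -- The vertical gap: within the window every lower point lies below every upper point.
  have hlt : ∀ a b : Fin n, (i : ℕ) ≤ a + h → (a : ℕ) ≤ i + h → (i : ℕ) ≤ b + h →
      (b : ℕ) ≤ i + h → X a = false → X b = true → σ a < σ b := by
    intro a b ha1 ha2 hb1 hb2 hXa hXb
    rcases (hσ a).near_of_false hR hXa with c | c <;>
    rcases (hσ b).near_of_true hR hXb with d | d <;> omega
  have mono : ∀ b : Bool, (∀ c d : Fin n, X c = b → X d = b → (i : ℕ) ≤ c + h →
      (d : ℕ) ≤ i + h → c < d → σ c < σ d) → ∀ c d : Fin n, X c = b → X d = b →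
      (i : ℕ) ≤ c + h → (c : ℕ) ≤ i + h → (i : ℕ) ≤ d + h → (d : ℕ) ≤ i + h →
      (σ c ≤ σ d ↔ c = d ∨ (c : ℕ) < d) := by
    intro b H c d hc hd hc1 hc2 hd1 hd2
    rcases lt_trichotomy c d with hcd | hcd | hcd
    · exact iff_of_true (H c d hc hd hc1 hd2 hcd).le (Or.inr hcd)
    · exact iff_of_true (by rw [hcd]) (Or.inl hcd)
    · exact iff_of_false (not_le.2 (H d c hd hc hd1 hc2 hcd)) (by omega)
  have anti : ∀ b : Bool, (∀ c d : Fin n, X c = b → X d = b → (i : ℕ) ≤ c + h →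
      (d : ℕ) ≤ i + h → c < d → σ d < σ c) → ∀ c d : Fin n, X c = b → X d = b →
      (i : ℕ) ≤ c + h → (c : ℕ) ≤ i + h → (i : ℕ) ≤ d + h → (d : ℕ) ≤ i + h →
      (σ c ≤ σ d ↔ c = d ∨ (d : ℕ) < c) := by
    intro b H c d hc hd hc1 hc2 hd1 hd2
    rcases lt_trichotomy c d with hcd | hcd | hcd
    · exact iff_of_false (not_le.2 (H c d hc hd hc1 hd2 hcd)) (by omega)
    · exact iff_of_true (by rw [hcd]) (Or.inl hcd)
    · exact iff_of_true (H d c hd hc hd1 hc2 hcd).le (Or.inr hcd)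
  have hYfalse : (i : ℕ) + z + (20 * t + 20) < n → ∀ c : Fin n, X c = true → (c : ℕ) ≤ i + h →
      Y (σ c) = false := by
    intro hiz c hc hc'
    rcases (hσ c).near_of_true hR hc with d | d
    · exact d.1
    · omega
  have hYtrue : n + (20 * t + 20) < i + z → ∀ c : Fin n, X c = true → (i : ℕ) ≤ c + h →
      Y (σ c) = true := by
    intro hiz c hc hc'
    rcases (hσ c).near_of_true hR hc with d | d
    · omega
    · exact d.1
  have final : ∀ (j : Fin 4) (p q : Prop),
      (X a = false → X b = false → (σ a ≤ σ b ↔ p)) →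
      (X a = true → X b = true → (σ a ≤ σ b ↔ q)) →
      (X a = false → X b = false → (p ↔ labelLE j (shiftLabels X i) (a - i) (b - i))) →
      (X a = true → X b = true → (q ↔ labelLE j (shiftLabels X i) (a - i) (b - i))) →
      (σ a ≤ σ b ↔ labelLE j (shiftLabels X i) (a - i) (b - i)) := by
    intro j p q H1 H2 H3 H4
    cases hXa : X a <;> cases hXb : X b
    · rw [H1 hXa hXb, H3 hXa hXb]
    · refine iff_of_true (hlt a b ha1 ha2 hb1 hb2 hXa hXb).le ?_
      fin_cases j <;> simp [labelLE, shiftLabels_sub, hXa, hXb]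
    · refine iff_of_false (not_le.2 (hlt b a hb1 hb2 ha1 ha2 hXb hXa)) ?_
      have : a ≠ b := fun h => by simp [h, hXb] at hXa
      have : ((a : ℕ) : ℤ) - (i : ℕ) ≠ ((b : ℕ) : ℤ) - (i : ℕ) := by omega
      fin_cases j <;> simp [labelLE, shiftLabels_sub, hXa, hXb] <;> omega
    · rw [H2 hXa hXb, H4 hXa hXb]
  -- Two independent alternatives give the four types: the side of `z` decides the slope of the
  -- lower points, the side of `n - z` that of the upper points.
  rcases f3 with f3 | f3
  · have D := mono false (fun c d hc hd hc1 _ hcd =>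
      IsRow.isRLMin hR hσ hc (show z < c by omega) d hcd) a b
    rcases f4 with f4 | f4
    · have U := mono true (fun c d hc hd _ hd2 hcd =>
        IsRow.isLRMax hR hσ hd (hYfalse f4 d hd hd2) c hcd) a b
      rw [show discreteCase n z i = 0 by rw [discreteCase, if_pos (by omega)]]
      refine final 0 _ _ (fun h1 h2 => D h1 h2 ha1 ha2 hb1 hb2)
        (fun h1 h2 => U h1 h2 ha1 ha2 hb1 hb2) ?_ ?_ <;> intro h1 h2 <;>
        simp [labelLE, shiftLabels_sub, h1, h2] <;> omega
    · have U := anti true (fun c d hc hd hc1 _ hcd =>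
        IsRow.isRLMax hR hσ hc (hYtrue f4 c hc hc1) d hcd) a b
      rw [show discreteCase n z i = 2 by
        rw [discreteCase, if_neg (by omega), if_neg (by omega), if_pos (by omega)]]
      refine final 2 _ _ (fun h1 h2 => D h1 h2 ha1 ha2 hb1 hb2)
        (fun h1 h2 => U h1 h2 ha1 ha2 hb1 hb2) ?_ ?_ <;> intro h1 h2 <;>
        simp [labelLE, shiftLabels_sub, h1, h2] <;> omega
  · have D := anti false (fun c d hc hd _ hd2 hcd =>
      IsRow.isLRMin hR hσ hd (show d ≤ z by omega) c hcd) a b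
    rcases f4 with f4 | f4
    · have U := mono true (fun c d hc hd _ hd2 hcd =>
        IsRow.isLRMax hR hσ hd (hYfalse f4 d hd hd2) c hcd) a b
      rw [show discreteCase n z i = 1 by
        rw [discreteCase, if_neg (by omega), if_pos (by omega)]]
      refine final 1 _ _ (fun h1 h2 => D h1 h2 ha1 ha2 hb1 hb2)
        (fun h1 h2 => U h1 h2 ha1 ha2 hb1 hb2) ?_ ?_ <;> intro h1 h2 <;>
        simp [labelLE, shiftLabels_sub, h1, h2] <;> omega
    · have U := anti true (fun c d hc hd hc1 _ hcd =>
        IsRow.isRLMax hR hσ hc (hYtrue f4 c hc hc1) d hcd) a b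
      rw [show discreteCase n z i = 3 by
        rw [discreteCase, if_neg (by omega), if_neg (by omega), if_neg (by omega)]]
      refine final 3 _ _ (fun h1 h2 => D h1 h2 ha1 ha2 hb1 hb2)
        (fun h1 h2 => U h1 h2 ha1 ha2 hb1 hb2) ?_ ?_ <;> intro h1 h2 <;>
        simp [labelLE, shiftLabels_sub, h1, h2] <;> omega

end Local

/-! ### Counting words -/

/-- Independence of the letters in counting form; it yields both the cylinder counts and the
exponential moments below. -/
theorem sum_prod_words {n : ℕ} (g : Fin n → Bool → ℝ) :
    ∑ X : Fin n → Bool, ∏ a, g a (X a) = ∏ a, (g a true + g a false) := by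
  have h := Finset.prod_univ_sum (fun _ : Fin n => (Finset.univ : Finset Bool)) g
  rw [Fintype.piFinset_univ] at h
  rw [← h]
  simp

theorem card_words (n : ℕ) : (Fintype.card (Fin n → Bool) : ℝ) = 2 ^ n := by
  simp

open Classical in
theorem card_words_eq_on {n : ℕ} (T : Finset (Fin n)) (g : Fin n → Bool) :
    ((Finset.univ.filter fun X : Fin n → Bool => ∀ a ∈ T, X a = g a).card : ℝ) =
      2 ^ n * (1 / 2) ^ T.card := by
  have h := sum_prod_words fun (a : Fin n) (b : Bool) => if a ∈ T → b = g a then (1 : ℝ) else 0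
  have h1 : ∀ X : Fin n → Bool, ∏ a, (if a ∈ T → X a = g a then (1 : ℝ) else 0) =
      if ∀ a ∈ T, X a = g a then 1 else 0 := by
    intro X
    rw [Finset.prod_ite_zero]
    simp
  have h2 : ∀ a : Fin n, ((if a ∈ T → true = g a then (1 : ℝ) else 0) +
      if a ∈ T → false = g a then (1 : ℝ) else 0) = 2 * if a ∈ T then 1 / 2 else 1 := by
    intro a
    by_cases ha : a ∈ T
    · cases hg : g a <;> simp [ha]
    · simp [ha]
      norm_num
  simp only [h1, h2] at h
  rw [Finset.prod_mul_distrib, Finset.prod_ite] at h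
  simp only [Finset.sum_boole, Finset.prod_const, Finset.card_univ, Fintype.card_fin, one_pow,
    mul_one, Finset.filter_univ_mem] at h
  exact h

/-! ### Deviations of prefix counts -/

theorem sum_exp_prefixCount {n m : ℕ} (hm : m ≤ n) (b : Bool) (r : ℝ) :
    ∑ X : Fin n → Bool, Real.exp (r * (2 * prefixCount X b m - m)) = 2 ^ n * Real.cosh r ^ m := by
  have h := sum_prod_words fun (a : Fin n) (c : Bool) =>
    Real.exp (if (a : ℕ) < m then (if c = b then r else -r) else 0)
  have h1 : ∀ X : Fin n → Bool, ∏ a : Fin n, Real.exp (if (a : ℕ) < m then (if X a = b then r else -r)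
      else 0) = Real.exp (r * (2 * prefixCount X b m - m)) := by
    intro X
    rw [← Real.exp_sum]
    congr 1
    have e : (m : ℝ) = ∑ a : Fin n, if (a : ℕ) < m then (1 : ℝ) else 0 := by
      rw [Finset.sum_boole, Fin.card_filter_val_lt, min_eq_right hm]
    rw [e, prefixCount, Finset.card_filter]
    push_cast
    rw [mul_sub, ← mul_assoc, Finset.mul_sum, Finset.mul_sum, ← Finset.sum_sub_distrib]
    apply Finset.sum_congr rfl
    intro a _
    by_cases h1 : (a : ℕ) < m <;> by_cases h2 : X a = b <;> simp [h1, h2]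
    ring
  have h2 : ∀ a : Fin n, (Real.exp (if (a : ℕ) < m then (if true = b then r else -r) else 0) +
      Real.exp (if (a : ℕ) < m then (if false = b then r else -r) else 0)) =
      2 * if (a : ℕ) < m then Real.cosh r else 1 := by
    intro a
    by_cases ha : (a : ℕ) < m
    · cases b <;> simp [ha, Real.cosh_eq] <;> ring
    · simp [ha]
      norm_num
  simp only [h1, h2] at h
  rw [h, Finset.prod_mul_distrib, Finset.prod_ite]
  simp [Fin.card_filter_val_lt, min_eq_right hm]

/-- Chernoff's bound, from the exponential moment and `cosh r ≤ exp (r ^ 2 / 2)`. -/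
theorem card_prefixCount_gt_le {n m : ℕ} (hm : m ≤ n) (b : Bool) (t : ℕ) :
    ((Finset.univ.filter fun X : Fin n → Bool => m + t < 2 * prefixCount X b m).card : ℝ) ≤
      2 ^ n * Real.exp (-(t : ℝ) ^ 2 / (2 * n)) := by
  rcases Nat.eq_zero_or_pos n with hn | hn
  · subst hn
    obtain rfl : m = 0 := by omega
    simp [prefixCount_zero]
  have hn' : (0 : ℝ) < n := by exact_mod_cast hn
  -- This value minimizes the exponent `n * r ^ 2 / 2 - r * t`, giving `-t ^ 2 / (2 * n)`.
  set r : ℝ := t / n with hr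
  have hr0 : 0 ≤ r := by positivity
  have h1 : ((Finset.univ.filter fun X : Fin n → Bool => m + t < 2 * prefixCount X b m).card : ℝ) *
      Real.exp (r * t) ≤ 2 ^ n * Real.cosh r ^ m := by
    rw [← sum_exp_prefixCount hm b r, ← nsmul_eq_mul, ← Finset.sum_const]
    refine (Finset.sum_le_sum fun X hX => ?_).trans
      (Finset.sum_le_sum_of_subset_of_nonneg (Finset.filter_subset _ _) fun X _ _ =>
        (Real.exp_pos _).le)
    rw [Real.exp_le_exp]
    apply mul_le_mul_of_nonneg_left _ hr0
    have h2 := (Finset.mem_filter.1 hX).2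
    have h3 : (m : ℝ) + t < 2 * prefixCount X b m := by exact_mod_cast h2
    linarith
  have h2 : Real.cosh r ^ m ≤ Real.exp (n * (r ^ 2 / 2)) := by
    calc Real.cosh r ^ m ≤ Real.exp (r ^ 2 / 2) ^ m :=
          pow_le_pow_left₀ (Real.cosh_pos r).le (Real.cosh_le_exp_half_sq r) m
      _ ≤ Real.exp (r ^ 2 / 2) ^ n :=
          pow_le_pow_right₀ (Real.one_le_exp (by positivity)) hm
      _ = _ := by rw [← Real.exp_nat_mul]
  rw [← le_div_iff₀ (Real.exp_pos _)] at h1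
  refine h1.trans ?_
  rw [div_eq_mul_inv, ← Real.exp_neg, mul_assoc]
  apply mul_le_mul_of_nonneg_left _ (by positivity)
  refine (mul_le_mul_of_nonneg_right h2 (Real.exp_pos _).le).trans ?_
  rw [← Real.exp_add, Real.exp_le_exp]
  apply le_of_eq
  rw [hr]
  field_simp
  ring

/-- All prefixes of the word `X` are balanced up to `t`. -/
def IsBalanced {n : ℕ} (t : ℕ) (X : Fin n → Bool) : Prop :=
  ∀ m ≤ n, 2 * prefixCount X false m ≤ m + t ∧ m ≤ 2 * prefixCount X false m + t

open Classical in
-- Union bound over the `n + 1` prefixes and the two signs; a deficit of one letter is an excess of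
-- the other.
theorem card_not_isBalanced_le (n t : ℕ) :
    ((Finset.univ.filter fun X : Fin n → Bool => ¬ IsBalanced t X).card : ℝ) ≤
      2 * (n + 1) * 2 ^ n * Real.exp (-(t : ℝ) ^ 2 / (2 * n)) := by
  have hsub : (Finset.univ.filter fun X : Fin n → Bool => ¬ IsBalanced t X) ⊆
      (Finset.range (n + 1)).biUnion fun m =>
        (Finset.univ.filter fun X : Fin n → Bool => m + t < 2 * prefixCount X false m) ∪
        (Finset.univ.filter fun X : Fin n → Bool => m + t < 2 * prefixCount X true m) := by
    intro X hX
    have h1 := (Finset.mem_filter.1 hX).2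
    unfold IsBalanced at h1
    push Not at h1
    obtain ⟨m, hm, h1⟩ := h1
    have h2 := prefixCount_true_add_false X hm
    simp only [Finset.mem_biUnion, Finset.mem_range, Finset.mem_union, Finset.mem_filter,
      Finset.mem_univ, true_and]
    refine ⟨m, by omega, ?_⟩
    by_cases h3 : m + t < 2 * prefixCount X false m
    · exact Or.inl h3
    · have := h1 (by omega)
      right
      omega
  have h1 := (Finset.card_le_card hsub).trans Finset.card_biUnion_le
  have h2 : ((Finset.univ.filter fun X : Fin n → Bool => ¬ IsBalanced t X).card : ℝ) ≤
      ∑ m ∈ Finset.range (n + 1), (((Finset.univ.filter fun X : Fin n → Bool =>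
        m + t < 2 * prefixCount X false m) ∪ (Finset.univ.filter fun X : Fin n → Bool =>
        m + t < 2 * prefixCount X true m)).card : ℝ) := by exact_mod_cast h1
  refine h2.trans ?_
  have h3 : ∀ m ∈ Finset.range (n + 1), (((Finset.univ.filter fun X : Fin n → Bool =>
        m + t < 2 * prefixCount X false m) ∪ (Finset.univ.filter fun X : Fin n → Bool =>
        m + t < 2 * prefixCount X true m)).card : ℝ) ≤
        2 * (2 ^ n * Real.exp (-(t : ℝ) ^ 2 / (2 * n))) := by
    intro m hm
    have hm' : m ≤ n := Nat.le_of_lt_succ (Finset.mem_range.1 hm)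
    have h4 := card_prefixCount_gt_le hm' false t
    have h5 := card_prefixCount_gt_le hm' true t
    have h6 := Finset.card_union_le (Finset.univ.filter fun X : Fin n → Bool =>
        m + t < 2 * prefixCount X false m) (Finset.univ.filter fun X : Fin n → Bool =>
        m + t < 2 * prefixCount X true m)
    have h7 : (((Finset.univ.filter fun X : Fin n → Bool =>
        m + t < 2 * prefixCount X false m) ∪ (Finset.univ.filter fun X : Fin n → Bool =>
        m + t < 2 * prefixCount X true m)).card : ℝ) ≤ ((Finset.univ.filter fun X : Fin n → Bool =>
        m + t < 2 * prefixCount X false m).card : ℝ) + ((Finset.univ.filter fun X : Fin n → Bool =>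
        m + t < 2 * prefixCount X true m).card : ℝ) := by exact_mod_cast h6
    linarith
  refine (Finset.sum_le_sum h3).trans ?_
  rw [Finset.sum_const, Finset.card_range, nsmul_eq_mul]
  push_cast
  apply le_of_eq
  ring

/-! ### Empirical frequencies of patterns -/

/-- The labels of `X` in the window of radius `h` around `i` form the pattern `w`. -/
def MatchesAt {n : ℕ} (h : ℕ) (w : ℤ → Bool) (i : ℕ) (X : Fin n → Bool) : Prop :=
  ∀ a : Fin n, i ≤ (a : ℕ) + h → (a : ℕ) ≤ i + h → X a = w ((a : ℤ) - i)

theorem card_window {n h i : ℕ} (h1 : h ≤ i) (h2 : i + h < n) :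
    (Finset.univ.filter fun a : Fin n => i ≤ (a : ℕ) + h ∧ (a : ℕ) ≤ i + h).card = 2 * h + 1 := by
  have e : (Finset.univ.filter fun a : Fin n => i ≤ (a : ℕ) + h ∧ (a : ℕ) ≤ i + h) =
      Finset.Icc (⟨i - h, by omega⟩ : Fin n) ⟨i + h, h2⟩ := by
    ext a
    simp only [Finset.mem_filter, Finset.mem_univ, true_and, Finset.mem_Icc, Fin.le_def]
    omega
  rw [e, Fin.card_Icc]
  simp only
  omega

open Classical in
theorem card_matchesAt {n h i : ℕ} (h1 : h ≤ i) (h2 : i + h < n) (w : ℤ → Bool) :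
    ((Finset.univ.filter fun X : Fin n → Bool => MatchesAt h w i X).card : ℝ) =
      2 ^ n * (1 / 2) ^ (2 * h + 1) := by
  rw [← card_window h1 h2, ← card_words_eq_on _ fun a : Fin n => w ((a : ℤ) - i)]
  congr 3
  ext X
  simp [MatchesAt]

open Classical in
theorem card_matchesAt_and {n h i j : ℕ} (h1 : h ≤ i) (h2 : i + 2 * h < j) (h3 : j + h < n)
    (w : ℤ → Bool) :
    ((Finset.univ.filter fun X : Fin n → Bool => MatchesAt h w i X ∧ MatchesAt h w j X).card : ℝ) =
      2 ^ n * ((1 / 2) ^ (2 * h + 1) * (1 / 2) ^ (2 * h + 1)) := by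
  have hd : Disjoint (Finset.univ.filter fun a : Fin n => i ≤ (a : ℕ) + h ∧ (a : ℕ) ≤ i + h)
      (Finset.univ.filter fun a : Fin n => j ≤ (a : ℕ) + h ∧ (a : ℕ) ≤ j + h) := by
    rw [Finset.disjoint_left]
    intro a
    simp only [Finset.mem_filter, Finset.mem_univ, true_and]
    omega
  have key := card_words_eq_on
    ((Finset.univ.filter fun a : Fin n => i ≤ (a : ℕ) + h ∧ (a : ℕ) ≤ i + h) ∪
      (Finset.univ.filter fun a : Fin n => j ≤ (a : ℕ) + h ∧ (a : ℕ) ≤ j + h))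
    -- As the windows are disjoint, both patterns amount to prescribing a single word on their
    -- union.
    fun a : Fin n => if (a : ℕ) ≤ i + h then w ((a : ℤ) - i) else w ((a : ℤ) - j)
  rw [Finset.card_union_of_disjoint hd, card_window h1 (by omega), card_window (by omega) h3,
    pow_add] at key
  rw [← key]
  congr 3
  ext X
  simp only [MatchesAt, Finset.mem_union, Finset.mem_filter, Finset.mem_univ, true_and]
  constructor
  · rintro ⟨H1, H2⟩ a (⟨ha1, ha2⟩ | ⟨ha1, ha2⟩)
    · rw [if_pos ha2, H1 a ha1 ha2]
    · rw [if_neg (by omega), H2 a ha1 ha2]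
  · intro H
    refine ⟨fun a ha1 ha2 => ?_, fun a ha1 ha2 => ?_⟩
    · rw [H a (Or.inl ⟨ha1, ha2⟩), if_pos ha2]
    · rw [H a (Or.inr ⟨ha1, ha2⟩), if_neg (by omega)]

open Classical in
/-- The centered indicator of a pattern. -/
noncomputable def centeredMatch {n : ℕ} (h : ℕ) (w : ℤ → Bool) (i : ℕ) (X : Fin n → Bool) : ℝ :=
  (if MatchesAt h w i X then 1 else 0) - (1 / 2) ^ (2 * h + 1)

/-- Disjoint windows are independent, so their centered indicators are orthogonal. -/
theorem sum_centeredMatch_mul_of_lt {n h i j : ℕ} (h1 : h ≤ i) (h2 : i + 2 * h < j)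
    (h3 : j + h < n) (w : ℤ → Bool) :
    ∑ X : Fin n → Bool, centeredMatch h w i X * centeredMatch h w j X = 0 := by
  classical
  have e : ∀ X : Fin n → Bool, centeredMatch h w i X * centeredMatch h w j X =
      (if MatchesAt h w i X ∧ MatchesAt h w j X then 1 else 0) -
      (1 / 2) ^ (2 * h + 1) * (if MatchesAt h w i X then 1 else 0) -
      (1 / 2) ^ (2 * h + 1) * (if MatchesAt h w j X then 1 else 0) +
      (1 / 2) ^ (2 * h + 1) * (1 / 2) ^ (2 * h + 1) := by
    intro X
    unfold centeredMatch
    by_cases a1 : MatchesAt h w i X <;> by_cases a2 : MatchesAt h w j X <;> simp [a1, a2] <;> ring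
  simp only [e, Finset.sum_add_distrib, Finset.sum_sub_distrib, ← Finset.mul_sum]
  rw [Finset.sum_boole, Finset.sum_boole, Finset.sum_boole, card_matchesAt_and h1 h2 h3,
    card_matchesAt h1 (by omega), card_matchesAt (by omega) h3]
  simp only [Finset.sum_const, Finset.card_univ, nsmul_eq_mul, card_words]
  ring

theorem abs_centeredMatch_le {n h i : ℕ} (w : ℤ → Bool) (X : Fin n → Bool) :
    |centeredMatch h w i X| ≤ 1 := by
  unfold centeredMatch
  have h1 : (0 : ℝ) ≤ (1 / 2) ^ (2 * h + 1) := by positivity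
  have h2 : ((1 : ℝ) / 2) ^ (2 * h + 1) ≤ 1 := pow_le_one₀ (by norm_num) (by norm_num)
  rw [abs_le]
  split_ifs <;> constructor <;> linarith

theorem sum_centeredMatch_mul_le {n h i j : ℕ} (hi1 : h ≤ i) (hi2 : i + h < n) (hj1 : h ≤ j)
    (hj2 : j + h < n) (w : ℤ → Bool) :
    ∑ X : Fin n → Bool, centeredMatch h w i X * centeredMatch h w j X ≤
      if i ≤ j + 2 * h ∧ j ≤ i + 2 * h then 2 ^ n else 0 := by
  split_ifs with hij
  · rw [← card_words, ← nsmul_one, ← Finset.card_univ, ← Finset.sum_const]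
    apply Finset.sum_le_sum
    intro X _
    refine (le_abs_self _).trans ?_
    rw [abs_mul]
    exact mul_le_one₀ (abs_centeredMatch_le w X) (abs_nonneg _) (abs_centeredMatch_le w X)
  · rcases lt_or_ge (i + 2 * h) j with h4 | h4
    · exact (sum_centeredMatch_mul_of_lt hi1 h4 hj2 w).le
    · simp only [mul_comm (centeredMatch h w i _)]
      exact (sum_centeredMatch_mul_of_lt hj1 (by omega) hi2 w).le

/-- In the expanded square only pairs at distance at most `2 * h` survive, so the variance is linear
in the number of positions. -/
theorem sum_sq_sum_centeredMatch_le {n h : ℕ} (w : ℤ → Bool) (I : Finset ℕ)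
    (hI : ∀ i ∈ I, h ≤ i ∧ i + h < n) :
    ∑ X : Fin n → Bool, (∑ i ∈ I, centeredMatch h w i X) ^ 2 ≤ 2 ^ n * ((4 * h + 1) * I.card) := by
  have e : ∑ X : Fin n → Bool, (∑ i ∈ I, centeredMatch h w i X) ^ 2 =
      ∑ i ∈ I, ∑ j ∈ I, ∑ X : Fin n → Bool, centeredMatch h w i X * centeredMatch h w j X := by
    simp only [sq, Finset.sum_mul_sum]
    rw [Finset.sum_comm]
    apply Finset.sum_congr rfl
    intro i _
    rw [Finset.sum_comm]
  rw [e]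
  have h1 : ∀ i ∈ I, ∑ j ∈ I, ∑ X : Fin n → Bool, centeredMatch h w i X * centeredMatch h w j X ≤
      2 ^ n * (4 * h + 1) := by
    intro i hi
    have h2 : ∀ j ∈ I, ∑ X : Fin n → Bool, centeredMatch h w i X * centeredMatch h w j X ≤
        if i ≤ j + 2 * h ∧ j ≤ i + 2 * h then 2 ^ n else 0 := fun j hj =>
      sum_centeredMatch_mul_le (hI i hi).1 (hI i hi).2 (hI j hj).1 (hI j hj).2 w
    refine (Finset.sum_le_sum h2).trans ?_
    rw [← Finset.sum_filter, Finset.sum_const, nsmul_eq_mul, mul_comm]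
    apply mul_le_mul_of_nonneg_left _ (by positivity)
    -- At most `4 * h + 1` positions have a window that can overlap the window at `i`.
    have h3 : (I.filter fun j => i ≤ j + 2 * h ∧ j ≤ i + 2 * h) ⊆
        Finset.Ico (i - 2 * h) (i + 2 * h + 1) := by
      intro j
      simp only [Finset.mem_filter, Finset.mem_Ico]
      omega
    have h4 := Finset.card_le_card h3
    rw [Nat.card_Ico] at h4
    exact_mod_cast h4.trans (by omega)
  refine (Finset.sum_le_sum h1).trans ?_
  rw [Finset.sum_const, nsmul_eq_mul]
  apply le_of_eq
  ring

open Classical in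
/-- A Chebyshev inequality for the number of occurrences of a pattern. -/
theorem card_deviation_le {n h : ℕ} (w : ℤ → Bool) (I : Finset ℕ)
    (hI : ∀ i ∈ I, h ≤ i ∧ i + h < n) {r : ℝ} (hr : 0 < r) :
    ((Finset.univ.filter fun X : Fin n → Bool =>
      r < |((I.filter fun i => MatchesAt h w i X).card : ℝ) -
        (1 / 2) ^ (2 * h + 1) * I.card|).card : ℝ) ≤ 2 ^ n * ((4 * h + 1) * n) / r ^ 2 := by
  have e : ∀ X : Fin n → Bool, ((I.filter fun i => MatchesAt h w i X).card : ℝ) -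
        (1 / 2) ^ (2 * h + 1) * I.card = ∑ i ∈ I, centeredMatch h w i X := by
    intro X
    simp only [centeredMatch, Finset.sum_sub_distrib, Finset.sum_boole, Finset.sum_const,
      nsmul_eq_mul]
    ring
  simp only [e]
  rw [le_div_iff₀ (by positivity)]
  have hcard : (I.card : ℝ) ≤ n := by
    have : I ⊆ Finset.range n := fun i hi => Finset.mem_range.2 (by have := hI i hi; omega)
    have := Finset.card_le_card this
    rw [Finset.card_range] at this
    exact_mod_cast this
  refine le_trans ?_ ((sum_sq_sum_centeredMatch_le w I hI).trans ?_)
  · rw [← nsmul_eq_mul, ← Finset.sum_const]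
    refine (Finset.sum_le_sum fun X hX => ?_).trans
      (Finset.sum_le_sum_of_subset_of_nonneg (Finset.filter_subset _ _) fun X _ _ => sq_nonneg _)
    rw [← sq_abs (∑ i ∈ I, centeredMatch h w i X)]
    exact pow_le_pow_left₀ hr.le (Finset.mem_filter.1 hX).2.le 2
  · gcongr

/-! ### Counting roots by their local type -/

/-- The probability that `J(u, V) = j`. -/
noncomputable def caseProb : Fin 4 → ℝ → ℝ
  | 0, u => max 0 (1 - 2 * u)
  | 1, u => min u (1 - u)
  | 2, u => min u (1 - u)
  | 3, u => max 0 (2 * u - 1)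

theorem continuous_caseProb (j : Fin 4) : Continuous (caseProb j) := by
  fin_cases j
  · exact (by fun_prop : Continuous fun u : ℝ => max 0 (1 - 2 * u))
  · exact (by fun_prop : Continuous fun u : ℝ => min u (1 - u))
  · exact (by fun_prop : Continuous fun u : ℝ => min u (1 - u))
  · exact (by fun_prop : Continuous fun u : ℝ => max 0 (2 * u - 1))

open Classical in
theorem card_not_farFromCorners_le (n m z : ℕ) :
    ((Finset.range n).filter fun i => ¬ FarFromCorners n m z i).card ≤ 6 * m + 4 := by
  have hsub : ((Finset.range n).filter fun i => ¬ FarFromCorners n m z i) ⊆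
      (Finset.range (m + 1) ∪ Finset.Ico (n - m) n) ∪
        (Finset.Icc (z - m) (z + m) ∪ Finset.Icc (n - z - m) (n - z + m)) := by
    intro i hi
    obtain ⟨h1, h2⟩ := Finset.mem_filter.1 hi
    rw [Finset.mem_range] at h1
    simp only [Finset.mem_union, Finset.mem_range, Finset.mem_Ico, Finset.mem_Icc]
    by_contra hcon
    exact h2 ⟨by omega, by omega, by omega, by omega⟩
  refine (Finset.card_le_card hsub).trans ?_
  refine (Finset.card_union_le _ _).trans ?_
  have h1 := Finset.card_union_le (Finset.range (m + 1)) (Finset.Ico (n - m) n)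
  have h2 := Finset.card_union_le (Finset.Icc (z - m) (z + m)) (Finset.Icc (n - z - m) (n - z + m))
  simp only [Finset.card_range, Nat.card_Ico, Nat.card_Icc] at h1 h2
  omega

theorem card_discreteCase_zero {n z : ℕ} (hz : z < n) :
    ((Finset.range n).filter fun i => discreteCase n z i = 0).card ≤ (n - 2 * z) + 1 ∧
    (n - 2 * z) ≤ ((Finset.range n).filter fun i => discreteCase n z i = 0).card := by
  have e : ∀ i, discreteCase n z i = 0 ↔ 2 * z < n ∧ z ≤ i ∧ i + z ≤ n := by
    intro i
    unfold discreteCase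
    split_ifs <;> simp_all
  simp only [e]
  by_cases h : 2 * z < n
  · constructor
    · refine (Finset.card_le_card (t := Finset.Icc z (n - z)) ?_).trans ?_
      · intro i
        simp only [Finset.mem_filter, Finset.mem_range, Finset.mem_Icc]
        omega
      · rw [Nat.card_Icc]
        omega
    · refine le_trans ?_ (Finset.card_le_card (s := Finset.Ico z (n - z)) ?_)
      · rw [Nat.card_Ico]
        omega
      · intro i
        simp only [Finset.mem_filter, Finset.mem_range, Finset.mem_Ico]
        omega
  · simp [h]
    omega

theorem card_discreteCase_one {n z : ℕ} (hz : z < n) :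
    ((Finset.range n).filter fun i => discreteCase n z i = 1).card = min z (n - z) := by
  have e : ((Finset.range n).filter fun i => discreteCase n z i = 1) =
      Finset.range (min z (n - z)) := by
    ext i
    simp only [Finset.mem_filter, Finset.mem_range]
    unfold discreteCase
    split_ifs <;> simp <;> omega
  rw [e, Finset.card_range]

theorem card_discreteCase_two {n z : ℕ} (hz : z < n) :
    ((Finset.range n).filter fun i => discreteCase n z i = 2).card = min z (n - z) - 1 := by
  have e : ((Finset.range n).filter fun i => discreteCase n z i = 2) =
      Finset.Ico (max z (n - z) + 1) n := by
    ext i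
    simp only [Finset.mem_filter, Finset.mem_range, Finset.mem_Ico]
    unfold discreteCase
    split_ifs <;> simp <;> omega
  rw [e, Nat.card_Ico]
  omega

theorem sum_card_discreteCase (n z : ℕ) :
    ∑ j : Fin 4, ((Finset.range n).filter fun i => discreteCase n z i = j).card = n := by
  rw [← Finset.card_eq_sum_card_fiberwise (fun _ _ => Finset.mem_univ _), Finset.card_range]

/-- Discretization of `J(u, V)` with `u = z / n`: boundary conventions in the four intervals cost
only a bounded number of roots. -/
theorem abs_card_discreteCase_sub_le {n z : ℕ} (hz : z < n) (j : Fin 4) :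
    |(((Finset.range n).filter fun i => discreteCase n z i = j).card : ℝ) -
      n * caseProb j (z / n)| ≤ 2 := by
  have hn : (0 : ℝ) < n := by exact_mod_cast (by omega : 0 < n)
  have a0 := card_discreteCase_zero hz
  have a1 := card_discreteCase_one hz
  have a2 := card_discreteCase_two hz
  -- The last type is the default branch; its size comes by complement from the other three.
  have a3 := sum_card_discreteCase n z
  rw [Fin.sum_univ_four] at a3
  have e0 : (n : ℝ) * max 0 (1 - 2 * ((z : ℝ) / n)) = ((n - 2 * z : ℕ) : ℝ) := by
    rw [mul_max_of_nonneg _ _ hn.le]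
    rw [show (n : ℝ) * (1 - 2 * (z / n)) = n - 2 * z by field_simp, mul_zero]
    rcases le_total (2 * z) n with h | h
    · rw [Nat.cast_sub h, max_eq_right]
      · push_cast; ring
      · have : (2 * z : ℝ) ≤ n := by exact_mod_cast h
        linarith
    · rw [Nat.sub_eq_zero_of_le h, max_eq_left]
      · simp
      · have : (n : ℝ) ≤ 2 * z := by exact_mod_cast h
        linarith
  have e3 : (n : ℝ) * max 0 (2 * ((z : ℝ) / n) - 1) = ((2 * z - n : ℕ) : ℝ) := by
    rw [mul_max_of_nonneg _ _ hn.le]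
    rw [show (n : ℝ) * (2 * (z / n) - 1) = 2 * z - n by field_simp, mul_zero]
    rcases le_total n (2 * z) with h | h
    · rw [Nat.cast_sub h, max_eq_right]
      · push_cast; ring
      · have : (n : ℝ) ≤ 2 * z := by exact_mod_cast h
        linarith
    · rw [Nat.sub_eq_zero_of_le h, max_eq_left]
      · simp
      · have : (2 * z : ℝ) ≤ n := by exact_mod_cast h
        linarith
  have e1 : (n : ℝ) * min ((z : ℝ) / n) (1 - z / n) = ((min z (n - z) : ℕ) : ℝ) := by
    rw [mul_min_of_nonneg _ _ hn.le, Nat.cast_min, Nat.cast_sub hz.le]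
    congr 1 <;> field_simp
  have key : ∀ a b : ℕ, a ≤ b + 2 → b ≤ a + 2 → |(a : ℝ) - b| ≤ 2 := by
    intro a b h1 h2
    have h3 : (a : ℝ) ≤ b + 2 := by exact_mod_cast h1
    have h4 : (b : ℝ) ≤ a + 2 := by exact_mod_cast h2
    rw [abs_le]
    constructor <;> linarith
  fin_cases j <;> simp only [caseProb, e0, e1, e3, Fin.zero_eta, Fin.mk_one, Fin.reduceFinMk] <;>
    apply key <;> omega

/-! ### Counting square permutations by the position of the lowest point -/

theorem regularLabels_iff {n t : ℕ} {X Y : Fin n → Bool} {z : Fin n} :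
    RegularLabels t X Y z ↔ IsBalanced t X ∧ IsBalanced t Y ∧ 100 * t + 100 ≤ (z : ℕ) ∧
      z + 100 * t + 100 ≤ n :=
  ⟨fun h => ⟨fun m hm => ⟨h.col_le m hm, h.le_col m hm⟩, fun m hm => ⟨h.row_le m hm, h.le_row m hm⟩,
    h.le_lowest, h.lowest_le⟩, fun h => ⟨fun m hm => (h.1 m hm).1, fun m hm => (h.1 m hm).2,
    fun m hm => (h.2.1 m hm).1, fun m hm => (h.2.1 m hm).2, h.2.2.1, h.2.2.2⟩⟩

/-- An upper bound for the number of irregular triples, divided by `4 ^ n`. -/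
noncomputable def irregularBound (n t : ℕ) : ℝ :=
  4 * n * (n + 1) * Real.exp (-(t : ℝ) ^ 2 / (2 * n)) + (200 * t + 202)

open Classical in
/-- The number of irregular triples with a given position of the lowest point. -/
noncomputable def irregularCount (n t : ℕ) (z : Fin n) : ℕ :=
  (Finset.univ.filter fun p : (Fin n → Bool) × (Fin n → Bool) => ¬ RegularLabels t p.1 p.2 z).card

/-- For `z` in the middle, irregularity means that one of the two words is unbalanced. For the
`O(t)` columns near the ends all `4 ^ n` pairs of words are counted as irregular. -/
theorem sum_irregularCount_le (n t : ℕ) :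
    ((∑ z, irregularCount n t z : ℕ) : ℝ) ≤ 4 ^ n * irregularBound n t := by
  classical
  set E : ℝ := Real.exp (-(t : ℝ) ^ 2 / (2 * n)) with hE
  have hb := card_not_isBalanced_le n t
  have four : (4 : ℝ) ^ n = 2 ^ n * 2 ^ n := by rw [← mul_pow]; norm_num
  have hz : ∀ z : Fin n, (irregularCount n t z : ℝ) ≤ 4 * (n + 1) * 4 ^ n * E +
      if 100 * t + 100 ≤ (z : ℕ) ∧ z + 100 * t + 100 ≤ n then 0 else 4 ^ n := by
    intro z
    split_ifs with h
    · have hsub : (Finset.univ.filter fun p : (Fin n → Bool) × (Fin n → Bool) =>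
          ¬ RegularLabels t p.1 p.2 z) ⊆
          ((Finset.univ.filter fun X : Fin n → Bool => ¬ IsBalanced t X) ×ˢ Finset.univ) ∪
          (Finset.univ ×ˢ (Finset.univ.filter fun X : Fin n → Bool => ¬ IsBalanced t X)) := by
        rintro ⟨X, Y⟩ hp
        have hp := (Finset.mem_filter.1 hp).2
        rw [regularLabels_iff] at hp
        simp only [Finset.mem_union, Finset.mem_product, Finset.mem_filter, Finset.mem_univ,
          true_and, and_true]
        simp only [h, and_true] at hp
        tauto
      have h1 := (Finset.card_le_card hsub).trans (Finset.card_union_le _ _)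
      simp only [Finset.card_product, Finset.card_univ] at h1
      have h2 : (irregularCount n t z : ℝ) ≤
          ((Finset.univ.filter fun X : Fin n → Bool => ¬ IsBalanced t X).card : ℝ) *
            (Fintype.card (Fin n → Bool) : ℝ) + (Fintype.card (Fin n → Bool) : ℝ) *
            ((Finset.univ.filter fun X : Fin n → Bool => ¬ IsBalanced t X).card : ℝ) := by
        exact_mod_cast h1
      rw [card_words] at h2
      have h3 := mul_le_mul_of_nonneg_left hb (show (0 : ℝ) ≤ 2 ^ n by positivity)
      rw [four]
      linarith
    · have h1 : irregularCount n t z ≤ _ := Finset.card_filter_le _ _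
      rw [Finset.card_univ, Fintype.card_prod] at h1
      have h2 : (irregularCount n t z : ℝ) ≤ (Fintype.card (Fin n → Bool) : ℝ) *
        (Fintype.card (Fin n → Bool) : ℝ) := by exact_mod_cast h1
      rw [card_words, ← four] at h2
      have : 0 ≤ 4 * ((n : ℝ) + 1) * 4 ^ n * E := by positivity
      linarith
  push_cast
  refine (Finset.sum_le_sum fun z _ => hz z).trans ?_
  rw [Finset.sum_add_distrib, Finset.sum_const, Finset.sum_ite, Finset.sum_const_zero, zero_add,
    Finset.sum_const,
    Finset.card_univ, Fintype.card_fin, nsmul_eq_mul, nsmul_eq_mul]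
  have hcard : (Finset.univ.filter fun z : Fin n =>
      ¬ (100 * t + 100 ≤ (z : ℕ) ∧ z + 100 * t + 100 ≤ n)).card ≤ 200 * t + 202 := by
    refine (Finset.card_le_card_of_injOn (fun z : Fin n => (z : ℕ))
      (t := Finset.range (100 * t + 100) ∪ Finset.Ico (n - (100 * t + 100)) n) ?_
      Fin.val_injective.injOn).trans ((Finset.card_union_le _ _).trans ?_)
    · intro z hz
      have h1 := (Finset.mem_filter.1 (Finset.mem_coe.1 hz)).2
      have h2 := z.isLt
      simp only [Finset.coe_union, Finset.coe_range, Finset.coe_Ico, Set.mem_union, Set.mem_Iio,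
        Set.mem_Ico]
      omega
    · rw [Finset.card_range, Nat.card_Ico]
      omega
  have hcard' : ((Finset.univ.filter fun z : Fin n =>
      ¬ (100 * t + 100 ≤ (z : ℕ) ∧ z + 100 * t + 100 ≤ n)).card : ℝ) ≤ 200 * t + 202 := by
    exact_mod_cast hcard
  have := mul_le_mul_of_nonneg_right hcard' (show (0 : ℝ) ≤ 4 ^ n by positivity)
  unfold irregularBound
  rw [← hE]
  linarith

section Lowest

variable {n : ℕ} [NeZero n]

open Classical in
/-- The number of square permutations with lowest point in column `z`. -/
noncomputable def squareCount (z : Fin n) : ℕ :=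
  (Finset.univ.filter fun σ : Equiv.Perm (Fin n) => σ ∈ squarePerms n ∧ σ.symm 0 = z).card

open Classical in
/-- The number of admissible labels with lowest point in column `z`. -/
noncomputable def admissibleCount (z : Fin n) : ℕ :=
  (Finset.univ.filter fun p : (Fin n → Bool) × (Fin n → Bool) => AdmissibleLabels p.1 p.2 z).card

theorem encode_mem_of_regular {t : ℕ} {X Y : Fin n → Bool} {z : Fin n}
    (hR : RegularLabels t X Y z) (hA : AdmissibleLabels X Y z) :
    ∃ σ ∈ squarePerms n, encode σ = (X, Y, z) := by
  obtain ⟨σ, hσ⟩ := exists_perm_isRow hR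
  exact ⟨σ, IsRow.mem_squarePerms hR hσ, IsRow.encode_eq hR hA hσ⟩

/-- Surjectivity half of the comparison: every pair of words that is both admissible and regular
encodes some square permutation. -/
theorem admissibleCount_le (t : ℕ) (z : Fin n) :
    admissibleCount z ≤ squareCount z + irregularCount n t z := by
  classical
  have hsub : (Finset.univ.filter fun p : (Fin n → Bool) × (Fin n → Bool) =>
      AdmissibleLabels p.1 p.2 z) ⊆
      ((Finset.univ.filter fun σ : Equiv.Perm (Fin n) => σ ∈ squarePerms n ∧ σ.symm 0 = z).image
        fun σ => (columnLabel σ, rowLabel σ)) ∪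
      (Finset.univ.filter fun p : (Fin n → Bool) × (Fin n → Bool) =>
        ¬ RegularLabels t p.1 p.2 z) := by
    rintro ⟨X, Y⟩ hp
    have hA := (Finset.mem_filter.1 hp).2
    simp only [Finset.mem_union, Finset.mem_image, Finset.mem_filter, Finset.mem_univ, true_and]
    by_cases hR : RegularLabels t X Y z
    · obtain ⟨σ, hσ, he⟩ := encode_mem_of_regular hR hA
      simp only [encode, Prod.mk.injEq] at he
      exact Or.inl ⟨σ, ⟨hσ, he.2.2⟩, by rw [he.1, he.2.1]⟩
    · exact Or.inr hR
  refine (Finset.card_le_card hsub).trans ((Finset.card_union_le _ _).trans ?_)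
  exact Nat.add_le_add_right Finset.card_image_le _

/-- Injectivity half: distinct square permutations have distinct labels once `z` is fixed, and
regular ones are admissible. -/
theorem squareCount_le (t : ℕ) (z : Fin n) :
    squareCount z ≤ admissibleCount z + irregularCount n t z := by
  classical
  have hinj : Set.InjOn (fun σ : Equiv.Perm (Fin n) => (columnLabel σ, rowLabel σ))
      (Finset.univ.filter fun σ : Equiv.Perm (Fin n) => σ ∈ squarePerms n ∧ σ.symm 0 = z) := by
    intro σ hσ τ hτ h
    simp only [Finset.coe_filter, Finset.mem_univ, true_and, Set.mem_ofPred_eq] at hσ hτ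
    apply injOn_encode hσ.1 hτ.1
    simp only [Prod.mk.injEq] at h
    simp only [encode, h.1, h.2, hσ.2, hτ.2]
  unfold squareCount
  rw [← Finset.card_image_of_injOn hinj]
  refine (Finset.card_le_card ?_).trans (Finset.card_union_le _ _)
  intro p hp
  obtain ⟨σ, h, rfl⟩ := Finset.mem_image.1 hp
  obtain ⟨-, hσ, rfl⟩ := Finset.mem_filter.1 h
  simp only [Finset.mem_union, Finset.mem_filter, Finset.mem_univ, true_and]
  by_cases hR : RegularLabels t (columnLabel σ) (rowLabel σ) (σ.symm 0)
  · left
    exact admissibleLabels_of_mem_squarePerms hσ hR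
  · exact Or.inr hR

/-- Three letters of `X` and two of `Y` are forced, whence `32 = 2 ^ 5`; `z` must differ from both
end columns for the three to be distinct. -/
theorem admissibleCount_eq {z : Fin n} (h0 : z ≠ 0) (h1 : z ≠ Fin.rev 0) (hn : 1 < n) :
    (admissibleCount z : ℝ) = 4 ^ n / 32 := by
  classical
  have hne : (0 : Fin n) ≠ Fin.rev 0 := by
    intro h
    have h2 := congrArg Fin.val h
    rw [Fin.val_rev] at h2
    simp at h2
    omega
  have e : (Finset.univ.filter fun p : (Fin n → Bool) × (Fin n → Bool) =>
      AdmissibleLabels p.1 p.2 z) =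
      (Finset.univ.filter fun X : Fin n → Bool =>
        ∀ a ∈ ({0, Fin.rev 0, z} : Finset (Fin n)), X a = (fun _ => false) a) ×ˢ
      (Finset.univ.filter fun X : Fin n → Bool =>
        ∀ a ∈ ({0, Fin.rev 0} : Finset (Fin n)), X a = (fun _ => false) a) := by
    ext ⟨X, Y⟩
    simp only [Finset.mem_filter, Finset.mem_univ, true_and, Finset.mem_product,
      Finset.mem_insert, Finset.mem_singleton, forall_eq_or_imp, forall_eq]
    exact ⟨fun h => ⟨⟨h.col_first, h.col_last, h.col_lowest⟩, h.row_first, h.row_last⟩,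
      fun h => ⟨h.1.1, h.1.2.1, h.1.2.2, h.2.1, h.2.2⟩⟩
  have c1 : ({0, Fin.rev 0, z} : Finset (Fin n)).card = 3 := by
    rw [Finset.card_insert_of_notMem, Finset.card_pair h1.symm]
    simp [hne, h0.symm]
  have c2 : ({0, Fin.rev 0} : Finset (Fin n)).card = 2 := Finset.card_pair hne
  unfold admissibleCount
  rw [e, Finset.card_product]
  push_cast
  rw [card_words_eq_on, card_words_eq_on, c1, c2,
    show (4 : ℝ) ^ n = 2 ^ n * 2 ^ n by rw [← mul_pow]; norm_num]
  ring

theorem admissibleCount_le_pow (z : Fin n) : (admissibleCount z : ℝ) ≤ 4 ^ n := by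
  classical
  have h1 : admissibleCount z ≤ _ := Finset.card_filter_le _ _
  rw [Finset.card_univ, Fintype.card_prod] at h1
  have h2 : (admissibleCount z : ℝ) ≤ (Fintype.card (Fin n → Bool) : ℝ) *
    (Fintype.card (Fin n → Bool) : ℝ) := by exact_mod_cast h1
  rwa [card_words, ← mul_pow, show (2 : ℝ) * 2 = 4 by norm_num] at h2

/-- The position of the lowest point of a square permutation is nearly uniform. -/
theorem sum_abs_squareCount_sub_le (t : ℕ) (hn : 1 < n) :
    ∑ z : Fin n, |(squareCount z : ℝ) - 4 ^ n / 32| ≤ 4 ^ n * (irregularBound n t + 2) := by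
  classical
  -- At the two end columns the forced letters coincide, so only the trivial bound `4 ^ n` is used
  -- there; this is the `+ 2` in the final estimate.
  have h : ∀ z : Fin n, |(squareCount z : ℝ) - 4 ^ n / 32| ≤ irregularCount n t z +
      if z ∈ ({0, Fin.rev 0} : Finset (Fin n)) then 4 ^ n else 0 := by
    intro z
    have h1 : (admissibleCount z : ℝ) ≤ squareCount z + irregularCount n t z := by
      exact_mod_cast admissibleCount_le t z
    have h2 : (squareCount z : ℝ) ≤ admissibleCount z + irregularCount n t z := by
      exact_mod_cast squareCount_le t z
    have h3 : (0 : ℝ) ≤ admissibleCount z := Nat.cast_nonneg _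
    have h4 := admissibleCount_le_pow z
    have h5 : (0 : ℝ) < 4 ^ n := by positivity
    rw [abs_le]
    split_ifs with hz
    · constructor <;> linarith
    · simp only [Finset.mem_insert, Finset.mem_singleton, not_or] at hz
      rw [admissibleCount_eq hz.1 hz.2 hn] at h1 h2
      constructor <;> linarith
  refine (Finset.sum_le_sum fun z _ => h z).trans ?_
  rw [Finset.sum_add_distrib, ← Finset.sum_filter, Finset.sum_const, nsmul_eq_mul]
  have h1 := sum_irregularCount_le n t
  push_cast at h1
  have h2 : ((Finset.univ.filter fun z => z ∈ ({0, Fin.rev 0} : Finset (Fin n))).card : ℝ) ≤ 2 := by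
    rw [Finset.filter_univ_mem]
    exact_mod_cast Finset.card_le_two
  have := mul_le_mul_of_nonneg_right h2 (show (0 : ℝ) ≤ 4 ^ n by positivity)
  linarith

end Lowest

/-! ### Local sets of rooted permutations -/

namespace RootedPerm

/-- A set of rooted permutations which only depends on the restriction of radius `h`. -/
def IsLocal (h : ℕ) (C : Set RootedPerm) : Prop :=
  ∀ Z Z' : RootedPerm, restrict h Z = restrict h Z' → (Z ∈ C ↔ Z' ∈ C)

theorem IsLocal.mono {h k : ℕ} (hk : h ≤ k) {C : Set RootedPerm} (hC : IsLocal h C) :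
    IsLocal k C :=
  fun Z Z' hZ => hC Z Z' (restrict_eq_mono hk hZ)

theorem IsLocal.inter {h : ℕ} {C D : Set RootedPerm} (hC : IsLocal h C) (hD : IsLocal h D) :
    IsLocal h (C ∩ D) :=
  fun Z Z' hZ => and_congr (hC Z Z' hZ) (hD Z Z' hZ)

theorem isLocal_setOf_restrict_eq (h : ℕ) (R : RootedPerm) :
    IsLocal h {Z | restrict h Z = restrict h R} := by
  intro Z Z' hZ
  simp only [mem_ofPred_eq, hZ]

theorem dist_le_iff {X Y : RootedPerm} (h : ℕ) :
    dist X Y ≤ (1 / 2 : ℝ) ^ h ↔ restrict h X = restrict h Y :=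
  localDist_le_iff h

theorem IsLocal.isOpen {h : ℕ} {C : Set RootedPerm} (hC : IsLocal h C) : IsOpen C := by
  rw [Metric.isOpen_iff]
  intro Z hZ
  refine ⟨(1 / 2) ^ h, by positivity, fun Z' hZ' => ?_⟩
  exact (hC Z' Z ((dist_le_iff h).1 (Metric.mem_ball.1 hZ').le)).2 hZ

theorem IsLocal.measurableSet {h : ℕ} {C : Set RootedPerm} (hC : IsLocal h C) :
    MeasurableSet C :=
  hC.isOpen.measurableSet

theorem exists_isLocal_subset {u : Set RootedPerm} (hu : IsOpen u) {Z : RootedPerm} (hZ : Z ∈ u) :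
    ∃ C : Set RootedPerm, (∃ h, IsLocal h C) ∧ C ∈ nhds Z ∧ C ⊆ u := by
  obtain ⟨ε, hε, hball⟩ := Metric.isOpen_iff.1 hu Z hZ
  obtain ⟨h, hh⟩ := exists_pow_lt_of_lt_one hε (by norm_num : (1 / 2 : ℝ) < 1)
  refine ⟨{Z' | restrict h Z' = restrict h Z}, ⟨h, isLocal_setOf_restrict_eq h Z⟩,
    (isLocal_setOf_restrict_eq h Z).isOpen.mem_nhds rfl, fun Z' hZ' => hball ?_⟩
  exact lt_of_le_of_lt ((dist_le_iff h).2 hZ') hh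

/-- Convergence on local sets implies weak convergence. -/
theorem tendsto_probabilityMeasure_of_isLocal {ι : Type*} {l : Filter ι} [l.IsCountablyGenerated]
    {μ : ι → ProbabilityMeasure RootedPerm} {ν : ProbabilityMeasure RootedPerm}
    (H : ∀ (h : ℕ) (C : Set RootedPerm), IsLocal h C →
      Tendsto (fun i => (μ i : Measure RootedPerm).real C) l
        (nhds ((ν : Measure RootedPerm).real C))) :
    Tendsto μ l (nhds ν) := by
  -- Local sets are stable under intersection and contain a neighborhood base at each point, which
  -- makes them convergence determining.
  have hS : IsPiSystem {C : Set RootedPerm | ∃ h, IsLocal h C} := by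
    rintro C ⟨h, hC⟩ D ⟨k, hD⟩ -
    exact ⟨max h k, (hC.mono (le_max_left _ _)).inter (hD.mono (le_max_right _ _))⟩
  refine hS.tendsto_probabilityMeasure_of_tendsto_of_mem ?_ ?_ ?_
  · rintro C ⟨h, hC⟩
    exact hC.measurableSet
  · intro u hu Z hZ
    exact exists_isLocal_subset hu hZ
  · rintro C ⟨h, hC⟩
    rw [← NNReal.tendsto_coe]
    exact H h C hC

end RootedPerm

open RootedPerm

/-! ### The limiting measures -/

theorem restrict_labelPerm_congr {h : ℕ} {L L' : ℤ → Bool}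
    (hL : ∀ x ∈ Icc (-(h : ℤ)) h, L x = L' x) (j : Fin 4) :
    restrict h (labelPerm j L) = restrict h (labelPerm j L') := by
  rw [RootedPerm.restrict_eq_iff]
  intro x hx y hy
  change labelLE j L x y ↔ labelLE j L' x y
  fin_cases j <;> simp only [labelLE, hL x hx, hL y hy]

theorem continuous_labelPerm (j : Fin 4) : Continuous (labelPerm j) := by
  rw [Metric.continuous_iff']
  intro L ε hε
  obtain ⟨h, hh⟩ := exists_pow_lt_of_lt_one hε (by norm_num : (1 / 2 : ℝ) < 1)
  have H : ∀ᶠ L' : ℤ → Bool in nhds L, ∀ x ∈ Icc (-(h : ℤ)) h, L' x = L x := by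
    rw [eventually_all_finite (finite_Icc _ _)]
    intro x _
    exact (continuous_apply x).continuousAt.eventually_mem ((isOpen_discrete {L x}).mem_nhds rfl)
  filter_upwards [H] with L' hL'
  exact lt_of_le_of_lt ((dist_le_iff h).2 (restrict_labelPerm_congr hL' j)) hh

theorem measurable_caseJ : Measurable fun p : ℝ × ℝ => caseJ p.1 p.2 := by
  unfold caseJ
  refine Measurable.ite ?_ measurable_const (Measurable.ite ?_ measurable_const
    (Measurable.ite ?_ measurable_const measurable_const))
  · exact (measurableSet_lt measurable_fst measurable_const).inter
      ((measurableSet_le measurable_fst measurable_snd).inter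
        (measurableSet_le measurable_snd (measurable_const.sub measurable_fst)))
  · exact measurableSet_lt measurable_snd
      (measurable_fst.min (measurable_const.sub measurable_fst))
  · exact measurableSet_lt (measurable_fst.max (measurable_const.sub measurable_fst))
      measurable_snd

theorem measurable_labelPerm : Measurable fun p : Fin 4 × (ℤ → Bool) => labelPerm p.1 p.2 :=
  measurable_from_prod_countable_right fun j => (continuous_labelPerm j).measurable

/-- The random limit order, as a function of `U`, `V` and the labels. -/
noncomputable def limitPerm (u : ℝ) (p : ℝ × (ℤ → Bool)) : RootedPerm :=
  labelPerm (caseJ u p.1) p.2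

theorem measurable_limitPerm : Measurable fun q : ℝ × (ℝ × (ℤ → Bool)) => limitPerm q.1 q.2 := by
  have h1 : Measurable fun q : ℝ × (ℝ × (ℤ → Bool)) => caseJ q.1 q.2.1 :=
    measurable_caseJ.comp (measurable_fst.prodMk (measurable_fst.comp measurable_snd))
  exact measurable_labelPerm.comp (h1.prodMk (measurable_snd.comp measurable_snd))

theorem measurable_limitPerm_right (u : ℝ) : Measurable (limitPerm u) :=
  measurable_limitPerm.comp (measurable_const.prodMk measurable_id)

/-- The law of a Bernoulli labeling of the integers. -/
noncomputable def bernoulliLaw : Measure (ℤ → Bool) :=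
  Measure.infinitePi fun _ => (uniformOn Set.univ : Measure Bool)

/-- The uniform measure on the unit interval. -/
noncomputable def unitLaw : Measure ℝ := volume.restrict (Icc 0 1)

instance : IsProbabilityMeasure bernoulliLaw := by
  unfold bernoulliLaw
  infer_instance

instance : IsProbabilityMeasure unitLaw :=
  ⟨by simp [unitLaw]⟩

/-- The law of the limit order given `U = u`. -/
noncomputable def limitLaw (u : ℝ) : ProbabilityMeasure RootedPerm :=
  ⟨(unitLaw.prod bernoulliLaw).map (limitPerm u),
    Measure.isProbabilityMeasure_map (measurable_limitPerm_right u).aemeasurable⟩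

theorem unitLaw_real_caseJ {u : ℝ} (hu : u ∈ Icc (0 : ℝ) 1) (j : Fin 4) :
    unitLaw.real {v | caseJ u v = j} = caseProb j u := by
  obtain ⟨h0, h1⟩ := hu
  have hmeas : MeasurableSet {v | caseJ u v = j} :=
    (measurable_caseJ.comp (measurable_const.prodMk measurable_id)) (measurableSet_singleton j)
  rw [unitLaw, measureReal_restrict_apply hmeas]
  have case0 : ∀ v, caseJ u v = 0 ↔ u < 1 / 2 ∧ u ≤ v ∧ v ≤ 1 - u := by
    intro v
    unfold caseJ
    split_ifs <;> simp_all
  have case1 : ∀ v, caseJ u v = 1 ↔ v < min u (1 - u) := by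
    intro v
    unfold caseJ
    split_ifs with a b c <;> simp
    · intro h
      linarith [a.2.1]
    · simpa using b
    · simpa using b
    · simpa using b
  have case2 : ∀ v, caseJ u v = 2 ↔ max u (1 - u) < v := by
    intro v
    unfold caseJ
    split_ifs with a b c <;> simp
    · intro h
      linarith [a.2.2]
    · intro h
      linarith [b.trans_le (min_le_left _ _)]
    · simpa using c
    · simpa using c
  -- The default branch is again an interval: for `u < 1 / 2` the first three conditions already
  -- exhaust all `v`.
  have case3 : ∀ v, caseJ u v = 3 ↔ 1 / 2 ≤ u ∧ 1 - u ≤ v ∧ v ≤ u := by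
    intro v
    unfold caseJ
    split_ifs with a b c <;> simp
    · intro h
      linarith [a.1]
    · intro h h2
      rw [lt_min_iff] at b
      linarith
    · intro h h2
      rw [gt_iff_lt, max_lt_iff] at c
      exact c.1
    · rw [not_lt, min_le_iff] at b
      rw [gt_iff_lt, not_lt, le_max_iff] at c
      rcases lt_or_ge u (1 / 2) with hu | hu
      · exfalso
        have h3 : u ≤ v := b.elim id fun h => by linarith
        have h4 : v ≤ 1 - u := c.elim (fun h => by linarith) id
        exact a ⟨hu, h3, h4⟩
      · exact ⟨by linarith, b.elim (fun h => by linarith) fun h => by linarith,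
          c.elim id fun h => by linarith⟩
  fin_cases j <;>
    simp only [Fin.zero_eta, Fin.mk_one, Fin.reduceFinMk, case0, case1, case2, case3, caseProb]
  · rcases lt_or_ge u (1 / 2) with hu | hu
    · have e : {v | u < 1 / 2 ∧ u ≤ v ∧ v ≤ 1 - u} ∩ Icc 0 1 = Icc u (1 - u) := by
        ext v
        simp only [mem_inter_iff, mem_ofPred_eq, mem_Icc]
        exact ⟨fun h => h.1.2, fun h => ⟨⟨hu, h⟩, by linarith, by linarith⟩⟩
      rw [e, Real.volume_real_Icc, max_comm]
      congr 1
      ring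
    · have e : {v | u < 1 / 2 ∧ u ≤ v ∧ v ≤ 1 - u} ∩ Icc 0 1 = ∅ := by
        ext v
        simp only [not_lt.2 hu, false_and, mem_inter_iff, mem_ofPred_eq, mem_empty_iff_false]
      rw [e, max_eq_left (by linarith)]
      simp
  · have e : {v | v < min u (1 - u)} ∩ Icc 0 1 = Ico 0 (min u (1 - u)) := by
      ext v
      simp only [mem_inter_iff, mem_ofPred_eq, mem_Icc, mem_Ico]
      exact ⟨fun h => ⟨h.2.1, h.1⟩, fun h => ⟨h.2, h.1, by
        linarith [h.2.trans_le (min_le_left u (1 - u))]⟩⟩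
    rw [e, Real.volume_real_Ico, sub_zero, max_eq_left (le_min h0 (by linarith))]
  · have e : {v | max u (1 - u) < v} ∩ Icc 0 1 = Ioc (max u (1 - u)) 1 := by
      ext v
      simp only [mem_inter_iff, mem_ofPred_eq, mem_Icc, mem_Ioc]
      exact ⟨fun h => ⟨h.1, h.2.2⟩, fun h => ⟨h.1, by
        linarith [(le_max_left u (1 - u)).trans_lt h.1], h.2⟩⟩
    have h2 : 1 - max u (1 - u) = min u (1 - u) := by
      rcases le_total u (1 - u) with h | h
      · rw [max_eq_right h, min_eq_left h]; ring
      · rw [max_eq_left h, min_eq_right h]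
    rw [e, Real.volume_real_Ioc, h2, max_eq_left (le_min h0 (by linarith))]
  · rcases lt_or_ge u (1 / 2) with hu | hu
    · have e : {v | 1 / 2 ≤ u ∧ 1 - u ≤ v ∧ v ≤ u} ∩ Icc 0 1 = ∅ := by
        ext v
        simp only [not_le.2 hu, false_and, mem_inter_iff, mem_ofPred_eq, mem_empty_iff_false]
      rw [e, max_eq_left (by linarith)]
      simp
    · have e : {v | 1 / 2 ≤ u ∧ 1 - u ≤ v ∧ v ≤ u} ∩ Icc 0 1 = Icc (1 - u) u := by
        ext v
        simp only [mem_inter_iff, mem_ofPred_eq, mem_Icc]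
        exact ⟨fun h => h.1.2, fun h => ⟨⟨hu, h⟩, by linarith, by linarith⟩⟩
      rw [e, Real.volume_real_Icc, max_comm]
      congr 1
      ring

/-- The probability that the limit order of type `j` lies in `C`. -/
noncomputable def caseWeight (C : Set RootedPerm) (j : Fin 4) : ℝ :=
  bernoulliLaw.real {l | labelPerm j l ∈ C}

/-- The type and the labels are independent, so the law is a mixture of the four label orders; `u`
enters only through the weights, which are continuous. -/
theorem limitLaw_real {u : ℝ} (hu : u ∈ Icc (0 : ℝ) 1) {C : Set RootedPerm}
    (hC : MeasurableSet C) :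
    (limitLaw u : Measure RootedPerm).real C = ∑ j, caseProb j u * caseWeight C j := by
  have e : limitPerm u ⁻¹' C =
      ⋃ j ∈ (Finset.univ : Finset (Fin 4)), {v | caseJ u v = j} ×ˢ {l | labelPerm j l ∈ C} := by
    ext ⟨v, l⟩
    simp [limitPerm]
  have hm1 : ∀ j, MeasurableSet {v | caseJ u v = j} := fun j =>
    (measurable_caseJ.comp (measurable_const.prodMk measurable_id)) (measurableSet_singleton j)
  have hm2 : ∀ j, MeasurableSet {l | labelPerm j l ∈ C} := fun j =>
    (continuous_labelPerm j).measurable hC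
  change ((unitLaw.prod bernoulliLaw).map (limitPerm u)).real C = _
  rw [map_measureReal_apply (measurable_limitPerm_right u) hC, e, measureReal_biUnion_finset]
  · apply Finset.sum_congr rfl
    intro j _
    rw [measureReal_prod_prod, unitLaw_real_caseJ hu, caseWeight]
  · intro i _ j _ hij
    rw [Function.onFun, Set.disjoint_left]
    rintro ⟨v, l⟩ ⟨h1, -⟩ ⟨h2, -⟩
    exact hij (h1.symm.trans h2)
  · exact fun j _ => (hm1 j).prod (hm2 j)

theorem continuousOn_limitLaw : ContinuousOn limitLaw (Icc 0 1) := by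
  intro u hu
  apply tendsto_probabilityMeasure_of_isLocal
  intro h C hC
  rw [limitLaw_real hu hC.measurableSet]
  have h1 : Tendsto (fun v => ∑ j, caseProb j v * caseWeight C j) (nhdsWithin u (Icc 0 1))
      (nhds (∑ j, caseProb j u * caseWeight C j)) :=
    (tendsto_finsetSum _ fun j _ =>
      ((continuous_caseProb j).tendsto u).mul_const _).mono_left nhdsWithin_le_nhds
  refine h1.congr' ?_
  filter_upwards [self_mem_nhdsWithin] with v hv
  rw [limitLaw_real hv hC.measurableSet]

/-- Extension of a finite pattern to all integers. -/
noncomputable def extendPattern {h : ℕ} (w : Finset.Icc (-(h : ℤ)) h → Bool) (x : ℤ) : Bool :=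
  if hx : x ∈ Finset.Icc (-(h : ℤ)) h then w ⟨x, hx⟩ else false

open Classical in
-- A local event depends on the `2 * h + 1` labels of the window only, and each pattern has the same
-- probability. This matches the empirical counts pattern by pattern.
theorem caseWeight_eq {h : ℕ} {C : Set RootedPerm} (hC : IsLocal h C) (j : Fin 4) :
    caseWeight C j = ∑ w : Finset.Icc (-(h : ℤ)) h → Bool,
      if labelPerm j (extendPattern w) ∈ C then (1 / 2 : ℝ) ^ (2 * h + 1) else 0 := by
  have hcyl : ∀ w : Finset.Icc (-(h : ℤ)) h → Bool,
      {l : ℤ → Bool | ∀ x ∈ Finset.Icc (-(h : ℤ)) h, l x = extendPattern w x} =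
      Set.pi (Finset.Icc (-(h : ℤ)) h : Finset ℤ) fun x => {extendPattern w x} := by
    intro w
    ext l
    simp [Set.mem_pi]
  have hone : ∀ b : Bool, (uniformOn Set.univ : Measure Bool) {b} = 1 / 2 := by
    intro b
    rw [uniformOn_univ]
    simp
  have hval : ∀ w : Finset.Icc (-(h : ℤ)) h → Bool, bernoulliLaw.real
      {l : ℤ → Bool | ∀ x ∈ Finset.Icc (-(h : ℤ)) h, l x = extendPattern w x} =
      (1 / 2 : ℝ) ^ (2 * h + 1) := by
    intro w
    rw [hcyl, Measure.real, bernoulliLaw, Measure.infinitePi_pi _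
      (fun x _ => measurableSet_singleton _)]
    simp only [hone, Finset.prod_const, Int.card_Icc]
    rw [show ((h : ℤ) + 1 - -(h : ℤ)).toNat = 2 * h + 1 by omega]
    simp
  have e : {l | labelPerm j l ∈ C} = ⋃ w ∈ Finset.univ.filter
      (fun w : Finset.Icc (-(h : ℤ)) h → Bool => labelPerm j (extendPattern w) ∈ C),
      {l : ℤ → Bool | ∀ x ∈ Finset.Icc (-(h : ℤ)) h, l x = extendPattern w x} := by
    ext l
    simp only [mem_ofPred_eq, mem_iUnion, Finset.mem_filter, Finset.mem_univ, true_and,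
      exists_prop]
    constructor
    · intro hl
      have hw : ∀ x ∈ Finset.Icc (-(h : ℤ)) h, l x = extendPattern
          (fun y : Finset.Icc (-(h : ℤ)) h => l y.1) x := by
        intro x hx
        rw [extendPattern, dif_pos hx]
      refine ⟨fun x => l x.1, ?_, hw⟩
      exact (hC _ _ (restrict_labelPerm_congr (fun x hx => hw x (Finset.mem_Icc.2 hx)) j)).1 hl
    · rintro ⟨w, hw, hl⟩
      exact (hC _ _ (restrict_labelPerm_congr (fun x hx => hl x (Finset.mem_Icc.2 hx)) j)).2 hw
  rw [caseWeight, e, measureReal_biUnion_finset, ← Finset.sum_filter]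
  · exact Finset.sum_congr rfl fun w _ => hval w
  · intro w _ w' _ hww
    rw [Function.onFun, Set.disjoint_left]
    intro l hl hl'
    apply hww
    funext x
    have h1 := (hl x.1 x.2).symm.trans (hl' x.1 x.2)
    rw [extendPattern, extendPattern, dif_pos x.2, dif_pos x.2] at h1
    exact h1
  · intro w _
    rw [hcyl]
    exact MeasurableSet.pi (Finset.countable_toSet _) fun x _ => measurableSet_singleton _

/-- The law of a permutation rooted at a uniform position. -/
noncomputable def rootedLaw {n : ℕ} [NeZero n] (σ : Equiv.Perm (Fin n)) :
    ProbabilityMeasure RootedPerm :=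
  ⟨(uniformOn Set.univ : Measure (Fin n)).map (ofPerm σ),
    Measure.isProbabilityMeasure_map (measurable_of_countable _).aemeasurable⟩

open Classical in
theorem rootedLaw_real {n : ℕ} [NeZero n] (σ : Equiv.Perm (Fin n)) {C : Set RootedPerm}
    (hC : MeasurableSet C) :
    (rootedLaw σ : Measure RootedPerm).real C =
      ((Finset.univ.filter fun i => ofPerm σ i ∈ C).card : ℝ) / n := by
  change ((uniformOn Set.univ : Measure (Fin n)).map (ofPerm σ)).real C = _
  rw [map_measureReal_apply (measurable_of_countable _) hC, Measure.real, uniformOn_univ,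
    Fintype.card_fin, ENNReal.toReal_div]
  congr 1
  rw [show ofPerm σ ⁻¹' C = ((Finset.univ.filter fun i => ofPerm σ i ∈ C : Finset (Fin n)) :
    Set (Fin n)) by ext; simp, Measure.count_apply_finset]
  simp

/-- Around the limiting laws, a continuous functional is controlled by the values on local sets of
some fixed radius. -/
theorem exists_local_control {F : ProbabilityMeasure RootedPerm → ℝ} (hF : Continuous F) {ε : ℝ}
    (hε : 0 < ε) : ∃ (h : ℕ) (η : ℝ), 0 < η ∧ ∀ u ∈ Icc (0 : ℝ) 1,
      ∀ μ : ProbabilityMeasure RootedPerm,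
      (∀ C, IsLocal h C → |(μ : Measure RootedPerm).real C -
        (limitLaw u : Measure RootedPerm).real C| ≤ η) → |F μ - F (limitLaw u)| < ε := by
  by_contra! hcon
  -- Counterexamples with radius `k` and tolerance `1 / (k + 1)`. Along a subsequence `u k`
  -- converges, both sequences of measures then have the same limit, and continuity of `F` gives the
  -- contradiction.
  choose u hu μ hμ hF' using fun k : ℕ => hcon k (1 / ((k : ℝ) + 1)) (by positivity)
  obtain ⟨v, hv, φ, hφ, hlim⟩ := isCompact_Icc.tendsto_subseq hu
  have h1 : Tendsto (fun k => limitLaw (u (φ k))) atTop (nhds (limitLaw v)) :=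
    (continuousOn_limitLaw v hv).tendsto.comp
      (tendsto_nhdsWithin_iff.2 ⟨hlim, Eventually.of_forall fun k => hu (φ k)⟩)
  have h2 : Tendsto (fun k => μ (φ k)) atTop (nhds (limitLaw v)) := by
    apply tendsto_probabilityMeasure_of_isLocal
    intro h C hC
    have h3 : Tendsto (fun k => (limitLaw (u (φ k)) : Measure RootedPerm).real C) atTop
        (nhds ((limitLaw v : Measure RootedPerm).real C)) := by
      simp only [limitLaw_real (hu _) hC.measurableSet, limitLaw_real hv hC.measurableSet]
      exact tendsto_finsetSum _ fun j _ =>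
        (((continuous_caseProb j).tendsto v).comp hlim).mul_const _
    have h4 : Tendsto (fun k => (μ (φ k) : Measure RootedPerm).real C -
        (limitLaw (u (φ k)) : Measure RootedPerm).real C) atTop (nhds 0) := by
      apply squeeze_zero_norm' (a := fun k => 1 / ((φ k : ℝ) + 1))
      · filter_upwards [eventually_ge_atTop h] with k hk
        -- A set local at radius `h` is local at every larger radius, and `φ k ≥ k ≥ h`.
        exact hμ (φ k) C (hC.mono (hk.trans (hφ.id_le k)))
      · exact tendsto_one_div_add_atTop_nhds_zero_nat.comp hφ.tendsto_atTop
    simpa using h4.add h3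
  have h5 := ((hF.tendsto _).comp h2).sub ((hF.tendsto _).comp h1)
  rw [sub_self] at h5
  have h6 := h5.abs
  rw [abs_zero] at h6
  obtain ⟨k, hk⟩ := (h6.eventually (gt_mem_nhds hε)).exists
  exact absurd (hF' (φ k)) (not_le.2 hk)

/-! ### Comparison of the empirical and the limiting laws -/

/-- The roots of local type `j` whose window of radius `h` lies inside the word. -/
def innerRoots (n h z : ℕ) (j : Fin 4) : Finset ℕ :=
  (Finset.range n).filter fun i => (h ≤ i ∧ i + h < n) ∧ discreteCase n z i = j

theorem mem_innerRoots {n h z i : ℕ} {j : Fin 4} :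
    i ∈ innerRoots n h z j ↔ (h ≤ i ∧ i + h < n) ∧ discreteCase n z i = j := by
  rw [innerRoots, Finset.mem_filter, Finset.mem_range]
  exact ⟨fun h => h.2, fun h => ⟨by omega, h⟩⟩

open Classical in
/-- All patterns of radius `h` occur with the expected frequencies, up to an error `r`, among the
roots of each local type. -/
def IsEquidistributed {n : ℕ} (h : ℕ) (r : ℝ) (z : ℕ) (X : Fin n → Bool) : Prop :=
  ∀ (j : Fin 4) (w : Finset.Icc (-(h : ℤ)) h → Bool),
    |(((innerRoots n h z j).filter fun i => MatchesAt h (extendPattern w) i X).card : ℝ) -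
      (1 / 2) ^ (2 * h + 1) * (innerRoots n h z j).card| ≤ r

/-- The number of patterns of radius `h`. -/
noncomputable def numPatterns (h : ℕ) : ℕ := Fintype.card (Finset.Icc (-(h : ℤ)) h → Bool)

open Classical in
-- Chebyshev's bound for each of the four types and each pattern, summed.
theorem card_not_isEquidistributed_le {n h z : ℕ} {r : ℝ} (hr : 0 < r) :
    ((Finset.univ.filter fun X : Fin n → Bool => ¬ IsEquidistributed h r z X).card : ℝ) ≤
      4 * numPatterns h * (2 ^ n * ((4 * h + 1) * n) / r ^ 2) := by
  have hsub : (Finset.univ.filter fun X : Fin n → Bool => ¬ IsEquidistributed h r z X) ⊆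
      (Finset.univ : Finset (Fin 4 × (Finset.Icc (-(h : ℤ)) h → Bool))).biUnion fun q =>
        Finset.univ.filter fun X : Fin n → Bool =>
          r < |(((innerRoots n h z q.1).filter fun i =>
            MatchesAt h (extendPattern q.2) i X).card : ℝ) -
          (1 / 2) ^ (2 * h + 1) * (innerRoots n h z q.1).card| := by
    intro X hX
    have h1 := (Finset.mem_filter.1 hX).2
    unfold IsEquidistributed at h1
    push Not at h1
    obtain ⟨j, w, h1⟩ := h1
    simp only [Finset.mem_biUnion, Finset.mem_univ, true_and, Finset.mem_filter]
    exact ⟨(j, w), h1⟩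
  have h1 := (Finset.card_le_card hsub).trans Finset.card_biUnion_le
  have h2 := (Nat.cast_le (α := ℝ)).2 h1
  push_cast at h2
  refine h2.trans ((Finset.sum_le_sum fun q _ => card_deviation_le (extendPattern q.2)
    (innerRoots n h z q.1) (fun i hi => (mem_innerRoots.1 hi).1) hr).trans ?_)
  rw [Finset.sum_const, Finset.card_univ, Fintype.card_prod, Fintype.card_fin, nsmul_eq_mul]
  push_cast
  rfl

theorem card_innerRoots_le (n h z : ℕ) (j : Fin 4) :
    (innerRoots n h z j).card ≤ ((Finset.range n).filter fun i => discreteCase n z i = j).card := by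
  apply Finset.card_le_card
  intro i
  simp only [innerRoots, Finset.mem_filter]
  tauto

theorem card_le_card_innerRoots_add (n h z : ℕ) (j : Fin 4) :
    ((Finset.range n).filter fun i => discreteCase n z i = j).card ≤
      (innerRoots n h z j).card + 2 * h := by
  have hsub : ((Finset.range n).filter fun i => discreteCase n z i = j) ⊆
      innerRoots n h z j ∪ (Finset.range h ∪ Finset.Ico (n - h) n) := by
    intro i
    simp only [innerRoots, Finset.mem_filter, Finset.mem_range, Finset.mem_union, Finset.mem_Ico]
    rintro ⟨h1, h2⟩
    by_cases h3 : h ≤ i ∧ i + h < n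
    · exact Or.inl ⟨h1, h3, h2⟩
    · right
      omega
  refine (Finset.card_le_card hsub).trans ((Finset.card_union_le _ _).trans ?_)
  have := Finset.card_union_le (Finset.range h) (Finset.Ico (n - h) n)
  rw [Finset.card_range, Nat.card_Ico] at this
  omega

theorem abs_card_innerRoots_sub_le {n z : ℕ} (h : ℕ) (hz : z < n) (j : Fin 4) :
    |((innerRoots n h z j).card : ℝ) - n * caseProb j (z / n)| ≤ 2 + 2 * h := by
  have h1 := abs_card_discreteCase_sub_le hz j
  have h2 : ((innerRoots n h z j).card : ℝ) ≤
      (((Finset.range n).filter fun i => discreteCase n z i = j).card : ℝ) := by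
    exact_mod_cast card_innerRoots_le n h z j
  have h3 : (((Finset.range n).filter fun i => discreteCase n z i = j).card : ℝ) ≤
      ((innerRoots n h z j).card : ℝ) + 2 * h := by
    exact_mod_cast card_le_card_innerRoots_add n h z j
  have h4 : (0 : ℝ) ≤ h := Nat.cast_nonneg h
  rw [abs_le] at h1 ⊢
  constructor <;> linarith [h1.1, h1.2]

theorem matchesAt_iff {n h i : ℕ} (h1 : h ≤ i) (h2 : i + h < n) (w : ℤ → Bool)
    (X : Fin n → Bool) :
    MatchesAt h w i X ↔ ∀ x ∈ Finset.Icc (-(h : ℤ)) h, shiftLabels X i x = w x := by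
  constructor
  · intro H x hx
    rw [Finset.mem_Icc] at hx
    have h3 := H ⟨(x + i).toNat, by omega⟩ (by simp only; omega) (by simp only; omega)
    rw [← shiftLabels_sub X i] at h3
    have e : (((⟨(x + i).toNat, by omega⟩ : Fin n) : ℕ) : ℤ) - i = x := by
      simp only
      omega
    rwa [e] at h3
  · intro H a ha1 ha2
    rw [← H ((a : ℤ) - i) (by rw [Finset.mem_Icc]; omega), shiftLabels_sub]

open Classical in
-- Roots are sorted by the pattern they see, which alone decides membership in a local set.
theorem card_filter_labelPerm_mem {n h z : ℕ} (X : Fin n → Bool) {C : Set RootedPerm}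
    (hC : IsLocal h C) (j : Fin 4) :
    ((innerRoots n h z j).filter fun i => labelPerm j (shiftLabels X i) ∈ C).card =
      ∑ w : Finset.Icc (-(h : ℤ)) h → Bool, if labelPerm j (extendPattern w) ∈ C then
        ((innerRoots n h z j).filter fun i => MatchesAt h (extendPattern w) i X).card else 0 := by
  rw [Finset.card_eq_sum_card_fiberwise (t := Finset.univ)
    (f := fun i (x : Finset.Icc (-(h : ℤ)) h) => shiftLabels X i x.1)
    (fun _ _ => Finset.mem_coe.2 (Finset.mem_univ _))]
  apply Finset.sum_congr rfl
  intro w _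
  have key : ∀ i, (fun x : Finset.Icc (-(h : ℤ)) h => shiftLabels X i x.1) = w ↔
      ∀ x ∈ Finset.Icc (-(h : ℤ)) h, shiftLabels X i x = extendPattern w x := by
    intro i
    constructor
    · rintro rfl x hx
      rw [extendPattern, dif_pos hx]
    · intro H
      funext x
      rw [H x.1 x.2, extendPattern, dif_pos x.2]
  have key2 : ∀ i, (∀ x ∈ Finset.Icc (-(h : ℤ)) h, shiftLabels X i x = extendPattern w x) →
      (labelPerm j (shiftLabels X i) ∈ C ↔ labelPerm j (extendPattern w) ∈ C) := fun i H =>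
    hC _ _ (restrict_labelPerm_congr (fun x hx => H x (Finset.mem_Icc.2 hx)) j)
  split_ifs with hw
  · congr 1
    ext i
    simp only [Finset.mem_filter, key]
    constructor
    · rintro ⟨⟨h1, h2⟩, h3⟩
      have h4 := (mem_innerRoots.1 h1).1
      exact ⟨h1, (matchesAt_iff h4.1 h4.2 _ X).2 h3⟩
    · rintro ⟨h1, h3⟩
      have h4 := (mem_innerRoots.1 h1).1
      rw [matchesAt_iff h4.1 h4.2] at h3
      exact ⟨⟨h1, (key2 i h3).2 hw⟩, h3⟩
  · rw [Finset.card_eq_zero, Finset.filter_eq_empty_iff]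
    intro i hi h3
    exact hw ((key2 i ((key i).1 h3)).1 (Finset.mem_filter.1 hi).2)

theorem caseWeight_nonneg (C : Set RootedPerm) (j : Fin 4) : 0 ≤ caseWeight C j :=
  measureReal_nonneg

theorem caseWeight_le_one (C : Set RootedPerm) (j : Fin 4) : caseWeight C j ≤ 1 :=
  measureReal_le_one

open Classical in
theorem abs_card_filter_labelPerm_sub_le {n h z : ℕ} {X : Fin n → Bool} {r : ℝ}
    (hX : IsEquidistributed h r z X) {C : Set RootedPerm} (hC : IsLocal h C) (j : Fin 4) :
    |(((innerRoots n h z j).filter fun i => labelPerm j (shiftLabels X i) ∈ C).card : ℝ) -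
      (innerRoots n h z j).card * caseWeight C j| ≤ numPatterns h * r := by
  rw [card_filter_labelPerm_mem X hC, caseWeight_eq hC, Finset.mul_sum]
  push_cast
  rw [← Finset.sum_sub_distrib]
  refine (Finset.abs_sum_le_sum_abs _ _).trans ?_
  have hr : 0 ≤ r := (abs_nonneg _).trans (hX 0 fun _ => false)
  have : ∀ w ∈ (Finset.univ : Finset (Finset.Icc (-(h : ℤ)) h → Bool)),
      |(if labelPerm j (extendPattern w) ∈ C then
        (((innerRoots n h z j).filter fun i => MatchesAt h (extendPattern w) i X).card : ℝ) else 0) -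
      (innerRoots n h z j).card *
        (if labelPerm j (extendPattern w) ∈ C then (1 / 2 : ℝ) ^ (2 * h + 1) else 0)| ≤ r := by
    intro w _
    split_ifs
    · rw [mul_comm ((innerRoots n h z j).card : ℝ)]
      exact hX j w
    · simpa using hr
  refine (Finset.sum_le_sum this).trans ?_
  rw [Finset.sum_const, Finset.card_univ, nsmul_eq_mul, numPatterns]

theorem card_le_card_add_card_of_imp {α : Type*} {s : Finset α} {p q e : α → Prop}
    [DecidablePred p] [DecidablePred q] [DecidablePred e]
    (H : ∀ i ∈ s, ¬ e i → p i → q i) :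
    (s.filter p).card ≤ (s.filter q).card + (s.filter e).card := by
  classical
  refine (Finset.card_le_card (t := s.filter q ∪ s.filter e) ?_).trans (Finset.card_union_le _ _)
  intro i hi
  obtain ⟨h1, h2⟩ := Finset.mem_filter.1 hi
  rw [Finset.mem_union, Finset.mem_filter, Finset.mem_filter]
  by_cases h3 : e i
  · exact Or.inr ⟨h1, h3⟩
  · exact Or.inl ⟨h1, H i h1 h3 h2⟩

open Classical in
/-- The square permutations, as a finite set. -/
noncomputable def squareFinset (n : ℕ) : Finset (Equiv.Perm (Fin n)) :=
  Finset.univ.filter fun σ => σ ∈ squarePerms n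

theorem mem_squareFinset {n : ℕ} {σ : Equiv.Perm (Fin n)} : σ ∈ squareFinset n ↔ σ ∈ squarePerms n := by
  simp [squareFinset]

theorem val_div_mem_Icc {n : ℕ} (z : Fin n) : ((z : ℕ) : ℝ) / n ∈ Icc (0 : ℝ) 1 :=
  ⟨by positivity, div_le_one_of_le₀ (by exact_mod_cast z.isLt.le) (Nat.cast_nonneg n)⟩

section Comparison

variable {n : ℕ} [NeZero n] {σ : Equiv.Perm (Fin n)}

/-- For a square permutation with regular and equidistributed labels, the law of the permutation at
a uniform root is close to the limiting law on local sets. -/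
theorem abs_rootedLaw_sub_limitLaw_le (hσ : σ ∈ squarePerms n) {t h : ℕ} (ht : h ≤ t) {r : ℝ}
    (hR : RegularLabels t (columnLabel σ) (rowLabel σ) (σ.symm 0))
    (hX : IsEquidistributed h r (σ.symm 0) (columnLabel σ)) {C : Set RootedPerm}
    (hC : IsLocal h C) :
    |(rootedLaw σ : Measure RootedPerm).real C -
      (limitLaw ((σ.symm 0 : Fin n) / n) : Measure RootedPerm).real C| ≤
      (120 * t + 132 + 8 * h + 4 * numPatterns h * r) / n := by
  classical
  set X := columnLabel σ with hXdef
  set z := σ.symm 0 with hz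
  have hn : (0 : ℝ) < n := by exact_mod_cast Nat.pos_of_ne_zero (NeZero.ne n)
  rw [rootedLaw_real σ hC.measurableSet, limitLaw_real (val_div_mem_Icc z) hC.measurableSet]
  set A : ℕ := (Finset.univ.filter fun i => ofPerm σ i ∈ C).card with hA
  set B : ℕ := ((Finset.range n).filter fun i => (h ≤ i ∧ i + h < n) ∧
    labelPerm (discreteCase n z i) (shiftLabels X i) ∈ C).card with hB
  set E : ℕ := ((Finset.range n).filter fun i => ¬ FarFromCorners n (20 * t + 20) z i).card with hE
  -- Roots near a corner escape the local description; this is `6 * m + 4` with `m = 20 * t + 20`.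
  have hE' : E ≤ 120 * t + 124 := by
    have := card_not_farFromCorners_le n (20 * t + 20) z
    omega
  have hAeq : A = ((Finset.range n).filter fun i => ∃ hi : i < n, ofPerm σ ⟨i, hi⟩ ∈ C).card := by
    rw [hA]
    apply Finset.card_bij (fun (i : Fin n) _ => (i : ℕ))
    · intro i hi
      rw [Finset.mem_filter] at hi ⊢
      exact ⟨Finset.mem_range.2 i.isLt, i.isLt, hi.2⟩
    · intro i _ j _ hij
      exact Fin.ext hij
    · intro i hi
      obtain ⟨h1, h2, h3⟩ := Finset.mem_filter.1 hi
      exact ⟨⟨i, h2⟩, Finset.mem_filter.2 ⟨Finset.mem_univ _, h3⟩, rfl⟩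
  have hiff : ∀ i ∈ Finset.range n, ¬ ¬ FarFromCorners n (20 * t + 20) z i →
      ((∃ hi : i < n, ofPerm σ ⟨i, hi⟩ ∈ C) ↔ ((h ≤ i ∧ i + h < n) ∧
        labelPerm (discreteCase n z i) (shiftLabels X i) ∈ C)) := by
    intro i hi hfar
    rw [not_not] at hfar
    have hi' := Finset.mem_range.1 hi
    have f1 := hfar.le_index
    have f2 := hfar.index_le
    have hloc := hC _ _ (restrict_ofPerm_of_isRow hR (isRow_of_mem_squarePerms hσ) ht
      (i := ⟨i, hi'⟩) hfar)
    constructor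
    · rintro ⟨_, h1⟩
      exact ⟨by omega, hloc.1 h1⟩
    · rintro ⟨_, h1⟩
      exact ⟨hi', hloc.2 h1⟩
  have hAB : A ≤ B + E := by
    rw [hAeq]
    exact card_le_card_add_card_of_imp fun i hi he => (hiff i hi he).1
  have hBA : B ≤ A + E := by
    rw [hAeq]
    exact card_le_card_add_card_of_imp fun i hi he => (hiff i hi he).2
  have hBsum : B = ∑ j : Fin 4,
      ((innerRoots n h z j).filter fun i => labelPerm j (shiftLabels X i) ∈ C).card := by
    rw [hB, Finset.card_eq_sum_card_fiberwise (t := Finset.univ)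
      (f := fun i => discreteCase n z i) (fun _ _ => Finset.mem_coe.2 (Finset.mem_univ _))]
    apply Finset.sum_congr rfl
    intro j _
    congr 1
    ext i
    simp only [innerRoots, Finset.mem_filter]
    constructor
    · rintro ⟨⟨h1, h2, h3⟩, h4⟩
      exact ⟨⟨h1, h2, h4⟩, h4 ▸ h3⟩
    · rintro ⟨⟨h1, h2, h4⟩, h3⟩
      exact ⟨⟨h1, h2, h4.symm ▸ h3⟩, h4⟩
  -- Two errors per type: the pattern frequencies cost `numPatterns h * r`, and replacing the number
  -- of inner roots by `n * caseProb` costs `2 + 2 * h`.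
  have hBlim : |(B : ℝ) - n * ∑ j, caseProb j (z / n) * caseWeight C j| ≤
      4 * (numPatterns h * r + (2 + 2 * h)) := by
    rw [hBsum, Finset.mul_sum]
    push_cast
    rw [← Finset.sum_sub_distrib]
    refine (Finset.abs_sum_le_sum_abs _ _).trans ?_
    have : ∀ j ∈ (Finset.univ : Finset (Fin 4)),
        |(((innerRoots n h z j).filter fun i => labelPerm j (shiftLabels X i) ∈ C).card : ℝ) -
          n * (caseProb j (z / n) * caseWeight C j)| ≤ numPatterns h * r + (2 + 2 * h) := by
      intro j _
      have h1 := abs_card_filter_labelPerm_sub_le hX hC j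
      have h2 := abs_card_innerRoots_sub_le h z.isLt j
      have h3 : |((innerRoots n h z j).card : ℝ) * caseWeight C j -
          n * (caseProb j (z / n) * caseWeight C j)| ≤ 2 + 2 * h := by
        rw [← mul_assoc, ← sub_mul, abs_mul, abs_of_nonneg (caseWeight_nonneg C j)]
        exact (mul_le_of_le_one_right (abs_nonneg _) (caseWeight_le_one C j)).trans h2
      exact (abs_sub_le _ _ _).trans (add_le_add h1 h3)
    refine (Finset.sum_le_sum this).trans ?_
    rw [Finset.sum_const, Finset.card_univ, Fintype.card_fin, nsmul_eq_mul, Nat.cast_ofNat]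
  have hABr : (A : ℝ) ≤ B + E := by exact_mod_cast hAB
  have hBAr : (B : ℝ) ≤ A + E := by exact_mod_cast hBA
  have hEr : (E : ℝ) ≤ 120 * t + 124 := by exact_mod_cast hE'
  rw [le_div_iff₀ hn, ← abs_of_pos hn, ← abs_mul, abs_of_pos hn, sub_mul,
    div_mul_cancel₀ _ hn.ne']
  rw [abs_le] at hBlim ⊢
  constructor <;> linarith [hBlim.1, hBlim.2]

/-- A square permutation whose labels are irregular or not equidistributed. -/
def IsExceptional (t h : ℕ) (r : ℝ) (σ : Equiv.Perm (Fin n)) : Prop :=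
  ¬ (RegularLabels t (columnLabel σ) (rowLabel σ) (σ.symm 0) ∧
    IsEquidistributed h r (σ.symm 0) (columnLabel σ))

open Classical in
-- By injectivity of the encoding, exceptional permutations are no more numerous than exceptional
-- triples. Failure of equidistribution concerns `X` alone, so `Y` is left free.
theorem card_isExceptional_le (t h : ℕ) {r : ℝ} (hr : 0 < r) :
    (((squareFinset n).filter (IsExceptional t h r)).card : ℝ) ≤
      4 ^ n * (irregularBound n t + 4 * numPatterns h * ((4 * h + 1) * n ^ 2 / r ^ 2)) := by
  have h1 : ((squareFinset n).filter (IsExceptional t h r)).card =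
      ∑ z : Fin n, (((squareFinset n).filter (IsExceptional t h r)).filter
        fun σ => σ.symm 0 = z).card :=
    Finset.card_eq_sum_card_fiberwise fun _ _ => Finset.mem_coe.2 (Finset.mem_univ _)
  have h2 : ∀ z : Fin n, (((squareFinset n).filter (IsExceptional t h r)).filter
      fun σ => σ.symm 0 = z).card ≤ irregularCount n t z +
      (Finset.univ.filter fun X : Fin n → Bool => ¬ IsEquidistributed h r z X).card *
        Fintype.card (Fin n → Bool) := by
    intro z
    have hinj : Set.InjOn (fun σ : Equiv.Perm (Fin n) => (columnLabel σ, rowLabel σ))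
        (((squareFinset n).filter (IsExceptional t h r)).filter fun σ => σ.symm 0 = z) := by
      intro σ hσ τ hτ hst
      simp only [Finset.coe_filter, Finset.mem_filter, mem_squareFinset,
        Set.mem_ofPred_eq] at hσ hτ
      apply injOn_encode hσ.1.1 hτ.1.1
      simp only [Prod.mk.injEq] at hst
      simp only [encode, hst.1, hst.2, hσ.2, hτ.2]
    rw [← Finset.card_image_of_injOn hinj, irregularCount, ← Finset.card_univ,
      ← Finset.card_product]
    refine (Finset.card_le_card ?_).trans (Finset.card_union_le _ _)
    intro p hp
    obtain ⟨σ, hmem, rfl⟩ := Finset.mem_image.1 hp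
    obtain ⟨hσ, rfl⟩ := Finset.mem_filter.1 hmem
    have h3 := (Finset.mem_filter.1 hσ).2
    simp only [Finset.mem_union, Finset.mem_filter, Finset.mem_univ, true_and, Finset.mem_product,
      and_true]
    exact not_and_or.1 h3
  have h4 : ∀ z : Fin n, ((((squareFinset n).filter (IsExceptional t h r)).filter
      fun σ => σ.symm 0 = z).card : ℝ) ≤ irregularCount n t z +
      4 * numPatterns h * (2 ^ n * ((4 * h + 1) * n) / r ^ 2) * 2 ^ n := by
    intro z
    have h5 := (Nat.cast_le (α := ℝ)).2 (h2 z)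
    push_cast at h5
    rw [card_words] at h5
    have h6 := mul_le_mul_of_nonneg_right (card_not_isEquidistributed_le (n := n) (h := h)
      (z := z) hr) (show (0 : ℝ) ≤ 2 ^ n by positivity)
    linarith
  rw [h1]
  push_cast
  refine (Finset.sum_le_sum fun z _ => h4 z).trans ?_
  rw [Finset.sum_add_distrib, Finset.sum_const, Finset.card_univ, Fintype.card_fin, nsmul_eq_mul]
  have h7 := sum_irregularCount_le n t
  push_cast at h7
  have four : (4 : ℝ) ^ n = 2 ^ n * 2 ^ n := by rw [← mul_pow]; norm_num
  have h8 : (n : ℝ) * (4 * numPatterns h * (2 ^ n * ((4 * h + 1) * n) / r ^ 2) * 2 ^ n) =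
      4 ^ n * (4 * numPatterns h * ((4 * h + 1) * n ^ 2 / r ^ 2)) := by
    rw [four]
    ring
  rw [h8, mul_add]
  linarith

end Comparison

/-! ### Asymptotics -/

/-- Riemann sums of a continuous function converge to its integral. -/
theorem tendsto_riemannSum {g : ℝ → ℝ} (hg : ContinuousOn g (Icc 0 1)) :
    Tendsto (fun n : ℕ => (∑ z ∈ Finset.range n, g (z / n)) / n) atTop
      (nhds (∫ x in (0 : ℝ)..1, g x)) := by
  rw [Metric.tendsto_atTop]
  intro ε hε
  have huc := isCompact_Icc.uniformContinuousOn_of_continuous hg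
  rw [Metric.uniformContinuousOn_iff] at huc
  obtain ⟨δ, hδ, H⟩ := huc (ε / 2) (by positivity)
  obtain ⟨N, hN⟩ := exists_nat_gt (1 / δ)
  refine ⟨N + 1, fun n hn => ?_⟩
  have hn0 : (0 : ℝ) < n := by exact_mod_cast (by omega : 0 < n)
  have hNn : (N : ℝ) < n := by exact_mod_cast (by omega : N < n)
  have hstep : (1 : ℝ) / n < δ := by
    rw [div_lt_iff₀ hn0, ← div_lt_iff₀' hδ]
    linarith
  have hmem : ∀ z ≤ n, ((z : ℝ) / n) ∈ Icc (0 : ℝ) 1 := fun z hz =>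
    ⟨by positivity, div_le_one_of_le₀ (by exact_mod_cast hz) hn0.le⟩
  have hsub : ∀ z < n, Icc ((z : ℝ) / n) ((z + 1 : ℕ) / n) ⊆ Icc 0 1 := fun z hz =>
    Icc_subset_Icc (hmem z hz.le).1 (hmem (z + 1) hz).2
  have hle : ∀ z : ℕ, (z : ℝ) / n ≤ ((z + 1 : ℕ) : ℝ) / n := fun z => by
    gcongr
    omega
  have hint : ∀ z < n, IntervalIntegrable g volume ((z : ℝ) / n) ((z + 1 : ℕ) / n) := by
    intro z hz
    apply ContinuousOn.intervalIntegrable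
    rw [uIcc_of_le (hle z)]
    exact hg.mono (hsub z hz)
  have htotal : ∫ x in (0 : ℝ)..1, g x =
      ∑ z ∈ Finset.range n, ∫ x in ((z : ℝ) / n)..((z + 1 : ℕ) / n), g x := by
    have := intervalIntegral.sum_integral_adjacent_intervals (a := fun z : ℕ => (z : ℝ) / n) hint
    rw [this]
    simp [div_self hn0.ne']
  rw [htotal, Real.dist_eq, Finset.sum_div, ← Finset.sum_sub_distrib]
  have hterm : ∀ z ∈ Finset.range n, |g (z / n) / n -
      ∫ x in ((z : ℝ) / n)..((z + 1 : ℕ) / n), g x| ≤ ε / 2 * (1 / n) := by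
    intro z hz
    have hz' := Finset.mem_range.1 hz
    have hlen : ((z + 1 : ℕ) : ℝ) / n - z / n = 1 / n := by
      push_cast
      ring
    have e : g (z / n) / n = ∫ _ in ((z : ℝ) / n)..((z + 1 : ℕ) / n), g (z / n) := by
      rw [intervalIntegral.integral_const, hlen, smul_eq_mul]
      ring
    rw [e, ← intervalIntegral.integral_sub intervalIntegrable_const (hint z hz'), ← Real.norm_eq_abs]
    refine (intervalIntegral.norm_integral_le_of_norm_le_const (C := ε / 2) ?_).trans ?_
    · intro x hx
      rw [uIoc_of_le (hle z)] at hx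
      rw [← dist_eq_norm]
      refine (H _ (hmem z hz'.le) _ (hsub z hz' (Ioc_subset_Icc_self hx)) ?_).le
      rw [dist_comm, Real.dist_eq, abs_of_pos (by linarith [hx.1])]
      linarith [hx.2]
    · rw [hlen, abs_of_pos (by positivity)]
  refine lt_of_le_of_lt ((Finset.abs_sum_le_sum_abs _ _).trans (Finset.sum_le_sum hterm)) ?_
  rw [Finset.sum_const, Finset.card_range, nsmul_eq_mul]
  have : (n : ℝ) * (ε / 2 * (1 / n)) = ε / 2 := by
    field_simp
  linarith

/-- The scale of the allowed deviations of prefix counts. -/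
noncomputable def deviationScale (n : ℕ) : ℕ := ⌈(n : ℝ) ^ (3 / 4 : ℝ)⌉₊

theorem tendsto_deviationScale_div :
    Tendsto (fun n : ℕ => (deviationScale n : ℝ) / n) atTop (nhds 0) := by
  have h1 : Tendsto (fun n : ℕ => (n : ℝ) ^ (-(1 / 4) : ℝ) + 1 / (n : ℝ)) atTop (nhds (0 + 0)) :=
    ((tendsto_rpow_neg_atTop (by norm_num : (0 : ℝ) < 1 / 4)).comp
      tendsto_natCast_atTop_atTop).add tendsto_one_div_atTop_nhds_zero_nat
  rw [add_zero] at h1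
  refine squeeze_zero' (Eventually.of_forall fun n => by positivity) ?_ h1
  filter_upwards [eventually_gt_atTop 0] with n hn
  have hn0 : (0 : ℝ) < n := by exact_mod_cast hn
  have h2 : (deviationScale n : ℝ) ≤ (n : ℝ) ^ (3 / 4 : ℝ) + 1 :=
    (Nat.ceil_lt_add_one (by positivity)).le
  have h3 : (n : ℝ) ^ (-(1 / 4) : ℝ) = (n : ℝ) ^ (3 / 4 : ℝ) / n := by
    rw [show (-(1 / 4) : ℝ) = 3 / 4 - 1 by norm_num, Real.rpow_sub_one hn0.ne']
  rw [h3, ← add_div]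
  gcongr

theorem tendsto_deviationScale_atTop : Tendsto deviationScale atTop atTop :=
  (tendsto_nat_ceil_atTop.comp (tendsto_rpow_atTop (by norm_num : (0 : ℝ) < 3 / 4))).comp
    tendsto_natCast_atTop_atTop

/-- The exponent `3/4` balances two needs: `t / n` tends to `0`, while `t ^ 2 / (2 * n)` is at least
`√n / 2`, enough to beat the polynomial factor. -/
theorem tendsto_irregularBound_div :
    Tendsto (fun n : ℕ => (irregularBound n (deviationScale n) + 2) / n) atTop (nhds 0) := by
  have hy : Tendsto (fun n : ℕ => Real.sqrt n / 2) atTop atTop :=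
    (Real.tendsto_sqrt_atTop.comp tendsto_natCast_atTop_atTop).atTop_div_const (by norm_num)
  -- With `y = √n / 2` one has `16 * y ^ 2 = 4 * n`, the leading factor after division by `n`.
  have h1 := ((Real.tendsto_pow_mul_exp_neg_atTop_nhds_zero 2).comp hy).const_mul 16
  have h2 := ((Real.tendsto_pow_mul_exp_neg_atTop_nhds_zero 0).comp hy).const_mul 4
  have h3 := tendsto_deviationScale_div.const_mul 200
  have h4 := (tendsto_one_div_atTop_nhds_zero_nat (𝕜 := ℝ)).const_mul 204
  have h5 := ((h1.add h2).add h3).add h4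
  simp only [mul_zero, add_zero] at h5
  refine squeeze_zero' (Eventually.of_forall fun n => ?_) ?_ h5
  · unfold irregularBound
    positivity
  filter_upwards [eventually_gt_atTop 0] with n hn
  have hn0 : (0 : ℝ) < n := by exact_mod_cast hn
  have hexp : Real.exp (-(deviationScale n : ℝ) ^ 2 / (2 * n)) ≤ Real.exp (-(Real.sqrt n / 2)) := by
    rw [Real.exp_le_exp, div_le_iff₀ (by positivity)]
    have h6 : (n : ℝ) ^ (3 / 4 : ℝ) ≤ deviationScale n := Nat.le_ceil _
    have h7 : ((n : ℝ) ^ (3 / 4 : ℝ)) ^ 2 = n * Real.sqrt n := by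
      rw [← Real.rpow_natCast, ← Real.rpow_mul hn0.le, Real.sqrt_eq_rpow]
      nth_rewrite 2 [← Real.rpow_one (n : ℝ)]
      rw [← Real.rpow_add hn0]
      norm_num
    have h8 : ((n : ℝ) ^ (3 / 4 : ℝ)) ^ 2 ≤ (deviationScale n : ℝ) ^ 2 :=
      pow_le_pow_left₀ (by positivity) h6 2
    linarith
  have hsq : (Real.sqrt n / 2) ^ 2 = n / 4 := by
    rw [div_pow, Real.sq_sqrt hn0.le]
    norm_num
  simp only [Function.comp_apply, hsq, pow_zero, one_mul]
  rw [div_le_iff₀ hn0]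
  unfold irregularBound
  have h9 := mul_le_mul_of_nonneg_left hexp (show (0 : ℝ) ≤ 4 * n * (n + 1) by positivity)
  have h10 : (16 * ((n : ℝ) / 4 * Real.exp (-(Real.sqrt n / 2))) +
      4 * Real.exp (-(Real.sqrt n / 2)) + 200 * (deviationScale n / n) + 204 * (1 / n)) * n =
      4 * n * (n + 1) * Real.exp (-(Real.sqrt n / 2)) + 200 * deviationScale n + 204 := by
    field_simp
    ring
  linarith

/-! ### Averages over square permutations. -/

section Average

variable {n : ℕ} [NeZero n]

theorem sum_squareFinset_lowest (g : Fin n → ℝ) :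
    ∑ σ ∈ squareFinset n, g (σ.symm 0) = ∑ z, (squareCount z : ℝ) * g z := by
  classical
  rw [← Finset.sum_fiberwise (squareFinset n) (fun σ => σ.symm 0)]
  apply Finset.sum_congr rfl
  intro z _
  rw [Finset.sum_congr rfl (g := fun _ => g z) fun σ hσ => by rw [(Finset.mem_filter.1 hσ).2],
    Finset.sum_const, nsmul_eq_mul]
  congr 2
  unfold squareCount
  congr 1
  ext σ
  simp [mem_squareFinset]

/-- A function of the lowest point's column may be averaged as if each column carried exactly `4 ^ n
/ 32` square permutations. -/
theorem abs_sum_lowest_sub_le (t : ℕ) (hn : 1 < n) {g : Fin n → ℝ} {M : ℝ}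
    (hg : ∀ z, |g z| ≤ M) :
    |∑ σ ∈ squareFinset n, g (σ.symm 0) - 4 ^ n / 32 * ∑ z, g z| ≤
      M * (4 ^ n * (irregularBound n t + 2)) := by
  rw [sum_squareFinset_lowest, Finset.mul_sum, ← Finset.sum_sub_distrib]
  have hM : 0 ≤ M := (abs_nonneg _).trans (hg 0)
  calc |∑ z, ((squareCount z : ℝ) * g z - 4 ^ n / 32 * g z)|
      ≤ ∑ z, |(squareCount z : ℝ) * g z - 4 ^ n / 32 * g z| := Finset.abs_sum_le_sum_abs _ _
    _ ≤ ∑ z : Fin n, M * |(squareCount z : ℝ) - 4 ^ n / 32| := by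
        apply Finset.sum_le_sum
        intro z _
        rw [← sub_mul, abs_mul, mul_comm]
        exact mul_le_mul_of_nonneg_right (hg z) (abs_nonneg _)
    _ ≤ _ := by
        rw [← Finset.mul_sum]
        exact mul_le_mul_of_nonneg_left (sum_abs_squareCount_sub_le t hn) hM

theorem abs_card_squareFinset_sub_le (t : ℕ) (hn : 1 < n) :
    |((squareFinset n).card : ℝ) - n * 4 ^ n / 32| ≤ 4 ^ n * (irregularBound n t + 2) := by
  have h := abs_sum_lowest_sub_le t hn (g := fun _ => 1) (M := 1) (by simp)
  simp only [Finset.sum_const, Finset.card_univ, Fintype.card_fin, nsmul_eq_mul, mul_one,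
    one_mul] at h
  rwa [show (4 : ℝ) ^ n / 32 * n = n * 4 ^ n / 32 by ring] at h

end Average

open BoundedContinuousFunction in
-- Non-exceptional permutations contribute at most `ε / 4` each by the local control; exceptional
-- ones are bounded by `2 * ‖F‖` and form a vanishing proportion. The normalization is the
-- asymptotic number of square permutations.
theorem tendsto_sum_sub_sum (F : ProbabilityMeasure RootedPerm →ᵇ ℝ) :
    Tendsto (fun n : ℕ+ => (∑ σ ∈ squareFinset n, (F (rootedLaw σ) -
      F (limitLaw ((σ.symm 0 : Fin n) / (n : ℕ))))) / ((n : ℕ) * 4 ^ (n : ℕ) / 32)) atTop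
      (nhds 0) := by
  classical
  rw [Metric.tendsto_nhds]
  intro ε hε
  obtain ⟨h, η, hη, hcontrol⟩ := exists_local_control F.continuous (show 0 < ε / 4 by positivity)
  have hP : (0 : ℝ) < numPatterns h := by
    exact_mod_cast (Fintype.card_pos : 0 < Fintype.card (Finset.Icc (-(h : ℤ)) h → Bool))
  -- With `r = θ * n`, the frequency error `4 * numPatterns h * r / n` is `η / 2`, leaving `η / 2`
  -- for the corner terms.
  set θ : ℝ := η / (8 * numPatterns h) with hθdef
  have hθ : 0 < θ := by positivity
  set K : ℝ := 4 * numPatterns h * ((4 * h + 1) / θ ^ 2) with hK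
  have hcast : Tendsto (fun n : ℕ+ => (n : ℕ)) atTop atTop := tendsto_PNat_val_atTop_atTop
  have lim1 := tendsto_irregularBound_div.comp hcast
  have lim2 := (tendsto_one_div_atTop_nhds_zero_nat (𝕜 := ℝ)).comp hcast
  have lim3 := tendsto_deviationScale_div.comp hcast
  have limA : Tendsto (fun n : ℕ+ => ε / 4 * (1 + 32 * ((irregularBound n (deviationScale n) + 2) /
      (n : ℕ))) + 2 * ‖F‖ * 32 * ((irregularBound n (deviationScale n) + 2) / (n : ℕ) +
        K * (1 / (n : ℕ)))) atTop
      (nhds (ε / 4 * (1 + 32 * 0) + 2 * ‖F‖ * 32 * (0 + K * 0))) :=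
    (((lim1.const_mul 32).const_add 1).const_mul (ε / 4)).add
      ((lim1.add (lim2.const_mul K)).const_mul (2 * ‖F‖ * 32))
  have limB : Tendsto (fun n : ℕ+ => 120 * ((deviationScale n : ℝ) / (n : ℕ)) +
      (132 + 8 * h) * (1 / (n : ℕ))) atTop (nhds (120 * 0 + (132 + 8 * h) * 0)) :=
    (lim3.const_mul 120).add (lim2.const_mul (132 + 8 * (h : ℝ)))
  filter_upwards [limA.eventually (gt_mem_nhds (show _ < ε / 2 by simp; linarith)),
    limB.eventually (gt_mem_nhds (show _ < η / 2 by simp; exact hη)),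
    (tendsto_deviationScale_atTop.comp hcast).eventually (eventually_ge_atTop h),
    hcast.eventually (eventually_gt_atTop 1)] with n hA hB ht hn1
  have hn : (0 : ℝ) < (n : ℕ) := by exact_mod_cast n.pos
  set t := deviationScale n with htdef
  have ht' : h ≤ t := ht
  set D := irregularBound n t + 2 with hD
  have four : (0 : ℝ) < 4 ^ (n : ℕ) := by positivity
  have hexc := card_isExceptional_le (n := n) t h (r := θ * (n : ℕ)) (by positivity)
  have hcard := abs_card_squareFinset_sub_le (n := n) t hn1
  have hgood : ∀ σ ∈ (squareFinset n).filter fun σ => ¬ IsExceptional t h (θ * (n : ℕ)) σ,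
      |F (rootedLaw σ) - F (limitLaw ((σ.symm 0 : Fin n) / (n : ℕ)))| ≤ ε / 4 := by
    intro σ hσ
    obtain ⟨h1, h2⟩ := Finset.mem_filter.1 hσ
    have h3 := not_not.1 h2
    refine (hcontrol _ (val_div_mem_Icc _) _ fun C hC => ?_).le
    refine (abs_rootedLaw_sub_limitLaw_le (mem_squareFinset.1 h1) ht' h3.1 h3.2 hC).trans ?_
    rw [div_le_iff₀ hn]
    have h4 : 4 * numPatterns h * (θ * (n : ℕ)) = η / 2 * (n : ℕ) := by
      rw [hθdef]
      field_simp
      ring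
    have h5 := mul_lt_mul_of_pos_right hB hn
    have h6 : (120 * ((t : ℝ) / (n : ℕ)) + (132 + 8 * h) * (1 / (n : ℕ))) * (n : ℕ) =
        120 * t + (132 + 8 * h) := by
      field_simp
    rw [h6] at h5
    rw [h4]
    linarith
  have hbad : ∀ σ ∈ (squareFinset n).filter fun σ => IsExceptional t h (θ * (n : ℕ)) σ,
      |F (rootedLaw σ) - F (limitLaw ((σ.symm 0 : Fin n) / (n : ℕ)))| ≤ 2 * ‖F‖ := by
    intro σ _
    have h1 := F.norm_coe_le_norm (rootedLaw σ)
    have h2 := F.norm_coe_le_norm (limitLaw ((σ.symm 0 : Fin n) / (n : ℕ)))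
    rw [← Real.norm_eq_abs]
    exact (norm_sub_le _ _).trans (by linarith)
  have hsum : |∑ σ ∈ squareFinset n, (F (rootedLaw σ) -
      F (limitLaw ((σ.symm 0 : Fin n) / (n : ℕ))))| ≤
      ε / 4 * (squareFinset n).card +
        2 * ‖F‖ * ((squareFinset n).filter (IsExceptional t h (θ * (n : ℕ)))).card := by
    refine (Finset.abs_sum_le_sum_abs _ _).trans ?_
    rw [← Finset.sum_filter_add_sum_filter_not (squareFinset n)
      (fun σ => IsExceptional t h (θ * (n : ℕ)) σ), add_comm]
    refine add_le_add ((Finset.sum_le_sum hgood).trans ?_) ((Finset.sum_le_sum hbad).trans ?_)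
    · rw [Finset.sum_const, nsmul_eq_mul, mul_comm]
      refine mul_le_mul_of_nonneg_left ?_ (by positivity)
      exact_mod_cast Finset.card_filter_le _ _
    · rw [Finset.sum_const, nsmul_eq_mul, mul_comm]
  rw [Real.dist_eq, sub_zero, abs_div, abs_of_pos (show (0 : ℝ) < (n : ℕ) * 4 ^ (n : ℕ) / 32 by
    positivity), div_lt_iff₀ (by positivity)]
  refine lt_of_le_of_lt hsum ?_
  have hcard' : ((squareFinset n).card : ℝ) ≤ (1 + 32 * (D / (n : ℕ))) *
      ((n : ℕ) * 4 ^ (n : ℕ) / 32) := by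
    have h1 := (abs_le.1 hcard).2
    have h2 : (1 + 32 * (D / (n : ℕ))) * ((n : ℕ) * 4 ^ (n : ℕ) / 32) =
        (n : ℕ) * 4 ^ (n : ℕ) / 32 + 4 ^ (n : ℕ) * D := by
      field_simp
    rw [h2]
    linarith
  have hexc' : (((squareFinset n).filter (IsExceptional t h (θ * (n : ℕ)))).card : ℝ) ≤
      32 * (D / (n : ℕ) + K * (1 / (n : ℕ))) * ((n : ℕ) * 4 ^ (n : ℕ) / 32) := by
    refine hexc.trans ?_
    -- As `r` is proportional to `n`, the Chebyshev term is constant, hence negligible after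
    -- division by `n`.
    have h1 : 4 * (numPatterns h : ℝ) * ((4 * h + 1) * (n : ℕ) ^ 2 / (θ * (n : ℕ)) ^ 2) = K := by
      rw [hK]
      field_simp
    have h2 : 32 * (D / (n : ℕ) + K * (1 / (n : ℕ))) * ((n : ℕ) * 4 ^ (n : ℕ) / 32) =
        4 ^ (n : ℕ) * (D + K) := by
      field_simp
    rw [h1, h2]
    apply mul_le_mul_of_nonneg_left _ four.le
    rw [hD]
    linarith
  calc ε / 4 * (squareFinset n).card +
        2 * ‖F‖ * ((squareFinset n).filter (IsExceptional t h (θ * (n : ℕ)))).card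
      ≤ ε / 4 * ((1 + 32 * (D / (n : ℕ))) * ((n : ℕ) * 4 ^ (n : ℕ) / 32)) +
        2 * ‖F‖ * (32 * (D / (n : ℕ) + K * (1 / (n : ℕ))) * ((n : ℕ) * 4 ^ (n : ℕ) / 32)) := by
        gcongr
    _ = (ε / 4 * (1 + 32 * (D / (n : ℕ))) + 2 * ‖F‖ * 32 * (D / (n : ℕ) + K * (1 / (n : ℕ)))) *
        ((n : ℕ) * 4 ^ (n : ℕ) / 32) := by ring
    _ < ε * ((n : ℕ) * 4 ^ (n : ℕ) / 32) := by
        apply mul_lt_mul_of_pos_right _ (by positivity)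
        linarith

open BoundedContinuousFunction in
-- Near-uniformity of `z` turns the sum into a Riemann sum of `u ↦ F (limitLaw u)`, which is
-- continuous on the unit interval.
theorem tendsto_sum_limitLaw (F : ProbabilityMeasure RootedPerm →ᵇ ℝ) :
    Tendsto (fun n : ℕ+ => (∑ σ ∈ squareFinset n,
      F (limitLaw ((σ.symm 0 : Fin n) / (n : ℕ)))) / ((n : ℕ) * 4 ^ (n : ℕ) / 32)) atTop
      (nhds (∫ u in (0 : ℝ)..1, F (limitLaw u))) := by
  have hcast : Tendsto (fun n : ℕ+ => (n : ℕ)) atTop atTop := tendsto_PNat_val_atTop_atTop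
  have hR := (tendsto_riemannSum (g := fun u => F (limitLaw u))
    (F.continuous.comp_continuousOn continuousOn_limitLaw)).comp hcast
  have hD := ((tendsto_irregularBound_div.comp hcast).const_mul (32 * ‖F‖))
  rw [mul_zero] at hD
  refine tendsto_of_tendsto_of_dist hR ?_
  refine squeeze_zero' (Eventually.of_forall fun n => dist_nonneg) ?_ hD
  filter_upwards [hcast.eventually (eventually_gt_atTop 1)] with n hn1
  have hn : (0 : ℝ) < (n : ℕ) := by exact_mod_cast n.pos
  have h1 := abs_sum_lowest_sub_le (n := n) (deviationScale n) hn1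
    (g := fun z => F (limitLaw ((z : ℕ) / (n : ℕ)))) (M := ‖F‖)
    (fun z => by rw [← Real.norm_eq_abs]; exact F.norm_coe_le_norm _)
  rw [Fin.sum_univ_eq_sum_range (fun z => F (limitLaw ((z : ℝ) / (n : ℕ)))) n] at h1
  have hpos : (0 : ℝ) < (n : ℕ) * 4 ^ (n : ℕ) / 32 := by positivity
  rw [dist_comm, Real.dist_eq]
  simp only [Function.comp_apply]
  rw [← mul_le_mul_iff_left₀ hpos, ← abs_of_pos hpos, ← abs_mul, abs_of_pos hpos, sub_mul,
    div_mul_cancel₀ _ hpos.ne']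
  refine le_trans (le_of_eq ?_) (h1.trans (le_of_eq ?_))
  · congr 2
    field_simp
  · field_simp

/-- The functional constantly `1` counts: square permutations number asymptotically `n * 4 ^ n /
32`. -/
theorem tendsto_card_squareFinset :
    Tendsto (fun n : ℕ+ => ((squareFinset n).card : ℝ) / ((n : ℕ) * 4 ^ (n : ℕ) / 32)) atTop
      (nhds 1) := by
  have h := tendsto_sum_limitLaw (BoundedContinuousFunction.const _ 1)
  simpa using h

open BoundedContinuousFunction in
/-- The average of a continuous functional of the rooted law over all square permutations. -/
theorem tendsto_average_rootedLaw (F : ProbabilityMeasure RootedPerm →ᵇ ℝ) :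
    Tendsto (fun n : ℕ+ => (∑ σ ∈ squareFinset n, F (rootedLaw σ)) / (squareFinset n).card) atTop
      (nhds (∫ u in (0 : ℝ)..1, F (limitLaw u))) := by
  have h1 := (tendsto_sum_sub_sum F).add (tendsto_sum_limitLaw F)
  rw [zero_add] at h1
  have h2 := h1.div tendsto_card_squareFinset one_ne_zero
  rw [div_one] at h2
  refine h2.congr fun n => ?_
  have hpos : (0 : ℝ) < (n : ℕ) * 4 ^ (n : ℕ) / 32 := by
    have hn : (0 : ℝ) < (n : ℕ) := by exact_mod_cast n.pos
    positivity
  simp only [Pi.div_apply]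
  rw [← add_div, ← Finset.sum_add_distrib, div_div_div_cancel_right₀ hpos.ne']
  simp

/-! ### Conditional laws under independence. -/

section ConditionalLaw

variable {Ω S T W : Type*} [MeasurableSpace Ω] [MeasurableSpace S] [StandardBorelSpace S]
  [Nonempty S] [MeasurableSpace T] [MeasurableSpace W]

theorem aemeasurable_condLaw {Y : Ω → S} {X : Ω → T} {P : Measure Ω} [IsProbabilityMeasure P]
    (hX : AEMeasurable X P) : AEMeasurable (condLaw Y X P) P := by
  have h : Measurable fun t => (⟨condDistrib Y X P t, inferInstance⟩ : ProbabilityMeasure S) :=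
    (condDistrib Y X P).measurable.subtype_mk
  exact h.comp_aemeasurable hX

/-- The conditional law of `g (X, Z)` given `X`, for `Z` independent of `X`. -/
theorem condLaw_ae_eq_of_indepFun {X : Ω → T} {Z : Ω → W} {P : Measure Ω} [IsProbabilityMeasure P]
    (hX : AEMeasurable X P) (hZ : AEMeasurable Z P) (hXZ : IndepFun X Z P) {g : T × W → S}
    (hg : Measurable g) {κ : T → ProbabilityMeasure S}
    (hκ : ∀ t, (κ t : Measure S) = (P.map Z).map fun w => g (t, w)) :
    condLaw (fun ω => g (X ω, Z ω)) X P =ᵐ[P] fun ω => κ (X ω) := by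
  have : IsProbabilityMeasure (P.map Z) := Measure.isProbabilityMeasure_map hZ
  let k : Kernel T S := (Kernel.id ×ₖ Kernel.const T (P.map Z)).map g
  have hk : ∀ t, k t = κ t := by
    intro t
    rw [hκ, Kernel.map_apply _ hg, Kernel.prod_apply, Kernel.id_apply, Kernel.const_apply,
      Measure.dirac_prod, Measure.map_map hg (by fun_prop)]
    rfl
  have : IsMarkovKernel k := Kernel.IsMarkovKernel.map _ hg
  have hpair : AEMeasurable (fun ω => (X ω, Z ω)) P := hX.prodMk hZ
  have hY : AEMeasurable (fun ω => g (X ω, Z ω)) P := hg.comp_aemeasurable hpair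
  have hprod : P.map (fun ω => (X ω, Z ω)) = (P.map X).prod (P.map Z) :=
    (indepFun_iff_map_prod_eq_prod_map_map hX hZ).1 hXZ
  -- The kernel `t ↦ law of g (t, Z)` disintegrates the joint law, and disintegrations are almost
  -- surely unique.
  have key : P.map (fun ω => (X ω, g (X ω, Z ω))) = P.map X ⊗ₘ k := by
    have hg' : Measurable fun p : T × W => (p.1, g p) := measurable_fst.prodMk hg
    have e : P.map (fun ω => (X ω, g (X ω, Z ω))) =
        (P.map fun ω => (X ω, Z ω)).map fun p => (p.1, g p) :=
      (AEMeasurable.map_map_of_aemeasurable hg'.aemeasurable hpair).symm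
    have : IsProbabilityMeasure (P.map X) := Measure.isProbabilityMeasure_map hX
    ext s hs
    rw [e, hprod, Measure.map_apply hg' hs, Measure.prod_apply (hg' hs),
      Measure.compProd_apply hs]
    refine lintegral_congr fun t => ?_
    rw [hk, hκ, Measure.map_apply (by fun_prop) (measurable_prodMk_left hs)]
    rfl
  have h := ae_of_ae_map hX (condDistrib_ae_eq_of_measure_eq_compProd X hY key)
  filter_upwards [h] with ω hω
  apply Subtype.ext
  exact hω.trans (hk _)

theorem integral_comp_of_indepFun {X : Ω → T} {Z : Ω → W} {P : Measure Ω} [IsProbabilityMeasure P]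
    {m : Measure T} {m' : Measure W} [SFinite m] [SFinite m'] (hX : HasLaw X m P)
    (hZ : HasLaw Z m' P)
    (hXZ : IndepFun X Z P) {f : T × W → ℝ} (hf : Measurable f) {C : ℝ} (hC : ∀ p, |f p| ≤ C) :
    ∫ ω, f (X ω, Z ω) ∂P = ∫ t, ∫ w, f (t, w) ∂m' ∂m := by
  have : IsProbabilityMeasure m := hX.map_eq ▸ Measure.isProbabilityMeasure_map hX.aemeasurable
  have : IsProbabilityMeasure m' := hZ.map_eq ▸ Measure.isProbabilityMeasure_map hZ.aemeasurable
  have hprod : P.map (fun ω => (X ω, Z ω)) = m.prod m' := by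
    rw [(indepFun_iff_map_prod_eq_prod_map_map hX.aemeasurable hZ.aemeasurable).1 hXZ,
      hX.map_eq, hZ.map_eq]
  rw [← integral_prod, ← hprod, integral_map (hX.aemeasurable.prodMk hZ.aemeasurable)]
  · exact hf.aestronglyMeasurable
  · exact Integrable.of_bound hf.aestronglyMeasurable C (Eventually.of_forall hC)

end ConditionalLaw

/-! ### Convergence in distribution through test functions, and integrals of the limit. -/

theorem tendstoInDistribution_of_integral {E : Type*} [TopologicalSpace E] [MeasurableSpace E]
    [OpensMeasurableSpace E] {Ω : ℕ+ → Type*} [∀ n, MeasurableSpace (Ω n)]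
    {P : ∀ n, Measure (Ω n)} [∀ n, IsProbabilityMeasure (P n)] {X : ∀ n, Ω n → E}
    {Ω' : Type*} [MeasurableSpace Ω'] {P' : Measure Ω'} [IsProbabilityMeasure P'] {Z : Ω' → E}
    (hX : ∀ n, AEMeasurable (X n) (P n)) (hZ : AEMeasurable Z P')
    (h : ∀ F : BoundedContinuousFunction E ℝ,
      Tendsto (fun n => ∫ ω, F (X n ω) ∂(P n)) atTop (nhds (∫ ω, F (Z ω) ∂P'))) :
    TendstoInDistribution X atTop Z P P' := by
  refine ⟨hX, hZ, ?_⟩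
  refine ProbabilityMeasure.tendsto_iff_forall_integral_tendsto.2 fun F => ?_
  have := h F
  refine Tendsto.congr ?_ (this.trans_eq ?_)
  · intro n
    exact (integral_map (hX n) F.continuous.measurable.aestronglyMeasurable).symm
  · rw [← integral_map hZ F.continuous.measurable.aestronglyMeasurable]
    rfl

theorem integral_uniformOn_squarePerms {n : ℕ} (f : Equiv.Perm (Fin n) → ℝ) :
    ∫ σ, f σ ∂(uniformOn (squarePerms n)) =
      (∑ σ ∈ squareFinset n, f σ) / (squareFinset n).card := by
  classical
  have hset : squarePerms n = (squareFinset n : Set (Equiv.Perm (Fin n))) := by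
    ext σ
    simp [mem_squareFinset]
  rw [hset, integral_fintype .of_finite]
  have hval : ∀ σ, (uniformOn (squareFinset n : Set (Equiv.Perm (Fin n)))).real {σ} =
      if σ ∈ squareFinset n then ((squareFinset n).card : ℝ)⁻¹ else 0 := by
    intro σ
    rw [Measure.real, uniformOn, cond_apply (Set.toFinite _).measurableSet,
      Measure.count_apply_finset]
    split_ifs with h
    · rw [inter_eq_right.2 (by simpa using h)]
      simp
    · rw [show (squareFinset n : Set (Equiv.Perm (Fin n))) ∩ {σ} = ∅ by
        ext τ; simp only [mem_inter_iff, Finset.mem_coe, mem_singleton_iff, mem_empty_iff_false,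
          iff_false]; rintro ⟨h1, rfl⟩; exact h h1]
      simp
  simp only [hval, smul_eq_mul, ite_mul, zero_mul]
  rw [← Finset.sum_filter, Finset.filter_mem_eq_inter, Finset.univ_inter, Finset.sum_div]
  exact Finset.sum_congr rfl fun σ _ => by ring

theorem hasLaw_bernoulliLaw {Ω : Type*} [MeasurableSpace Ω] {P : Measure Ω}
    [IsProbabilityMeasure P] {L : ℤ → Ω → Bool}
    (hL : ∀ x, HasLaw (L x) (uniformOn Set.univ) P) (hLind : iIndepFun L P) :
    HasLaw (fun ω x => L x ω) bernoulliLaw P :=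
  iIndepFun.hasLaw_infinitePi hL hLind (aemeasurable_pi_lambda _ fun x => (hL x).aemeasurable)

/-- The mixture over types, now for test functions: integrate the labels first, then `v` through its
type. -/
theorem integral_limitLaw {u : ℝ} (hu : u ∈ Icc (0 : ℝ) 1)
    (f : BoundedContinuousFunction RootedPerm ℝ) :
    ∫ x, f x ∂(limitLaw u : Measure RootedPerm) =
      ∑ j, caseProb j u * ∫ l, f (labelPerm j l) ∂bernoulliLaw := by
  have hm : Measurable (caseJ u) := measurable_caseJ.comp (measurable_const.prodMk measurable_id)
  have hfm : Measurable fun p : Fin 4 × (ℤ → Bool) => f (labelPerm p.1 p.2) :=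
    f.continuous.measurable.comp measurable_labelPerm
  change ∫ x, f x ∂((unitLaw.prod bernoulliLaw).map (limitPerm u)) = _
  rw [integral_map (measurable_limitPerm_right u).aemeasurable
    f.continuous.measurable.aestronglyMeasurable, integral_prod]
  · have e : ∫ v, ∫ l, f (limitPerm u (v, l)) ∂bernoulliLaw ∂unitLaw =
        ∫ j, ∫ l, f (labelPerm j l) ∂bernoulliLaw ∂(unitLaw.map (caseJ u)) :=
      (integral_map (f := fun j => ∫ l, f (labelPerm j l) ∂bernoulliLaw) hm.aemeasurable
        (measurable_of_countable _).aestronglyMeasurable).symm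
    have : IsProbabilityMeasure (unitLaw.map (caseJ u)) :=
      Measure.isProbabilityMeasure_map hm.aemeasurable
    rw [e, integral_fintype .of_finite]
    refine Finset.sum_congr rfl fun j _ => ?_
    rw [map_measureReal_apply hm (measurableSet_singleton j), smul_eq_mul,
      ← unitLaw_real_caseJ hu j]
    rfl
  · exact Integrable.of_bound
      (f.continuous.measurable.comp (measurable_limitPerm_right u)).aestronglyMeasurable ‖f‖
      (Eventually.of_forall fun p => f.norm_coe_le_norm _)

theorem integral_caseProb (j : Fin 4) : ∫ u in (0 : ℝ)..1, caseProb j u = 1 / 4 := by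
  have hint : ∀ a b : ℝ, IntervalIntegrable (caseProb j) volume a b :=
    fun a b => (continuous_caseProb j).intervalIntegrable a b
  rw [← intervalIntegral.integral_add_adjacent_intervals (hint 0 (1 / 2)) (hint (1 / 2) 1)]
  -- Every `caseProb j` is affine on each half of the unit interval.
  have hI : ∀ {a b c d : ℝ}, a ≤ b → (∀ u ∈ Icc a b, caseProb j u = c + d * u) →
      ∫ u in a..b, caseProb j u = c * (b - a) + d * ((b ^ 2 - a ^ 2) / 2) := by
    intro a b c d hab h
    rw [intervalIntegral.integral_congr (g := fun u => c + d * u)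
      (by rw [uIcc_of_le hab]; exact h), intervalIntegral.integral_add
      (f := fun _ => c) (g := fun u => d * u) intervalIntegrable_const
      ((continuous_const.mul continuous_id).intervalIntegrable _ _)]
    rw [intervalIntegral.integral_const, intervalIntegral.integral_const_mul, integral_id,
      smul_eq_mul, mul_comm c]
  fin_cases j
  · rw [hI (c := 1) (d := -2) (by norm_num), hI (c := 0) (d := 0) (by norm_num)]
    · norm_num
    · rintro u ⟨h1, h2⟩
      simp only [caseProb]
      rw [max_eq_left] <;> linarith
    · rintro u ⟨h1, h2⟩
      simp only [caseProb]
      rw [max_eq_right] <;> linarith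
  · rw [hI (c := 0) (d := 1) (by norm_num), hI (c := 1) (d := -1) (by norm_num)]
    · norm_num
    · rintro u ⟨h1, h2⟩
      simp only [caseProb]
      rw [min_eq_right] <;> linarith
    · rintro u ⟨h1, h2⟩
      simp only [caseProb]
      rw [min_eq_left] <;> linarith
  · rw [hI (c := 0) (d := 1) (by norm_num), hI (c := 1) (d := -1) (by norm_num)]
    · norm_num
    · rintro u ⟨h1, h2⟩
      simp only [caseProb]
      rw [min_eq_right] <;> linarith
    · rintro u ⟨h1, h2⟩
      simp only [caseProb]
      rw [min_eq_left] <;> linarith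
  · rw [hI (c := 0) (d := 0) (by norm_num), hI (c := -1) (d := 2) (by norm_num)]
    · norm_num
    · rintro u ⟨h1, h2⟩
      simp only [caseProb]
      rw [max_eq_right] <;> linarith
    · rintro u ⟨h1, h2⟩
      simp only [caseProb]
      rw [max_eq_left] <;> linarith

/-- Forgetting `U` makes the four types equally likely, which is why the annealed limit has a
uniform index `K` independent of the labels. -/
theorem integral_integral_limitLaw (f : BoundedContinuousFunction RootedPerm ℝ) :
    ∫ u in (0 : ℝ)..1, ∫ x, f x ∂(limitLaw u : Measure RootedPerm) =
      ∫ j, ∫ l, f (labelPerm j l) ∂bernoulliLaw ∂(uniformOn univ : Measure (Fin 4)) := by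
  rw [intervalIntegral.integral_congr
    (g := fun u => ∑ j, caseProb j u * ∫ l, f (labelPerm j l) ∂bernoulliLaw)
    (by rw [uIcc_of_le zero_le_one]; exact fun u hu => integral_limitLaw hu f),
    intervalIntegral.integral_finsetSum
      (f := fun j u => caseProb j u * ∫ l, f (labelPerm j l) ∂bernoulliLaw) fun j _ =>
      ((continuous_caseProb j).mul continuous_const).intervalIntegrable _ _,
    integral_fintype .of_finite]
  refine Finset.sum_congr rfl fun j _ => ?_
  rw [intervalIntegral.integral_mul_const, integral_caseProb, smul_eq_mul]
  congr 1
  rw [Measure.real, uniformOn_univ]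
  simp

/-- Integration of a continuous function, as a continuous function of the measure. -/
noncomputable def integralFunctional (f : BoundedContinuousFunction RootedPerm ℝ) :
    BoundedContinuousFunction (ProbabilityMeasure RootedPerm) ℝ :=
  BoundedContinuousFunction.mkOfCompact ⟨fun μ => ∫ x, f x ∂(μ : Measure RootedPerm),
    ProbabilityMeasure.continuous_integral_boundedContinuousFunction f⟩

/-- Continuity of `limitLaw` is known on the unit interval only, so measurability is asserted only
up to null sets of the uniform law. -/
theorem integral_limitLaw_comp {Ω : Type*} [MeasurableSpace Ω] {P : Measure Ω} {U : Ω → ℝ}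
    (hU : HasLaw U unitLaw P)
    (F : BoundedContinuousFunction (ProbabilityMeasure RootedPerm) ℝ) :
    ∫ ω, F (limitLaw (U ω)) ∂P = ∫ u in (0 : ℝ)..1, F (limitLaw u) := by
  have h : AEStronglyMeasurable (fun u => F (limitLaw u)) unitLaw :=
    (F.continuous.comp_continuousOn continuousOn_limitLaw).aestronglyMeasurable measurableSet_Icc
  rw [intervalIntegral.integral_of_le zero_le_one, ← integral_Icc_eq_integral_Ioc]
  change _ = ∫ u, F (limitLaw u) ∂unitLaw
  rw [← hU.map_eq] at h ⊢
  exact (integral_map hU.aemeasurable h).symm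

theorem theorem6p2
    -- a uniform random square permutation `σ n` of each size `n ≥ 1`, and an independent uniform
    -- root `i n`
    {Ω : ℕ+ → Type*} [∀ n, MeasurableSpace (Ω n)] (P : ∀ n, Measure (Ω n))
    [∀ n, IsProbabilityMeasure (P n)]
    (σ : ∀ n : ℕ+, Ω n → Equiv.Perm (Fin n)) (i : ∀ n : ℕ+, Ω n → Fin n)
    (hσ : ∀ n : ℕ+, HasLaw (σ n) (uniformOn (squarePerms n)) (P n))
    (hi : ∀ n : ℕ+, HasLaw (i n) (uniformOn Set.univ) (P n))
    (hσi : ∀ n : ℕ+, IndepFun (σ n) (i n) (P n))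
    -- independent uniform variables `U`, `V` on `[0,1]` and a Bernoulli labeling `L` of `ℤ`
    {Ω' : Type*} [MeasurableSpace Ω'] (P' : Measure Ω') [IsProbabilityMeasure P']
    (U V : Ω' → ℝ) (L : ℤ → Ω' → Bool)
    (hU : HasLaw U (volume.restrict (Set.Icc 0 1)) P')
    (hV : HasLaw V (volume.restrict (Set.Icc 0 1)) P')
    (hL : ∀ x, HasLaw (L x) (uniformOn Set.univ) P')
    (hLind : iIndepFun L P')
    (hUV : IndepFun U V P')
    (hUVL : IndepFun (fun ω => (U ω, V ω)) (fun ω x => L x ω) P')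
    -- a Bernoulli labeling `M` of `ℤ` and an independent uniform index `K`
    {Ω'' : Type*} [MeasurableSpace Ω''] (P'' : Measure Ω'') [IsProbabilityMeasure P'']
    (K : Ω'' → Fin 4) (M : ℤ → Ω'' → Bool)
    (hK : HasLaw K (uniformOn Set.univ) P'')
    (hM : ∀ x, HasLaw (M x) (uniformOn Set.univ) P'')
    (hMind : iIndepFun M P'')
    (hKM : IndepFun K (fun ω x => M x ω) P'') :
    TendstoQuenchedBS P σ i P'
      (condLaw (fun ω => labelPerm (caseJ (U ω) (V ω)) (fun x => L x ω)) U P') ∧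
    TendstoAnnealedBS P σ i P'' (fun ω => labelPerm (K ω) (fun x => M x ω)) := by
  have hlab := hasLaw_bernoulliLaw hL hLind
  have hlabM := hasLaw_bernoulliLaw hM hMind
  have hperm : ∀ n : ℕ+, Measurable
      fun p : Equiv.Perm (Fin n) × Fin n => ofPerm p.1 p.2 := fun n => measurable_of_countable _
  constructor
  · have hn : ∀ n, condLaw (fun ω => ofPerm (σ n ω) (i n ω)) (σ n) (P n) =ᵐ[P n]
        fun ω => rootedLaw (σ n ω) := fun n =>
      condLaw_ae_eq_of_indepFun (hσ n).aemeasurable (hi n).aemeasurable (hσi n) (hperm n)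
        fun τ => by rw [(hi n).map_eq]; rfl
    have hVL : P'.map (fun ω => (V ω, fun x => L x ω)) = unitLaw.prod bernoulliLaw := by
      have hVL' : IndepFun V (fun ω x => L x ω) P' := hUVL.comp measurable_snd measurable_id
      rw [(indepFun_iff_map_prod_eq_prod_map_map hV.aemeasurable hlab.aemeasurable).1 hVL',
        hV.map_eq, hlab.map_eq]
      rfl
    -- The hypotheses give `U ⟂ V` and `(U, V) ⟂ L`; reassociating the product law yields `U ⟂ (V,
    -- L)`, the form required for the conditional law given `U`.
    have hUVL' : IndepFun U (fun ω => (V ω, fun x => L x ω)) P' := by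
      have hUVm := hU.aemeasurable.prodMk hV.aemeasurable
      rw [indepFun_iff_map_prod_eq_prod_map_map hU.aemeasurable
        (hV.aemeasurable.prodMk hlab.aemeasurable), hVL, hU.map_eq]
      have h1 := (indepFun_iff_map_prod_eq_prod_map_map hUVm hlab.aemeasurable).1 hUVL
      rw [(indepFun_iff_map_prod_eq_prod_map_map hU.aemeasurable hV.aemeasurable).1 hUV,
        hU.map_eq, hV.map_eq, hlab.map_eq] at h1
      change _ = unitLaw.prod (unitLaw.prod bernoulliLaw)
      rw [← Measure.prodAssoc_prod]
      rw [show (unitLaw.prod unitLaw).prod bernoulliLaw = _ from h1.symm,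
        AEMeasurable.map_map_of_aemeasurable
        MeasurableEquiv.prodAssoc.measurable.aemeasurable (hUVm.prodMk hlab.aemeasurable)]
      rfl
    have hlim : condLaw (fun ω => labelPerm (caseJ (U ω) (V ω)) (fun x => L x ω)) U P' =ᵐ[P']
        fun ω => limitLaw (U ω) :=
      condLaw_ae_eq_of_indepFun hU.aemeasurable (hV.aemeasurable.prodMk hlab.aemeasurable) hUVL'
        measurable_limitPerm fun u => by rw [hVL]; rfl
    refine tendstoInDistribution_of_integral (fun n => aemeasurable_condLaw (hσ n).aemeasurable)
      (aemeasurable_condLaw hU.aemeasurable) fun F => ?_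
    rw [integral_congr_ae (f := fun ω => F (condLaw _ U P' ω)) (g := fun ω => F (limitLaw (U ω))) (hlim.fun_comp F), integral_limitLaw_comp hU]
    refine (tendsto_average_rootedLaw F).congr fun n => ?_
    rw [integral_congr_ae (f := fun ω => F (condLaw _ (σ n) (P n) ω))
      (g := fun ω => F (rootedLaw (σ n ω))) ((hn n).fun_comp F), ← integral_uniformOn_squarePerms, ← (hσ n).map_eq,
      integral_map (hσ n).aemeasurable (measurable_of_countable _).aestronglyMeasurable]
  · refine tendstoInDistribution_of_integral (fun n => (hperm n).comp_aemeasurable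
      ((hσ n).aemeasurable.prodMk (hi n).aemeasurable)) (measurable_labelPerm.comp_aemeasurable
      (hK.aemeasurable.prodMk hlabM.aemeasurable)) fun f => ?_
    rw [integral_comp_of_indepFun hK hlabM hKM (f := fun p => f (labelPerm p.1 p.2)) (C := ‖f‖)
      (f.continuous.measurable.comp measurable_labelPerm) (fun p => f.norm_coe_le_norm _)]
    -- The annealed expectation of `f` is the mean over `σ` of its quenched expectations, i.e. the
    -- average of a linear functional of the rooted law.
    refine ((tendsto_average_rootedLaw (integralFunctional f)).congr fun n => ?_).trans_eq
      (congrArg nhds (integral_integral_limitLaw f))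
    rw [integral_comp_of_indepFun (hσ n) (hi n) (hσi n)
      (f := fun p => f (ofPerm p.1 p.2)) (C := ‖f‖)
      (f.continuous.measurable.comp (hperm n)) (fun p => f.norm_coe_le_norm _),
      integral_uniformOn_squarePerms]
    congr 1
    refine Finset.sum_congr rfl fun τ _ => ?_
    exact integral_map (measurable_of_countable _).aemeasurable
      f.continuous.measurable.aestronglyMeasurable
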